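/- Let $k\ge 1$, $0<p_1<\dots<p_k<l$, and let $\nu_1,\dots,\nu_k\in\mathbb R^3=\mathrm{Im}\,\mathbb H$ be distinct. Put $p_0=0$, $p_{k+1}=l$, and cut the circle $\mathbb R/l\mathbb Z$ at $0$ and at the $p_\sigma$ into the closed intervals $\mathcal I_i=[p_i,p_{i+1}]$, $i=0,\dots,k$; each $p_\sigma$ has two copies, $p_\sigma-$ (right end of $\mathcal I_{\sigma-1}$) and $p_\sigma+$ (left end of $\mathcal I_\sigma$). The data of the small representation of the affine $A_{k-1}$ bow form the flat hyperkähler Hilbert space $$\mathrm{Dat}=L^2([0,l],\mathbb H)\oplus S^{k}\ni\big(T=t_0+\textstyle\sum_j t_j\mathbf e_j,\ (b_\sigma)_{\sigma=1}^k\big),\qquad g=\int_0^l|\delta T|^2ds+\sum_\sigma|\delta b_\sigma|^2,$$ where $S\cong\mathbb C^2\cong\mathbb H$, the $\mathbf e_j$ act by left multiplication, the scalar $\mathrm i$ acts by right multiplication by $\mathbf e_1$, and $\omega_j=g(\mathbf e_j\cdot,\cdot)$. The group $\mathcal G^0$ of unitary $H^1$ functions $g$ on $\bigsqcup_i\mathcal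 I_i$ with $g(0)=g(l)=1$ acts by $\mathrm i t_0\mapsto \mathrm i t_0+g^{-1}g'$, $t_j\mapsto t_j$, $b_\sigma\mapsto b_\sigma\,g(p_\sigma-)^{-1}g(p_\sigma+)$. For $b\in S$ let $\vec r(b)=-\mathrm{Im}\,\mathrm i bb^\dagger\in\mathbb R^3$. For real $H^1$ functions $f$ on $\bigsqcup_i\mathcal I_i$ with $f(0)=f(l)$ put $$\mu_j[f]=\int f'\,t_j\,ds+\sum_\sigma\big(f(p_\sigma+)-f(p_\sigma-)\big)\,r_j(b_\sigma),$$ and let $N$ be the set of data with $\mu_j[f]=\sum_\sigma\nu_{\sigma,j}\,(f(p_\sigma-)-f(p_\sigma+))$ for all $j$ and $f$ (the level $\mathrm i\nu$ with $\nu=\sum_\sigma\nu_\sigma(\delta_{p_\sigma-}-\delta_{p_\sigma+})$). Let $\rho:N\to M=N/\mathcal G^0$ be the quotient map. 1. $\mu$ is the hyperkähler moment map: $d\mu_j[f]=\omega_j(X_f,\cdot)$, where $X_f$ is the vector field generated by $\mathrm i f$. The space $M$, with the quotient topology, carries a structure of a smooth (Hausdorff, second countable) four-manifold for which $\rho$ is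 smooth and has smooth local sections, a Riemannian metric $g$ for which $\rho$ is a Riemannian submersion, and closed two-forms with $\rho^*\Omega_j=\omega_j|_N$; they make $M$ a hyperkähler manifold. 2. $M$ is the $k$-centred multi-Taub-NUT space. On each datum in $N$ the $t_j$ are constant and $\vec r(b_\sigma)=\vec t-\vec\nu_\sigma$ for every $\sigma$; $\vec t$ defines a smooth surjection $\pi:M\to\mathbb R^3$. Multiplying any one of the $b_\sigma$ by $e^{-\mathrm i\varepsilon}$ defines one and the same smooth, isometric and triholomorphic circle action on $M$. Its orbits are the fibres of $\pi$; it has exactly one fixed point over each $\vec\nu_\sigma$ and is free elsewhere. Near every point of $\mathbb R^3\setminus\{\vec\nu_\sigma\}$ there are an open set $U\subset\mathbb R^3\setminus\{\vec\nu_\sigma\}$ and smooth maps $q_\sigma:U\to S$ with $\vec r(q_\sigma(\vec t))=\vec t-\vec\nu_\sigma$. For any such choice write $b_\sigma=q_\sigma(\vec t)e^{-\mathrm i\varphi_\sigma}$ and let $\eta_\sigma$ be the pullback by $q_\sigma$ of $\mathrm i(b^\dagger db-db^\dagger b)/(4|\vec r(b)|)$. Then $d\eta_\sigma=*_3d\frac1{2|\vec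 t-\vec\nu_\sigma|}$, and $\vec t$ and $\tau=\sum_\sigma\varphi_\sigma-\int_0^lt_0\,ds$ (modulo $2\pi$) are smooth coordinates on $\pi^{-1}(U)$, in which the circle acts by $\tau\mapsto\tau+\varepsilon$ and $$g=V\,d\vec t^{\,2}+\frac{(d\tau+\eta)^2}{V},\qquad V=l+\sum_\sigma\frac1{2|\vec t-\vec\nu_\sigma|},\qquad \eta=\sum_\sigma\eta_\sigma,\qquad d\eta=*_3dV.$$ 3. For a point with coordinate $v\in\mathcal I_i$ let $L_v=(N\times\mathbb C)/\mathcal G^0$, where $g\cdot(x,\zeta)=(g\cdot x,g(v)^{-1}\zeta)$. It is a smooth Hermitian line bundle over $M$, with the natural connection for which $[c(r),\zeta]$ is parallel when the curve $c$ in $N$ is orthogonal to the $\mathcal G^0$-orbits. In coordinates as in 2, let $s$ be a smooth lift to $N$, over an open set of the coordinates $(\vec t,\tau)$, along which $\tau_l=\sum_{\sigma\le i}\varphi_\sigma-\int_0^vt_0\,ds$ is $0$ modulo $2\pi$ (if $v<l$, such an $s$ exists over all of $U\times\mathbb R$). In the trivialization $\zeta\mapsto[s,\zeta]$ of $L_v$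 the connection is $d+\mathrm i a_v$ with $$a_v=V_l(v)\,\frac{d\tau+\eta}{V}-\sum_{\sigma\le i}\eta_\sigma,\qquad V_l(v)=v+\sum_{\sigma\le i}\frac1{2|\vec t-\vec\nu_\sigma|}.$$ -/

import Mathlib

open MeasureTheory Set Filter Topology Function
open scoped Manifold ContDiff Quaternion InnerProductSpace

noncomputable section

namespace SmallBow

/-- Euclidean three-space, identified with the imaginary quaternions. -/
abbrev E3 := EuclideanSpace ℝ (Fin 3)

/-- The model space of the four-manifolds below. -/
abbrev E4 := EuclideanSpace ℝ (Fin 4)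

/-! ### Quaternions

The spinor space is the space of quaternions, on which the quaternions act by left multiplication;
complex scalars act by right multiplication, the complex unit acting by the quaternion unit `i`. -/

/-- The standard imaginary unit quaternions. -/
def unitQuat : Fin 3 → ℍ[ℝ] := ![⟨0, 1, 0, 0⟩, ⟨0, 0, 1, 0⟩, ⟨0, 0, 0, 1⟩]

/-- The imaginary part of a quaternion as a vector of `ℝ³`. -/
def imVec (q : ℍ[ℝ]) : E3 := !₂[q.imI, q.imJ, q.imK]

/-- Right multiplication by a complex scalar. -/
def rsmul (b : ℍ[ℝ]) (z : ℂ) : ℍ[ℝ] := b * Quaternion.coeComplex z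

/-- The vector `r = - Im i b b†`: in quaternionic notation `b b†` has imaginary part
`(1/2) Σ_j ⟪i, b̄ e_j b⟫ e_j ⊗ (- i)`, so that `r = - (1/2) b i b̄`. -/
def hopf (b : ℍ[ℝ]) : E3 := imVec ((-(1 / 2) : ℝ) • (b * unitQuat 0 * star b))

/-- The cross product on Euclidean three-space. -/
def cross (u v : E3) : E3 := WithLp.toLp 2 (crossProduct (WithLp.ofLp u) (WithLp.ofLp v))

/-- `d η = *₃ d f` at the point `t`, for a one-form `η` and a function `f` on `ℝ³`. -/
def CurvatureEq (η : E3 → (E3 →L[ℝ] ℝ)) (f : E3 → ℝ) (t : E3) : Prop :=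
  ∀ u v : E3, fderiv ℝ η t u v - fderiv ℝ η t v u = fderiv ℝ f t (cross u v)

/-! ### The bow and its small representation -/

/-- The affine `A_{k-1}` bow: `k` points `0 < p_1 < ... < p_k < l` on a circle of perimeter `l`. -/
structure Bow (k : ℕ) where
  l : ℝ
  p : Fin k → ℝ
  strictMono : StrictMono p
  pos : ∀ σ, 0 < p σ
  lt : ∀ σ, p σ < l

variable {k : ℕ}

namespace Bow

/-- The points `0, p_1, ..., p_k, l` at which the circle is cut. -/
def cut (B : Bow k) : Fin (k + 2) → ℝ :=
  Fin.cons (α := fun _ => ℝ) 0 (Fin.snoc (α := fun _ => ℝ) B.p B.l)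

/-- Left end of the `i`-th closed subinterval, `i = 0, ..., k`. -/
def left (B : Bow k) (i : Fin (k + 1)) : ℝ := B.cut i.castSucc

/-- Right end of the `i`-th closed subinterval. -/
def right (B : Bow k) (i : Fin (k + 1)) : ℝ := B.cut i.succ

end Bow

/-- `f` is an `H¹` function on the interval `[a, b]`. -/
def IsH1 {E : Type} [NormedAddCommGroup E] [NormedSpace ℝ E] (f : ℝ → E) (a b : ℝ) : Prop :=
  AbsolutelyContinuousOnInterval f a b ∧ MemLp (deriv f) 2 (volume.restrict (Icc a b))

/-- An `H¹` function on the bow, given by its restrictions `f i` to the closed subintervals; at each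
`p_σ` it has the two values `f σ.castSucc (p σ)` at `p_σ-` and `f σ.succ (p σ)` at `p_σ+`, while it
is continuous at the point `0 ∼ l` of the circle. -/
def IsBowH1 {E : Type} [NormedAddCommGroup E] [NormedSpace ℝ E] (B : Bow k)
    (f : Fin (k + 1) → ℝ → E) : Prop :=
  (∀ i, IsH1 (f i) (B.left i) (B.right i)) ∧ f 0 0 = f (Fin.last k) B.l

/-- The value at `p_σ-`. -/
def valMinus {E : Type} (B : Bow k) (f : Fin (k + 1) → ℝ → E) (σ : Fin k) : E :=
  f σ.castSucc (B.p σ)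

/-- The value at `p_σ+`. -/
def valPlus {E : Type} (B : Bow k) (f : Fin (k + 1) → ℝ → E) (σ : Fin k) : E :=
  f σ.succ (B.p σ)

/-- The based gauge group `𝒢⁰`: unitary `H¹` functions on the bow with value `1` at `0`. -/
def IsBasedGauge (B : Bow k) (g : Fin (k + 1) → ℝ → ℂ) : Prop :=
  IsBowH1 B g ∧ (∀ i, ∀ s ∈ Icc (B.left i) (B.right i), ‖g i s‖ = 1) ∧ g 0 0 = 1

/-- The data of the small representation. The quaternion `T(s) = t₀ + t₁ e₁ + t₂ e₂ + t₃ e₃` encodes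
the connection `d/ds + i t₀` and the Hermitian sections `t₁, t₂, t₃`; the `k` quaternions are the
bifundamental data `b_σ`. The inner product of this Hilbert space,
`∫ Re (T̄ T') ds + Σ_σ Re (b̄_σ b'_σ)`, is the flat hyperkähler metric. -/
abbrev Dat (B : Bow k) : Type :=
  WithLp 2 (Lp ℍ[ℝ] 2 ((volume : Measure ℝ).restrict (Icc 0 B.l)) ×
    PiLp 2 (fun _ : Fin k => ℍ[ℝ]))

/-- The flat hyperkähler structure: left multiplication by a quaternion. -/
def leftMul (B : Bow k) (q : ℍ[ℝ]) (X : Dat B) : Dat B :=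
  WithLp.toLp 2 ((ContinuousLinearMap.mul ℝ ℍ[ℝ] q).compLp X.fst,
    WithLp.toLp 2 (fun σ => q * X.snd σ))

/-- `y = g · x`: the connection `d/ds + i t₀` goes to `g⁻¹ (d/ds + i t₀) g`, the `t_j` are
unchanged, and `b_σ` goes to `g⁻¹(p_σ-) b_σ g(p_σ+)`. -/
def GaugeAct (B : Bow k) (g : Fin (k + 1) → ℝ → ℂ) (x y : Dat B) : Prop :=
  (∀ i, ∀ᵐ s ∂(volume : Measure ℝ).restrict (Icc (B.left i) (B.right i)),
    y.fst s = x.fst s + (((g i s)⁻¹ * deriv (g i) s).im : ℍ[ℝ])) ∧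
  ∀ σ, y.snd σ = rsmul (x.snd σ) ((valMinus B g σ)⁻¹ * valPlus B g σ)

/-- `X` is the value at `x` of the vector field generated by the gauge algebra element `i f`. -/
def IsGenerated (B : Bow k) (f : Fin (k + 1) → ℝ → ℝ) (x X : Dat B) : Prop :=
  (∀ i, ∀ᵐ s ∂(volume : Measure ℝ).restrict (Icc (B.left i) (B.right i)),
    X.fst s = ((deriv (f i) s : ℝ) : ℍ[ℝ])) ∧
  ∀ σ, X.snd σ = rsmul (x.snd σ) (Complex.I * ((valPlus B f σ - valMinus B f σ : ℝ) : ℂ))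

/-- The `j`-th component of the hyperkähler moment map, evaluated on the gauge algebra
element `i f`. -/
def momentMap (B : Bow k) (f : Fin (k + 1) → ℝ → ℝ) (j : Fin 3) (x : Dat B) : ℝ :=
  (∑ i, ∫ s in (B.left i)..(B.right i), deriv (f i) s * imVec (x.fst s) j) +
    ∑ σ, (valPlus B f σ - valMinus B f σ) * hopf (x.snd σ) j

/-- The level set of the moment map at the level `ν = Σ_σ ν_σ (δ_{p_σ-} - δ_{p_σ+})`. -/
def levelSet (B : Bow k) (ν : Fin k → E3) : Set (Dat B) :=
  {x | ∀ f : Fin (k + 1) → ℝ → ℝ, IsBowH1 B f → ∀ j : Fin 3,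
    momentMap B f j x = ∑ σ, ν σ j * (valMinus B f σ - valPlus B f σ)}

/-- The moduli space: the set of orbits of the based gauge group in the level set, with the quotient
topology. -/
def Moduli (B : Bow k) (ν : Fin k → E3) : Type :=
  Quot (fun x y : levelSet B ν => ∃ g, IsBasedGauge B g ∧ GaugeAct B g x y)

instance (B : Bow k) (ν : Fin k → E3) : TopologicalSpace (Moduli B ν) :=
  inferInstanceAs (TopologicalSpace (Quot _))

/-- The quotient projection. -/
def proj (B : Bow k) (ν : Fin k → E3) (x : levelSet B ν) : Moduli B ν := Quot.mk _ x

/-- The orthogonal complement of the tangent space to the gauge orbit through `x`. -/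
def Horizontal (B : Bow k) (x : Dat B) : Set (Dat B) :=
  {h | ∀ f X, IsBowH1 B f → f 0 0 = 0 → IsGenerated B f x X → ⟪X, h⟫_ℝ = 0}

/-! ### Structures on four-manifolds -/

section Manifold

variable {M : Type} [TopologicalSpace M] [ChartedSpace E4 M]

/-- A field of bilinear forms on the tangent spaces. -/
abbrev BilinField (M : Type) [TopologicalSpace M] [ChartedSpace E4 M] : Type :=
  ∀ m : M, TangentSpace 𝓘(ℝ, E4) m →L[ℝ] TangentSpace 𝓘(ℝ, E4) m →L[ℝ] ℝ

/-- A smooth Riemannian metric. -/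
abbrev SmoothMetric (M : Type) [TopologicalSpace M] [ChartedSpace E4 M]
    [IsManifold 𝓘(ℝ, E4) ∞ M] : Type :=
  Bundle.ContMDiffRiemannianMetric 𝓘(ℝ, E4) ∞ E4 (fun m : M => TangentSpace 𝓘(ℝ, E4) m)

/-- The field of bilinear forms is a smooth closed two-form: its pullback by a smooth map from an
open subset of `ℝ⁴` is alternating, smooth, and has vanishing exterior derivative. -/
def IsClosedTwoForm (Ω : BilinField M) : Prop :=
  (∀ m u v, Ω m u v = - Ω m v u) ∧
  ∀ (O : Set E4) (φ : E4 → M), IsOpen O → ContMDiffOn 𝓘(ℝ, E4) 𝓘(ℝ, E4) ∞ φ O →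
    let pb : E4 → E4 → E4 → ℝ := fun u v y =>
      Ω (φ y) (mfderiv 𝓘(ℝ, E4) 𝓘(ℝ, E4) φ y u) (mfderiv 𝓘(ℝ, E4) 𝓘(ℝ, E4) φ y v)
    (∀ u v, ContDiffOn ℝ ∞ (pb u v) O) ∧
    ∀ y ∈ O, ∀ u v w,
      fderiv ℝ (pb v w) y u + fderiv ℝ (pb w u) y v + fderiv ℝ (pb u v) y w = 0

/-- `(g, Ω₁, Ω₂, Ω₃)` is a hyperkähler structure: the `Ω_j` are closed two-forms
`Ω_j = g (J_j ·, ·)` with `J₁, J₂, J₃` satisfying the relations of the imaginary unit quaternions. -/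
def IsHyperkahler [IsManifold 𝓘(ℝ, E4) ∞ M] (g : SmoothMetric M) (Ω : Fin 3 → BilinField M) :
    Prop :=
  (∀ j, IsClosedTwoForm (Ω j)) ∧
  ∃ J : Fin 3 → ∀ m : M, TangentSpace 𝓘(ℝ, E4) m →L[ℝ] TangentSpace 𝓘(ℝ, E4) m,
    (∀ j m u v, g.inner m (J j m u) v = Ω j m u v) ∧
    (∀ j m u, J j m (J j m u) = -u) ∧
    (∀ m u, J 0 m (J 1 m u) = J 2 m u)

/-- The multi-Taub-NUT potential `V = l + Σ_σ 1 / (2 |t - ν_σ|)`. -/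
def potential (l : ℝ) (ν : Fin k → E3) (t : E3) : ℝ := l + ∑ σ, 1 / (2 * ‖t - ν σ‖)

/-- `Φ` is a coordinate system `(t, τ)` on the part of `M` over the open set `U ⊆ ℝ³`, with `τ` of
period `2π`, in which the circle acts by translations of `τ` and the metric is
`V dt² + (dτ + η)² / V` with `dη = *₃ dV`. -/
structure IsGibbonsHawkingChart [IsManifold 𝓘(ℝ, E4) ∞ M] (l : ℝ) (ν : Fin k → E3)
    (g : SmoothMetric M) (π : M → E3) (act : Circle → M → M)
    (U : Set E3) (η : E3 → (E3 →L[ℝ] ℝ)) (Φ : E3 × ℝ → M) : Prop where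
  isOpen : IsOpen U
  ne_center : ∀ t ∈ U, t ∉ range ν
  smooth_form : ContDiffOn ℝ ∞ η U
  curvature : ∀ t ∈ U, CurvatureEq η (potential l ν) t
  smooth : ContMDiffOn 𝓘(ℝ, E3 × ℝ) 𝓘(ℝ, E4) ∞ Φ (U ×ˢ univ)
  proj_eq : ∀ t ∈ U, ∀ τ, π (Φ (t, τ)) = t
  covers : ∀ m, π m ∈ U → ∃ τ, Φ (π m, τ) = m
  periodic : ∀ t ∈ U, ∀ τ τ', Φ (t, τ) = Φ (t, τ') ↔ ∃ n : ℤ, τ' = τ + n * (2 * Real.pi)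
  act_eq : ∀ t ∈ U, ∀ τ ε, act (Circle.exp ε) (Φ (t, τ)) = Φ (t, τ + ε)
  metric_eq : ∀ t ∈ U, ∀ τ, ∀ v w : E3 × ℝ,
    g.inner (Φ (t, τ)) (mfderiv 𝓘(ℝ, E3 × ℝ) 𝓘(ℝ, E4) Φ (t, τ) v)
        (mfderiv 𝓘(ℝ, E3 × ℝ) 𝓘(ℝ, E4) Φ (t, τ) w) =
      potential l ν t * ⟪v.1, w.1⟫_ℝ + (v.2 + η t v.1) * (w.2 + η t w.1) / potential l ν t

/-- `(M, g)`, with the map `π` to `ℝ³` and the circle action `act`, is the multi-Taub-NUT space with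
centers `ν_σ`: a smooth Riemannian four-manifold with a smooth isometric circle action whose orbits
are the fibers of `π`, with exactly one fixed point over each center and no other point with
non-trivial isotropy, whose metric off the fixed points is of Gibbons-Hawking form with
potential `V`. -/
structure IsMultiTaubNUT [IsManifold 𝓘(ℝ, E4) ∞ M] (l : ℝ) (ν : Fin k → E3)
    (g : SmoothMetric M) (π : M → E3) (act : Circle → M → M) : Prop where
  t2 : T2Space M
  secondCountable : SecondCountableTopology M
  smooth_proj : ContMDiff 𝓘(ℝ, E4) 𝓘(ℝ, E3) ∞ π
  surjective : Surjective π
  act_one : ∀ m, act 1 m = m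
  act_mul : ∀ z w m, act (z * w) m = act z (act w m)
  smooth_act : ContMDiff (𝓘(ℝ, ℝ).prod 𝓘(ℝ, E4)) 𝓘(ℝ, E4) ∞
    (fun q : ℝ × M => act (Circle.exp q.1) q.2)
  fiber : ∀ m m', π m = π m' ↔ ∃ z, act z m = m'
  fixed : ∀ m, π m ∈ range ν → ∀ z, act z m = m
  free : ∀ m, π m ∉ range ν → ∀ z, act z m = m → z = 1
  isometric : ∀ z m u v, g.inner (act z m) (mfderiv 𝓘(ℝ, E4) 𝓘(ℝ, E4) (act z) m u)
    (mfderiv 𝓘(ℝ, E4) 𝓘(ℝ, E4) (act z) m v) = g.inner m u v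
  gibbonsHawking : ∀ t, t ∉ range ν → ∃ U η Φ, t ∈ U ∧ IsGibbonsHawkingChart l ν g π act U η Φ

end Manifold

/-! ### The hyperkähler quotient -/

/-- The velocity, at `x`, of the projection to the moduli space of a map into the level set. -/
def projDeriv (B : Bow k) (ν : Fin k → E3) [ChartedSpace E4 (Moduli B ν)]
    {F : Type} [NormedAddCommGroup F] [NormedSpace ℝ F] (c : F → levelSet B ν) (x : F) (v : F) :
    TangentSpace 𝓘(ℝ, E4) (proj B ν (c x)) :=
  mfderiv 𝓘(ℝ, F) 𝓘(ℝ, E4) (fun y => proj B ν (c y)) x v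

/-- The smooth structure, the metric `g` and the two-forms `Ω_j` on the moduli space are those of
the hyperkähler quotient. A map into the level set is smooth if it is smooth as a map into the
Hilbert space of data. The projection is then smooth and has smooth local sections; it is a
Riemannian submersion; and each `Ω_j` pulls back to the restriction of the flat symplectic form
`⟪e_j ·, ·⟫` to the level set. -/
structure IsHyperkahlerQuotient (B : Bow k) (ν : Fin k → E3) [ChartedSpace E4 (Moduli B ν)]
    [IsManifold 𝓘(ℝ, E4) ∞ (Moduli B ν)] (g : SmoothMetric (Moduli B ν))
    (Ω : Fin 3 → BilinField (Moduli B ν)) : Prop where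
  smooth_proj : ∀ (F : Type) [NormedAddCommGroup F] [NormedSpace ℝ F] (c : F → levelSet B ν) (x : F),
    ContDiffAt ℝ ∞ (fun y => (c y : Dat B)) x →
    ContMDiffAt 𝓘(ℝ, F) 𝓘(ℝ, E4) ∞ (fun y => proj B ν (c y)) x
  local_section : ∀ x : levelSet B ν, ∃ s : Moduli B ν → levelSet B ν, s (proj B ν x) = x ∧
    (∀ᶠ m in 𝓝 (proj B ν x), proj B ν (s m) = m) ∧
    ContMDiffAt 𝓘(ℝ, E4) 𝓘(ℝ, Dat B) ∞ (fun m => (s m : Dat B)) (proj B ν x)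
  horizontal_lift : ∀ (x : levelSet B ν) (u : TangentSpace 𝓘(ℝ, E4) (proj B ν x)),
    ∃ c : ℝ → levelSet B ν, c 0 = x ∧ ContDiffAt ℝ ∞ (fun r => (c r : Dat B)) 0 ∧
      deriv (fun r => (c r : Dat B)) 0 ∈ Horizontal B x ∧ projDeriv B ν c 0 1 = u
  metric_eq : ∀ (F : Type) [NormedAddCommGroup F] [NormedSpace ℝ F] (c : F → levelSet B ν) (x : F),
    ContDiffAt ℝ ∞ (fun y => (c y : Dat B)) x → ∀ v w : F,
    fderiv ℝ (fun y => (c y : Dat B)) x v ∈ Horizontal B (c x) →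
    g.inner (proj B ν (c x)) (projDeriv B ν c x v) (projDeriv B ν c x w) =
      ⟪fderiv ℝ (fun y => (c y : Dat B)) x v, fderiv ℝ (fun y => (c y : Dat B)) x w⟫_ℝ
  form_eq : ∀ (F : Type) [NormedAddCommGroup F] [NormedSpace ℝ F] (c : F → levelSet B ν) (x : F),
    ContDiffAt ℝ ∞ (fun y => (c y : Dat B)) x → ∀ (v w : F) (j : Fin 3),
    Ω j (proj B ν (c x)) (projDeriv B ν c x v) (projDeriv B ν c x w) =
      ⟪leftMul B (unitQuat j) (fderiv ℝ (fun y => (c y : Dat B)) x v),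
        fderiv ℝ (fun y => (c y : Dat B)) x w⟫_ℝ

/-- Rotation of one of the bifundamental components, `b_σ ↦ b_σ z⁻¹`. -/
def rotate (B : Bow k) (σ : Fin k) (z : Circle) (x : Dat B) : Dat B :=
  WithLp.toLp 2 (x.fst, WithLp.toLp 2 (Function.update (WithLp.ofLp x.snd) σ
    (rsmul (x.snd σ) ((z⁻¹ : Circle) : ℂ))))

/-! ### The tautological line bundles -/

/-- The tautological line bundle `L_v` of the point with coordinate `v` of the `i`-th closed
subinterval: the quotient of (level set) × ℂ by `(x, ζ) ∼ (g · x, g(v)⁻¹ ζ)`, `g` in the based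
gauge group. -/
def Taut (B : Bow k) (ν : Fin k → E3) (i : Fin (k + 1)) (v : ℝ) : Type :=
  Quot (fun a b : levelSet B ν × ℂ =>
    ∃ g, IsBasedGauge B g ∧ GaugeAct B g a.1 b.1 ∧ b.2 = (g i v)⁻¹ * a.2)

/-- The class `[x, ζ]` in the line bundle. -/
def Taut.mk {B : Bow k} {ν : Fin k → E3} {i : Fin (k + 1)} {v : ℝ} (x : levelSet B ν) (ζ : ℂ) :
    Taut B ν i v :=
  Quot.mk _ (x, ζ)

/-- The projection of the line bundle to the moduli space. -/
def Taut.base {B : Bow k} {ν : Fin k → E3} {i : Fin (k + 1)} {v : ℝ} :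
    Taut B ν i v → Moduli B ν :=
  Quot.lift (fun a => proj B ν a.1) (by
    rintro a b ⟨g, hg, hab, -⟩
    exact Quot.sound ⟨g, hg, hab⟩)

/-- `L_v` is a smooth Hermitian line bundle: for every point `x` of the level set `ζ ↦ [x, ζ]` is a
bijection onto the fiber, and the transition functions between the trivializations given by smooth
maps into the level set are smooth and unitary. -/
def IsSmoothLineBundle (B : Bow k) (ν : Fin k → E3) (i : Fin (k + 1)) (v : ℝ) : Prop :=
  (∀ (x : levelSet B ν) (ℓ : Taut B ν i v), ℓ.base = proj B ν x → ∃! ζ, Taut.mk x ζ = ℓ) ∧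
  ∀ (F : Type) [NormedAddCommGroup F] [NormedSpace ℝ F] (c c' : F → levelSet B ν) (h : F → ℂ)
    (x : F), ContDiffAt ℝ ∞ (fun y => (c y : Dat B)) x →
    ContDiffAt ℝ ∞ (fun y => (c' y : Dat B)) x →
    (∀ᶠ y in 𝓝 x, (Taut.mk (c y) 1 : Taut B ν i v) = Taut.mk (c' y) (h y)) →
    ContDiffAt ℝ ∞ h x ∧ ‖h x‖ = 1

/-- `∇_u ψ = w` for the natural connection of `L_v`, which is induced by the horizontal subspaces:
if `c` is a curve in the level set with horizontal velocity at `0` that projects to `u`, and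
`ψ = [c, χ]` along `c`, then `∇_u ψ = [c 0, χ' 0]`. -/
def HasCovDeriv (B : Bow k) (ν : Fin k → E3) [ChartedSpace E4 (Moduli B ν)]
    (i : Fin (k + 1)) (v : ℝ) (ψ : Moduli B ν → Taut B ν i v) (m : Moduli B ν)
    (u : TangentSpace 𝓘(ℝ, E4) m) (w : Taut B ν i v) : Prop :=
  ∀ (c : ℝ → levelSet B ν) (χ : ℝ → ℂ), proj B ν (c 0) = m →
    ContDiffAt ℝ ∞ (fun r => (c r : Dat B)) 0 →
    deriv (fun r => (c r : Dat B)) 0 ∈ Horizontal B (c 0) →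
    projDeriv B ν c 0 1 = u →
    (∀ᶠ r in 𝓝 0, ψ (proj B ν (c r)) = Taut.mk (c r) (χ r)) →
    ∃ χ' : ℂ, HasDerivAt χ χ' 0 ∧ w = Taut.mk (c 0) χ'

/-! ### Local coordinates -/

/-- A local choice of phases over the open set `U ⊆ ℝ³`: smooth maps `q_σ` with
`hopf (q_σ t) = t - ν_σ`. -/
structure IsPhaseFrame (ν : Fin k → E3) (U : Set E3) (q : Fin k → E3 → ℍ[ℝ]) : Prop where
  isOpen : IsOpen U
  ne_center : ∀ t ∈ U, t ∉ range ν
  smooth : ∀ σ, ContDiffOn ℝ ∞ (q σ) U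
  hopf_eq : ∀ t ∈ U, ∀ σ, hopf (q σ t) = t - ν σ

/-- The phase angles `φ_σ` of the data `x` over `t`, with respect to a choice of phases:
`b_σ = q_σ(t) e^{-i φ_σ}`. -/
def IsPhase (B : Bow k) (q : Fin k → E3 → ℍ[ℝ]) (x : Dat B) (t : E3) (φ : Fin k → ℝ) : Prop :=
  ∀ σ, x.snd σ = rsmul (q σ t) (Complex.exp (-(Complex.I * (φ σ : ℂ))))

/-- The one-form `η_σ`, that is, the pullback by `q = q_σ` of the one-form
`i (b† db - db† b) / (4 r) = - ⟪b i, db⟫ / |b|²`. -/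
def phaseForm (q : E3 → ℍ[ℝ]) (t : E3) : E3 →L[ℝ] ℝ :=
  (-(1 / ‖q t‖ ^ 2) : ℝ) • (innerSL ℝ (q t * unitQuat 0)).comp (fderiv ℝ q t)

/-- `V_l(v) = v + Σ_{σ < i} 1 / (2 |t - ν_σ|)`, the sum being over the points `p_σ` to the left of
the `i`-th subinterval. -/
def leftPotential (ν : Fin k → E3) (i : Fin (k + 1)) (v : ℝ) (t : E3) : ℝ :=
  v + ∑ σ : Fin k, if (σ : ℕ) < (i : ℕ) then 1 / (2 * ‖t - ν σ‖) else 0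

/-- The one-form `a_v = V_l(v) (dτ + η) / V - Σ_{σ < i} η_σ`, `η = Σ_σ η_σ`, at `(t, τ)`, evaluated
on the vector `w`. -/
def tautForm (B : Bow k) (ν : Fin k → E3) (q : Fin k → E3 → ℍ[ℝ]) (i : Fin (k + 1)) (v : ℝ)
    (t : E3) (w : E3 × ℝ) : ℝ :=
  leftPotential ν i v t * (w.2 + ∑ σ, phaseForm (q σ) t w.1) / potential B.l ν t -
    ∑ σ : Fin k, if (σ : ℕ) < (i : ℕ) then phaseForm (q σ) t w.1 else 0

/-- `s` is a smooth lift to the level set of the coordinate system `Φ` over `O`, along which the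
local coordinate `τ_l = Σ_{σ < i} φ_σ - ∫₀^v t₀ ds` of `U(1)_v` is `0`. It is the trivialization
`ζ ↦ [s, ζ]` of `L_v` given by the coordinate `τ_l`. -/
structure IsTautTrivialization (B : Bow k) (ν : Fin k → E3) (q : Fin k → E3 → ℍ[ℝ])
    (Φ : E3 × ℝ → Moduli B ν) (i : Fin (k + 1)) (v : ℝ) (O : Set (E3 × ℝ))
    (s : E3 × ℝ → levelSet B ν) : Prop where
  smooth : ContDiffOn ℝ ∞ (fun y => (s y : Dat B)) O
  lift : ∀ y ∈ O, proj B ν (s y) = Φ y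
  tau_left : ∀ y ∈ O, ∃ φ : Fin k → ℝ, IsPhase B q (s y) y.1 φ ∧
    (∑ σ : Fin k, if (σ : ℕ) < (i : ℕ) then φ σ else 0) -
      (∫ r in (0 : ℝ)..v, ((s y : Dat B).fst r).re) = 0

end SmallBow

end

noncomputable section

namespace SmallBow

set_option linter.unusedSectionVars false

section

/-! ### Quaternion algebra and the Hopf map -/

/-! The infinite-dimensional part of the problem is linear and reduces to totals. Up to a constant,
an `H¹` function on the bow is a square integrable derivative together with `k` jumps, subject only
to the condition that integral plus sum of jumps is zero (`exists_bowH1`, `bowH1_sum_deriv`). So a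
based gauge transformation amounts to jumps `θ_σ` and a change of `t₀` of total zero (`GaugeRel`,
`exists_gaugeRel`). The moment map equations say that `(t_j, r_j(b_σ) + ν_{σ,j})` is orthogonal to
all pairs of total zero, hence is constant (`mem_levelSet_iff`).

As the fibres of the Hopf map are circles, over a given `t` only the phases of the `b_σ` and the
integrals of `t₀` remain. They enter through one function, `hol s v`: the product of the phases of
the `b_ρ`, `ρ ∈ s`, relative to local sections of the Hopf map, times `exp (i ∫₀^v t₀)`. Its change
under a gauge transformation is a total (`hol_gauge`), and three choices of `(s, v)` carry the
proof. With `s` all indices but `σ` and `v = l`, the quaternion `b_σ · hol` is invariant and is a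
chart, valid also over `ν_σ`, since the centres are distinct and no other `b_ρ` vanishes there. With
all indices and `v = l`, `hol = e^{-iτ}` is the Gibbons-Hawking coordinate. With the indices to the
left of `v`, `hol` transforms like `g(v)` and trivializes `L_v`.

For the metric, the horizontal tangent vectors are those with constant `T`-component `κ ∈ ℍ` and
`H_σ i b̄_σ = -κ` for all `σ` (`QHor`). This is stable under left multiplication by quaternions, and
every tangent vector of the level set is such a vector plus a vertical one
(`IsTan.exists_isHorPart`). So the metric and the forms descend; in a chart, `⟪q ·, ·⟫` becomes `(1
+ W |b|²) ⟪q L ·, L ·⟫` with `L` invertible, and the complex structures are `L⁻¹ e_j L`. The forms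
are closed because, through local lifts, their pullbacks are pullbacks of constant forms on a flat
space.

Away from the centres `H_σ = |b_σ|⁻² κ b_σ i`, so `|H|² = V |κ|²`, with `Im κ = dt` and `Re κ = -(dτ
+ η) / V`; this is the Gibbons-Hawking metric. The same `κ` gives the logarithmic derivative of the
left `hol` along a horizontal curve, namely `-i a_v`, hence the connection (`hasCovDeriv_taut`). The
equation `dη = *₃ dV` is the sum over the centres of `curvatureEq_phaseForm`. -/

@[simp] lemma re_unitQuat_zero : (unitQuat 0).re = 0 := rfl
@[simp] lemma imI_unitQuat_zero : (unitQuat 0).imI = 1 := rfl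
@[simp] lemma imJ_unitQuat_zero : (unitQuat 0).imJ = 0 := rfl
@[simp] lemma imK_unitQuat_zero : (unitQuat 0).imK = 0 := rfl
@[simp] lemma re_unitQuat_one : (unitQuat 1).re = 0 := rfl
@[simp] lemma imI_unitQuat_one : (unitQuat 1).imI = 0 := rfl
@[simp] lemma imJ_unitQuat_one : (unitQuat 1).imJ = 1 := rfl
@[simp] lemma imK_unitQuat_one : (unitQuat 1).imK = 0 := rfl
@[simp] lemma re_unitQuat_two : (unitQuat 2).re = 0 := rfl
@[simp] lemma imI_unitQuat_two : (unitQuat 2).imI = 0 := rfl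
@[simp] lemma imJ_unitQuat_two : (unitQuat 2).imJ = 0 := rfl
@[simp] lemma imK_unitQuat_two : (unitQuat 2).imK = 1 := rfl

lemma quat_inner_eq (a b : ℍ[ℝ]) :
    ⟪a, b⟫_ℝ = a.re * b.re + a.imI * b.imI + a.imJ * b.imJ + a.imK * b.imK := by
  simp [Quaternion.inner_def]

lemma quat_norm_sq (a : ℍ[ℝ]) : ‖a‖ ^ 2 = a.re ^ 2 + a.imI ^ 2 + a.imJ ^ 2 + a.imK ^ 2 := by
  rw [← real_inner_self_eq_norm_sq, quat_inner_eq]; ring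

lemma E3_inner_eq (u v : E3) : ⟪u, v⟫_ℝ = u 0 * v 0 + u 1 * v 1 + u 2 * v 2 := by
  simp [PiLp.inner_apply, Fin.sum_univ_three]; ring

lemma E3_norm_sq (u : E3) : ‖u‖ ^ 2 = u 0 ^ 2 + u 1 ^ 2 + u 2 ^ 2 := by
  rw [← real_inner_self_eq_norm_sq, E3_inner_eq]; ring

/-- The quaternion as a linear function of its imaginary part. -/
def imQuat : E3 →L[ℝ] ℍ[ℝ] := LinearMap.toContinuousLinearMap
  { toFun := fun t => ⟨0, t 0, t 1, t 2⟩
    map_add' := fun a b => by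
      apply Quaternion.ext
      · exact (add_zero (0 : ℝ)).symm
      all_goals rfl
    map_smul' := fun a b => by
      apply Quaternion.ext
      · exact (mul_zero a).symm
      all_goals rfl }

/-- The imaginary part as a continuous linear map. -/
def imVecL : ℍ[ℝ] →L[ℝ] E3 := LinearMap.toContinuousLinearMap
  { toFun := imVec
    map_add' := fun a b => by ext i; fin_cases i <;> simp [imVec]
    map_smul' := fun a b => by ext i; fin_cases i <;> simp [imVec] }

/-- The real part as a continuous linear map. -/
def reL : ℍ[ℝ] →L[ℝ] ℝ := LinearMap.toContinuousLinearMap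
  { toFun := fun a => a.re
    map_add' := fun a b => by simp
    map_smul' := fun a b => by simp }

/-- The conjugation as a continuous linear map. -/
def conjL : ℍ[ℝ] →L[ℝ] ℍ[ℝ] := LinearMap.toContinuousLinearMap
  { toFun := fun a => star a
    map_add' := fun a b => by simp
    map_smul' := fun a b => by simp }

/-- The inclusion of the complex numbers in the quaternions. -/
def cQuat : ℂ →L[ℝ] ℍ[ℝ] := LinearMap.toContinuousLinearMap
  { toFun := fun z => (z : ℍ[ℝ])
    map_add' := fun a b => by simp
    map_smul' := fun a b => by simp [Algebra.smul_def] }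

/-- The projection of the quaternions to the complex numbers. -/
def quatC : ℍ[ℝ] →L[ℝ] ℂ := LinearMap.toContinuousLinearMap
  { toFun := fun a => ⟨a.re, a.imI⟩
    map_add' := fun a b => by apply Complex.ext <;> simp
    map_smul' := fun a b => by apply Complex.ext <;> simp }

@[simp] lemma re_imQuat (t : E3) : (imQuat t).re = 0 := rfl
@[simp] lemma imI_imQuat (t : E3) : (imQuat t).imI = t 0 := rfl
@[simp] lemma imJ_imQuat (t : E3) : (imQuat t).imJ = t 1 := rfl
@[simp] lemma imK_imQuat (t : E3) : (imQuat t).imK = t 2 := rfl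
@[simp] lemma imVecL_apply (a : ℍ[ℝ]) : imVecL a = imVec a := rfl
@[simp] lemma reL_apply (a : ℍ[ℝ]) : reL a = a.re := rfl
@[simp] lemma conjL_apply (a : ℍ[ℝ]) : conjL a = star a := rfl
@[simp] lemma cQuat_apply (z : ℂ) : cQuat z = (z : ℍ[ℝ]) := rfl
@[simp] lemma quatC_apply (a : ℍ[ℝ]) : quatC a = ⟨a.re, a.imI⟩ := rfl
@[simp] lemma imVec_zero' (a : ℍ[ℝ]) : imVec a 0 = a.imI := rfl
@[simp] lemma imVec_one' (a : ℍ[ℝ]) : imVec a 1 = a.imJ := rfl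
@[simp] lemma imVec_two' (a : ℍ[ℝ]) : imVec a 2 = a.imK := rfl

@[simp] lemma imVec_imQuat (t : E3) : imVec (imQuat t) = t := by
  ext i; fin_cases i <;> rfl

lemma E3_ext {u v : E3} (h0 : u 0 = v 0) (h1 : u 1 = v 1) (h2 : u 2 = v 2) : u = v := by
  ext i; fin_cases i <;> assumption

/-- The differential of the Hopf map at `b`. -/
def dhopf (b : ℍ[ℝ]) : ℍ[ℝ] →L[ℝ] E3 :=
  -(imVecL.comp ((ContinuousLinearMap.mul ℝ ℍ[ℝ]).flip (unitQuat 0 * star b)))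

lemma dhopf_apply (b β : ℍ[ℝ]) : dhopf b β = imVec (-(β * unitQuat 0 * star b)) := by
  rw [← imVecL_apply, map_neg]
  simp [dhopf, mul_assoc]

lemma hopf_zero_coord (b : ℍ[ℝ]) :
    hopf b 0 = -(1 / 2) * (b.re ^ 2 + b.imI ^ 2 - b.imJ ^ 2 - b.imK ^ 2) := by
  simp [hopf]; ring

lemma hopf_one_coord (b : ℍ[ℝ]) : hopf b 1 = -(b.re * b.imK + b.imI * b.imJ) := by
  simp [hopf]; ring

lemma hopf_two_coord (b : ℍ[ℝ]) : hopf b 2 = b.re * b.imJ - b.imI * b.imK := by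
  simp [hopf]; ring

lemma dhopf_zero_coord (b a : ℍ[ℝ]) :
    dhopf b a 0 = -(a.re * b.re + a.imI * b.imI - a.imJ * b.imJ - a.imK * b.imK) := by
  simp [dhopf_apply]; ring

lemma dhopf_one_coord (b a : ℍ[ℝ]) :
    dhopf b a 1 = -(a.re * b.imK + b.re * a.imK + a.imI * b.imJ + b.imI * a.imJ) := by
  simp [dhopf_apply]; ring

lemma dhopf_two_coord (b a : ℍ[ℝ]) :
    dhopf b a 2 = a.re * b.imJ + b.re * a.imJ - a.imI * b.imK - b.imI * a.imK := by
  simp [dhopf_apply]; ring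

/-- This is what turns `1 / ‖b_σ‖ ^ 2` into the harmonic function `1 / (2 |t - ν_σ|)`. -/
lemma norm_hopf (b : ℍ[ℝ]) : ‖b‖ ^ 2 = 2 * ‖hopf b‖ := by
  have h : (‖b‖ ^ 2) ^ 2 = (2 * ‖hopf b‖) ^ 2 := by
    rw [mul_pow, E3_norm_sq, hopf_zero_coord, hopf_one_coord, hopf_two_coord, quat_norm_sq]; ring
  exact (sq_eq_sq₀ (by positivity) (by positivity)).1 h

lemma hopf_eq_zero {b : ℍ[ℝ]} : hopf b = 0 ↔ b = 0 := by
  have := norm_hopf b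
  rw [← norm_eq_zero, ← norm_eq_zero (a := b)]
  constructor <;> intro h <;> simp_all

/-- Euler's relation for a quadratic map; the calculus of `hopf` goes through its polarization. -/
lemma dhopf_self_half (b : ℍ[ℝ]) : hopf b = (1 / 2 : ℝ) • dhopf b b := by
  apply E3_ext <;>
  simp [hopf_zero_coord, hopf_one_coord, hopf_two_coord, dhopf_zero_coord, dhopf_one_coord,
    dhopf_two_coord] <;> ring

/-- The symmetric bilinear map of the quadratic map `hopf`. -/
def hopfBilin : ℍ[ℝ] →L[ℝ] ℍ[ℝ] →L[ℝ] E3 := LinearMap.toContinuousLinearMap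
  { toFun := dhopf
    map_add' := fun a b => by
      ext x i; fin_cases i <;> simp [dhopf_zero_coord, dhopf_one_coord, dhopf_two_coord] <;> ring
    map_smul' := fun a b => by
      ext x i; fin_cases i <;> simp [dhopf_zero_coord, dhopf_one_coord, dhopf_two_coord] <;> ring }

@[simp] lemma hopfBilin_apply (b : ℍ[ℝ]) : hopfBilin b = dhopf b := rfl

lemma contDiff_dhopf : ContDiff ℝ ∞ dhopf := by
  exact ContinuousLinearMap.contDiff (𝕜 := ℝ) (E := ℍ[ℝ]) (F := ℍ[ℝ] →L[ℝ] E3) hopfBilin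

lemma dhopf_symm (a b : ℍ[ℝ]) : dhopf a b = dhopf b a := by
  apply E3_ext <;> simp [dhopf_zero_coord, dhopf_one_coord, dhopf_two_coord] <;> ring

lemma contDiff_hopf : ContDiff ℝ ∞ hopf := by
  have : hopf = fun b => (1 / 2 : ℝ) • hopfBilin b b := by
    funext b; exact dhopf_self_half b
  rw [this]
  exact (contDiff_dhopf.clm_apply contDiff_id).const_smul (1 / 2 : ℝ)

lemma hasFDerivAt_hopf (b : ℍ[ℝ]) : HasFDerivAt hopf (dhopf b) b := by
  have : hopf = fun b => (1 / 2 : ℝ) • hopfBilin b b := by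
    funext b; exact dhopf_self_half b
  rw [this]
  have h1 : HasFDerivAt (fun b => hopfBilin b b) _ b :=
    (hopfBilin.hasFDerivAt (x := b)).clm_apply (hasFDerivAt_id b)
  have h := HasFDerivAt.fun_const_smul (𝕜 := ℝ) (E := ℍ[ℝ]) (F := E3) h1 (1 / 2 : ℝ)
  refine h.congr_fderiv ?_
  ext x : 1
  simp only [_root_.smul_apply, _root_.add_apply,
    ContinuousLinearMap.comp_apply, ContinuousLinearMap.flip_apply, hopfBilin_apply,
    ContinuousLinearMap.coe_id', id]
  rw [dhopf_symm x b, ← two_smul ℝ, smul_smul]; norm_num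

/-- The vector `b i` is tangent to the Hopf fibre through `b`. -/
lemma dhopf_rotation (b : ℍ[ℝ]) : dhopf b (b * unitQuat 0) = 0 := by
  apply E3_ext <;> simp [dhopf_zero_coord, dhopf_one_coord, dhopf_two_coord] ; ring

lemma inner_rotation_self (b : ℍ[ℝ]) : ⟪b * unitQuat 0, b * unitQuat 0⟫_ℝ = ‖b‖ ^ 2 := by
  rw [quat_norm_sq, quat_inner_eq]; simp; ring

/-- The component of `q` along the complex line and the differential of the Hopf map are the parts
of one quaternion. -/
lemma mul_unit_star (b β : ℍ[ℝ]) :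
    β * unitQuat 0 * star b = -((⟪b * unitQuat 0, β⟫_ℝ : ℝ) + imQuat (dhopf b β)) := by
  ext <;> simp [quat_inner_eq, dhopf_zero_coord, dhopf_one_coord, dhopf_two_coord] <;> ring

/-- The components of `hopf` are the Hamiltonians, for the three symplectic forms, of the rotation
with velocity `b i`. -/
lemma inner_unitQuat_mul (j : Fin 3) (b β : ℍ[ℝ]) :
    ⟪unitQuat j * (b * unitQuat 0), β⟫_ℝ = dhopf b β j := by
  fin_cases j <;> simp [quat_inner_eq, dhopf_zero_coord, dhopf_one_coord, dhopf_two_coord] <;> ring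

lemma rsmul_rsmul (b : ℍ[ℝ]) (z w : ℂ) : rsmul (rsmul b z) w = rsmul b (z * w) := by
  simp [rsmul, mul_assoc]

@[simp] lemma rsmul_one (b : ℍ[ℝ]) : rsmul b 1 = b := by simp [rsmul]

lemma rsmul_I (b : ℍ[ℝ]) : rsmul b Complex.I = b * unitQuat 0 := by
  simp only [rsmul]; congr 1

lemma rsmul_I_real (b : ℍ[ℝ]) (c : ℝ) :
    rsmul b (Complex.I * (c : ℂ)) = c • (b * unitQuat 0) := by
  ext <;> simp [rsmul] <;> ring

lemma rsmul_real (b : ℍ[ℝ]) (c : ℝ) : rsmul b (c : ℂ) = c • b := by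
  ext <;> simp [rsmul] <;> ring

lemma mul_rsmul (a b : ℍ[ℝ]) (z : ℂ) : a * rsmul b z = rsmul (a * b) z := by
  simp [rsmul, mul_assoc]

lemma coeComplex_norm (z : ℂ) : ‖(z : ℍ[ℝ])‖ = ‖z‖ := by
  have h : ‖(z : ℍ[ℝ])‖ ^ 2 = ‖z‖ ^ 2 := by
    rw [quat_norm_sq, ← Complex.normSq_eq_norm_sq, Complex.normSq_apply]; simp; ring
  exact (sq_eq_sq₀ (by positivity) (by positivity)).1 h

lemma norm_rsmul (b : ℍ[ℝ]) (z : ℂ) : ‖rsmul b z‖ = ‖b‖ * ‖z‖ := by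
  rw [rsmul, norm_mul, coeComplex_norm]

lemma inner_rsmul_rsmul (a b : ℍ[ℝ]) (z : ℂ) :
    ⟪rsmul a z, rsmul b z⟫_ℝ = ‖z‖ ^ 2 * ⟪a, b⟫_ℝ := by
  rw [← Complex.normSq_eq_norm_sq, Complex.normSq_apply, quat_inner_eq, quat_inner_eq]
  simp [rsmul]; ring

lemma rsmul_eq_zero {b : ℍ[ℝ]} {z : ℂ} (hz : z ≠ 0) : rsmul b z = 0 ↔ b = 0 := by
  rw [← norm_eq_zero, norm_rsmul]; simp [hz]

lemma hopf_rsmul (b : ℍ[ℝ]) (z : ℂ) : hopf (rsmul b z) = ‖z‖ ^ 2 • hopf b := by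
  rw [← Complex.normSq_eq_norm_sq, Complex.normSq_apply]
  apply E3_ext <;>
  simp [hopf_zero_coord, hopf_one_coord, hopf_two_coord, rsmul] <;> ring

lemma hopf_rsmul_unit (b : ℍ[ℝ]) {z : ℂ} (hz : ‖z‖ = 1) : hopf (rsmul b z) = hopf b := by
  simp [hopf_rsmul, hz]

lemma dhopf_rsmul_unit (b β : ℍ[ℝ]) {z : ℂ} (hz : ‖z‖ = 1) :
    dhopf (rsmul b z) (rsmul β z) = dhopf b β := by
  have : z.re * z.re + z.im * z.im = 1 := by
    rw [← Complex.normSq_apply, Complex.normSq_eq_norm_sq, hz]; norm_num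
  have e : dhopf (rsmul b z) (rsmul β z) = (z.re * z.re + z.im * z.im) • dhopf b β := by
    apply E3_ext <;>
    simp [dhopf_zero_coord, dhopf_one_coord, dhopf_two_coord, rsmul] <;> ring
  rw [e, this, one_smul]

lemma rsmul_mul_unit (b : ℍ[ℝ]) (z : ℂ) : rsmul b z * unitQuat 0 = rsmul (b * unitQuat 0) z := by
  rw [← rsmul_I, ← rsmul_I, rsmul_rsmul, rsmul_rsmul, mul_comm]

/-- Right multiplication by complex numbers as a bilinear map. -/
def rsmulL : ℍ[ℝ] →L[ℝ] ℂ →L[ℝ] ℍ[ℝ] :=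
  (ContinuousLinearMap.mul ℝ ℍ[ℝ]).bilinearComp (ContinuousLinearMap.id ℝ _) cQuat

@[simp] lemma rsmulL_apply (b : ℍ[ℝ]) (z : ℂ) : rsmulL b z = rsmul b z := rfl

lemma add_rsmul (a b : ℍ[ℝ]) (z : ℂ) : rsmul (a + b) z = rsmul a z + rsmul b z := by
  simp [rsmul, add_mul]
lemma sub_rsmul (a b : ℍ[ℝ]) (z : ℂ) : rsmul (a - b) z = rsmul a z - rsmul b z := by
  simp [rsmul, sub_mul]
lemma smul_rsmul (c : ℝ) (b : ℍ[ℝ]) (z : ℂ) : rsmul (c • b) z = c • rsmul b z := by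
  simp [rsmul]
lemma rsmul_add (a : ℍ[ℝ]) (z w : ℂ) : rsmul a (z + w) = rsmul a z + rsmul a w := by
  simp [rsmul, mul_add]

/-- The phase of `b` relative to `q`. -/
def phase (q b : ℍ[ℝ]) : ℂ := (‖q‖ ^ 2)⁻¹ • quatC (star q * b)

lemma phase_rsmul (q b : ℍ[ℝ]) (z : ℂ) : phase q (rsmul b z) = phase q b * z := by
  apply Complex.ext <;> simp [phase, rsmul] <;> ring

lemma phase_self {q : ℍ[ℝ]} (hq : q ≠ 0) : phase q q = 1 := by
  have : star q * q = ((‖q‖ ^ 2 : ℝ) : ℍ[ℝ]) := by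
    rw [Quaternion.star_mul_self, Quaternion.normSq_eq_norm_mul_self, sq]
  have hq' : ‖q‖ ≠ 0 := by simpa using hq
  rw [phase, this, quatC_apply, Quaternion.re_coe, Quaternion.imI_coe]
  apply Complex.ext
  · rw [Complex.smul_re]; simp [hq]
  · rw [Complex.smul_im]; simp

/-- Equal Hopf images give equal norms and `q i q̄ = b i b̄`, so `q̄ b` commutes with `i` and is
complex; projecting it to `ℂ` in `phase` loses nothing. The coordinates of the claim are
combinations of these equations. -/
lemma rsmul_phase {q b : ℍ[ℝ]} (hq : q ≠ 0) (h : hopf q = hopf b) :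
    rsmul q (phase q b) = b := by
  have hn : ‖q‖ ^ 2 = ‖b‖ ^ 2 := by rw [norm_hopf, norm_hopf, h]
  have hq' : ‖q‖ ^ 2 ≠ 0 := by simpa using hq
  have h0 := congrArg (fun u : E3 => u 0) h
  have h1 := congrArg (fun u : E3 => u 1) h
  have h2 := congrArg (fun u : E3 => u 2) h
  simp only [hopf_zero_coord, hopf_one_coord, hopf_two_coord] at h0 h1 h2
  rw [quat_norm_sq, quat_norm_sq] at hn
  have key : rsmul q (quatC (star q * b)) = ‖q‖ ^ 2 • b := by
    rw [quat_norm_sq]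
    ext <;> simp [rsmul]
    · linear_combination -b.re * h0 - b.re / 2 * hn - b.imK * h1 + b.imJ * h2
    · linear_combination -b.imI * h0 - b.imI / 2 * hn - b.imJ * h1 - b.imK * h2
    · linear_combination b.imJ * h0 - b.imJ / 2 * hn - b.imI * h1 + b.re * h2
    · linear_combination b.imK * h0 - b.imK / 2 * hn - b.re * h1 - b.imI * h2
  have e : rsmul q (phase q b) = (‖q‖ ^ 2)⁻¹ • rsmul q (quatC (star q * b)) := by
    rw [phase, ← rsmulL_apply, map_smul]; rfl
  rw [e, key, smul_smul, inv_mul_cancel₀ hq', one_smul]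

lemma norm_phase {q b : ℍ[ℝ]} (hq : q ≠ 0) (h : hopf q = hopf b) : ‖phase q b‖ = 1 := by
  have h1 := congrArg norm (rsmul_phase hq h)
  rw [norm_rsmul] at h1
  have hn : ‖q‖ ^ 2 = ‖b‖ ^ 2 := by rw [norm_hopf, norm_hopf, h]
  have hn' : ‖q‖ = ‖b‖ := (sq_eq_sq₀ (by positivity) (by positivity)).1 hn
  rw [← hn'] at h1
  have : ‖q‖ ≠ 0 := by simpa using hq
  exact mul_left_cancel₀ this (by rw [h1, mul_one])

lemma ContDiffAt.phase {F : Type*} [NormedAddCommGroup F] [NormedSpace ℝ F] {f g : F → ℍ[ℝ]}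
    {x : F} (hf : ContDiffAt ℝ ∞ f x) (hg : ContDiffAt ℝ ∞ g x) (h : f x ≠ 0) :
    ContDiffAt ℝ ∞ (fun y => phase (f y) (g y)) x := by
  unfold SmallBow.phase
  have h2 : ‖f x‖ ^ 2 ≠ 0 := by simpa using h
  exact ((hf.norm_sq ℝ).inv h2).smul (quatC.contDiff.contDiffAt.comp x
    ((conjL.contDiff.contDiffAt.comp x hf).mul hg))

/-- The Hopf fibres are circles, or the single point `0`, for which any angle will do. -/
lemma exists_norm_one_rsmul {q b : ℍ[ℝ]} (h : hopf q = hopf b) :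
    ∃ θ : ℝ, b = rsmul q (Complex.exp (Complex.I * θ)) := by
  by_cases hq : q = 0
  · have : b = 0 := by rw [← hopf_eq_zero, ← h, hopf_eq_zero]; exact hq
    exact ⟨0, by simp [this, hq]⟩
  · refine ⟨(SmallBow.phase q b).arg, ?_⟩
    have := Complex.norm_mul_exp_arg_mul_I (SmallBow.phase q b)
    rw [norm_phase hq h, Complex.ofReal_one, one_mul, mul_comm] at this
    rw [this, rsmul_phase hq h]

end

section

/-! ### Local sections of the Hopf map and the curvature of the phase forms -/

/-- The direction of a quaternion over `r` obtained from the reference quaternion `w`. -/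
def hopfDir (w : ℍ[ℝ]) (r : E3) : ℍ[ℝ] :=
  imQuat ((-2 : ℝ) • r) * w + (2 * ‖r‖) • (w * unitQuat 0)

/-- A quaternion over `r`, for `r` in an open dense cone depending on the reference quaternion. -/
def hopfLift (w : ℍ[ℝ]) (r : E3) : ℍ[ℝ] :=
  (Real.sqrt (2 * ‖r‖) / ‖hopfDir w r‖) • hopfDir w r

lemma hopf_smul (c : ℝ) (b : ℍ[ℝ]) : hopf (c • b) = c ^ 2 • hopf b := by
  apply E3_ext <;> simp [hopf_zero_coord, hopf_one_coord, hopf_two_coord] <;> ring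

/-- Left multiplication by `-2 r` has square `-(2|r|)²`, as has right multiplication by `2|r| i`. As
the two commute, the sum of both applied to `w` satisfies the equation here, the eigenvector
equation for quaternions over positive multiples of `r`. -/
lemma hopfDir_mul_unit (w : ℍ[ℝ]) (r : E3) :
    (2 * ‖r‖) • (hopfDir w r * unitQuat 0) = imQuat ((-2 : ℝ) • r) * hopfDir w r := by
  have h1 : imQuat ((-2 : ℝ) • r) * imQuat ((-2 : ℝ) • r) = ((-(2 * ‖r‖) ^ 2 : ℝ) : ℍ[ℝ]) := by
    rw [mul_pow, E3_norm_sq]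
    apply Quaternion.ext <;> simp only [Quaternion.re_mul, Quaternion.imI_mul, Quaternion.imJ_mul,
      Quaternion.imK_mul, Quaternion.re_coe, Quaternion.imI_coe, Quaternion.imJ_coe,
      Quaternion.imK_coe, re_imQuat, imI_imQuat, imJ_imQuat, imK_imQuat, PiLp.smul_apply,
      smul_eq_mul] <;> ring
  have h2 : (unitQuat 0 * unitQuat 0 : ℍ[ℝ]) = -1 := by ext <;> simp
  rw [hopfDir, mul_add, ← mul_assoc, h1, add_mul, smul_mul_assoc, mul_assoc w, h2, smul_add,
    mul_smul_comm, mul_assoc, smul_smul, Quaternion.coe_mul_eq_smul]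
  simp only [mul_neg, mul_one, neg_smul, smul_neg]
  rw [sq]; abel

/-- Multiplying the eigenvector equation by the conjugate of `u = hopfDir w r` on the right gives
`hopf u = (|u|² / (2|r|)) r`, and the factor in `hopfLift` corrects the length. -/
lemma hopf_hopfLift {w : ℍ[ℝ]} {r : E3} (hr : r ≠ 0) (h : hopfDir w r ≠ 0) :
    hopf (hopfLift w r) = r := by
  have hr' : ‖r‖ ≠ 0 := by simpa using hr
  have hd : ‖hopfDir w r‖ ≠ 0 := by simpa using h
  have e : (2 * ‖r‖) • hopf (hopfDir w r) = ‖hopfDir w r‖ ^ 2 • r := by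
    have h1 := congrArg (fun a => a * star (hopfDir w r)) (hopfDir_mul_unit w r)
    simp only [smul_mul_assoc] at h1
    rw [mul_assoc (imQuat _), Quaternion.self_mul_star, Quaternion.normSq_eq_norm_mul_self,
      Quaternion.mul_coe_eq_smul, ← sq] at h1
    have h2 : hopf (hopfDir w r) =
      imVecL ((-(1 / 2) : ℝ) • (hopfDir w r * unitQuat 0 * star (hopfDir w r))) := rfl
    rw [h2, ← map_smul, smul_comm, h1, ← smul_comm, map_smul, map_smul, imVecL_apply,
      imVec_imQuat, smul_smul, smul_smul]
    congr 1; ring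
  rw [hopfLift, hopf_smul, div_pow, Real.sq_sqrt (by positivity), div_eq_inv_mul, mul_smul, e,
    smul_smul, inv_mul_cancel₀ (by positivity), one_smul]

lemma continuous_hopfDir (w : ℍ[ℝ]) : Continuous (hopfDir w) := by
  unfold hopfDir; fun_prop

lemma contDiffAt_hopfLift {w : ℍ[ℝ]} {r : E3} (hr : r ≠ 0) (h : hopfDir w r ≠ 0) :
    ContDiffAt ℝ ∞ (hopfLift w) r := by
  have h0 : ContDiffAt ℝ ∞ (fun r : E3 => 2 * ‖r‖) r :=
    contDiffAt_const.mul (contDiffAt_norm ℝ hr)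
  have h1 : ContDiffAt ℝ ∞ (hopfDir w) r := by
    unfold hopfDir
    exact ((imQuat.contDiff.contDiffAt.comp r (contDiffAt_id.const_smul (-2 : ℝ))).mul
      contDiffAt_const).add (h0.smul contDiffAt_const)
  unfold hopfLift
  exact ((h0.sqrt (by simpa using hr)).div (h1.norm ℝ h) (by simpa using h)).smul h1

/-- The references `1` and `j` suffice: one component of each direction is `-2 r₀ + 2|r|` and `-2 r₀
- 2|r|` respectively, and these do not both vanish. -/
lemma exists_hopfDir_ne_zero {r : E3} (hr : r ≠ 0) : ∃ w, hopfDir w r ≠ 0 := by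
  by_contra! H
  have h1 := congrArg (fun a : ℍ[ℝ] => a.imI) (H 1)
  have h2 := congrArg (fun a : ℍ[ℝ] => a.imK) (H (unitQuat 1))
  simp [hopfDir] at h1 h2
  have : ‖r‖ = 0 := by linarith
  simp_all

lemma hopf_surjective : Surjective hopf := by
  intro r
  by_cases hr : r = 0
  · exact ⟨0, by rw [hr]; exact hopf_eq_zero.2 rfl⟩
  · obtain ⟨w, hw⟩ := exists_hopfDir_ne_zero hr
    exact ⟨_, hopf_hopfLift hr hw⟩

/-- The Hopf map has a section which is smooth near a given non-zero point. -/
lemma exists_hopf_section {r : E3} (hr : r ≠ 0) : ∃ q : E3 → ℍ[ℝ], (∀ s, hopf (q s) = s) ∧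
    ∃ U : Set E3, IsOpen U ∧ r ∈ U ∧ (0 : E3) ∉ U ∧ ContDiffOn ℝ ∞ q U := by
  classical
  obtain ⟨w, hw⟩ := exists_hopfDir_ne_zero hr
  have hU : IsOpen {s : E3 | s ≠ 0 ∧ hopfDir w s ≠ 0} :=
    isOpen_ne.inter (isOpen_ne.preimage (continuous_hopfDir w))
  -- Off the open set arbitrary preimages are taken, so that `q` is a section everywhere;
  -- `ChartData.lift` then lies in the level set for all values of the coordinate.
  refine ⟨fun s => if s ≠ 0 ∧ hopfDir w s ≠ 0 then hopfLift w s else surjInv hopf_surjective s,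
    fun s => ?_, {s : E3 | s ≠ 0 ∧ hopfDir w s ≠ 0}, hU, ⟨hr, hw⟩, fun h => h.1 rfl, ?_⟩
  · dsimp only
    split_ifs with h
    · exact hopf_hopfLift h.1 h.2
    · exact surjInv_eq _ s
  · have : ContDiffOn ℝ ∞ (hopfLift w) {s : E3 | s ≠ 0 ∧ hopfDir w s ≠ 0} :=
      fun s hs => (contDiffAt_hopfLift hs.1 hs.2).contDiffWithinAt
    exact this.congr fun s hs => if_pos hs

lemma inner_hopf_dhopf (b β : ℍ[ℝ]) :
    ⟪hopf b, dhopf b β⟫_ℝ = (1 / 2) * ‖b‖ ^ 2 * ⟪b, β⟫_ℝ := by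
  rw [E3_inner_eq, quat_norm_sq, quat_inner_eq]
  simp only [hopf_zero_coord, hopf_one_coord, hopf_two_coord, dhopf_zero_coord, dhopf_one_coord,
    dhopf_two_coord]
  ring

lemma cross_coord (u v : E3) : cross u v 0 = u 1 * v 2 - u 2 * v 1 ∧
    cross u v 1 = u 2 * v 0 - u 0 * v 2 ∧ cross u v 2 = u 0 * v 1 - u 1 * v 0 := by
  simp [cross, crossProduct]

/-- The curvature identity in polynomial form: up to powers of `‖b‖`, the left side is `*₃ d (1 /
2r)` and the right side the exterior derivative of the phase form. -/
lemma inner_hopf_cross (b x y : ℍ[ℝ]) :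
    2 * ⟪hopf b, cross (dhopf b x) (dhopf b y)⟫_ℝ = ‖b‖ ^ 4 * ⟪x * unitQuat 0, y⟫_ℝ -
      ‖b‖ ^ 2 * (⟪b, x⟫_ℝ * ⟪b * unitQuat 0, y⟫_ℝ - ⟪b, y⟫_ℝ * ⟪b * unitQuat 0, x⟫_ℝ) := by
  rw [show ‖b‖ ^ 4 = (‖b‖ ^ 2) ^ 2 by ring, E3_inner_eq, quat_norm_sq]
  simp only [cross_coord, hopf_zero_coord, hopf_one_coord, hopf_two_coord, dhopf_zero_coord,
    dhopf_one_coord, dhopf_two_coord, quat_inner_eq]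
  simp
  ring

section PhaseForm

variable {q : E3 → ℍ[ℝ]} {U : Set E3} {t a : E3}

/-- Both sides are derivatives of `hopf (q t) = t - a`. -/
lemma dhopf_fderiv (hU : IsOpen U) (hq : ContDiffOn ℝ ∞ q U)
    (hh : ∀ t ∈ U, hopf (q t) = t - a) (ht : t ∈ U) (u : E3) :
    dhopf (q t) (fderiv ℝ q t u) = u := by
  have hd : DifferentiableAt ℝ q t :=
    (hq.contDiffAt (hU.mem_nhds ht)).differentiableAt (by simp)
  have h1 : HasFDerivAt (fun t => hopf (q t)) ((dhopf (q t)).comp (fderiv ℝ q t)) t :=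
    (hasFDerivAt_hopf (q t)).comp t hd.hasFDerivAt
  have h2 : HasFDerivAt (fun t => hopf (q t)) (ContinuousLinearMap.id ℝ E3) t := by
    refine ((hasFDerivAt_id t).sub_const a).congr_of_eventuallyEq ?_
    filter_upwards [hU.mem_nhds ht] with s hs using hh s hs
  exact congrArg (fun L : E3 →L[ℝ] E3 => L u) (h1.unique h2)

lemma contDiffOn_phaseForm (hU : IsOpen U) (hq : ContDiffOn ℝ ∞ q U) (h0 : ∀ t ∈ U, q t ≠ 0) :
    ContDiffOn ℝ ∞ (phaseForm q) U := by
  rw [contDiffOn_clm_apply]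
  intro u
  have h1 : ContDiffOn ℝ ∞ (fun t => fderiv ℝ q t u) U :=
    (hq.fderiv_of_isOpen hU (by simp)).clm_apply contDiffOn_const
  have h2 : ContDiffOn ℝ ∞ (fun t => -(1 / ‖q t‖ ^ 2)) U :=
    (contDiffOn_const.div (hq.norm_sq ℝ) (fun t ht => by simpa using h0 t ht)).neg
  exact (h2.mul ((hq.mul contDiffOn_const).inner ℝ h1))

lemma phaseForm_apply (q : E3 → ℍ[ℝ]) (t u : E3) :
    phaseForm q t u = -(⟪q t * unitQuat 0, fderiv ℝ q t u⟫_ℝ / ‖q t‖ ^ 2) := by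
  simp [phaseForm]; ring

/-- On `U` the potential is `‖q‖⁻²`. In `dη` the second derivatives of `q` cancel by symmetry; what
remains involves only the first derivatives, whose images under `dhopf` are `u` and `v`, so that
`inner_hopf_cross` applies. -/
lemma curvatureEq_phaseForm (hU : IsOpen U) (hq : ContDiffOn ℝ ∞ q U)
    (hh : ∀ t ∈ U, hopf (q t) = t - a) (h0 : ∀ t ∈ U, q t ≠ 0) (ht : t ∈ U) :
    CurvatureEq (phaseForm q) (fun t' => 1 / (2 * ‖t' - a‖)) t := by
  have hqt : ContDiffAt ℝ ∞ q t := hq.contDiffAt (hU.mem_nhds ht)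
  have hd : HasFDerivAt q (fderiv ℝ q t) t := (hqt.differentiableAt (by simp)).hasFDerivAt
  have hdd : DifferentiableAt ℝ (fderiv ℝ q) t :=
    ((hqt.fderiv_right (m := ∞) (by simp)).differentiableAt (by simp))
  have hη : DifferentiableAt ℝ (phaseForm q) t :=
    ((contDiffOn_phaseForm hU hq h0).contDiffAt (hU.mem_nhds ht)).differentiableAt (by simp)
  have hn : ‖q t‖ ^ 2 ≠ 0 := by simpa using h0 t ht
  have hinv : HasFDerivAt (fun s => (‖q s‖ ^ 2)⁻¹)
      ((-((‖q t‖ ^ 2) ^ 2)⁻¹) • (2 • (innerSL ℝ (q t)).comp (fderiv ℝ q t))) t :=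
    (hasDerivAt_inv hn).comp_hasFDerivAt t hd.norm_sq
  have hform : ∀ u v, fderiv ℝ (phaseForm q) t u v =
      (‖q t‖ ^ 2)⁻¹ ^ 2 * (2 * ⟪q t, fderiv ℝ q t u⟫_ℝ) * ⟪q t * unitQuat 0, fderiv ℝ q t v⟫_ℝ -
      (‖q t‖ ^ 2)⁻¹ * (⟪q t * unitQuat 0, fderiv ℝ (fderiv ℝ q) t u v⟫_ℝ +
        ⟪fderiv ℝ q t u * unitQuat 0, fderiv ℝ q t v⟫_ℝ) := by
    intro u v
    have e1 : fderiv ℝ (fun s => phaseForm q s v) t u = fderiv ℝ (phaseForm q) t u v := by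
      rw [fderiv_clm_apply hη (differentiableAt_const v)]; simp
    have e2 : (fun s => phaseForm q s v) =
        fun s => -((‖q s‖ ^ 2)⁻¹ * ⟪q s * unitQuat 0, fderiv ℝ q s v⟫_ℝ) := by
      funext s; rw [phaseForm_apply, div_eq_inv_mul]
    have h3 : HasFDerivAt (fun s => q s * unitQuat 0)
      (((ContinuousLinearMap.mul ℝ ℍ[ℝ]).flip (unitQuat 0)).comp (fderiv ℝ q t)) t :=
      ((ContinuousLinearMap.mul ℝ ℍ[ℝ]).flip (unitQuat 0)).hasFDerivAt.comp t hd
    have h4 : HasFDerivAt (fun s => fderiv ℝ q s v)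
      ((ContinuousLinearMap.apply ℝ ℍ[ℝ] v).comp (fderiv ℝ (fderiv ℝ q) t)) t :=
      (ContinuousLinearMap.apply ℝ ℍ[ℝ] v).hasFDerivAt.comp t hdd.hasFDerivAt
    have h5 : HasFDerivAt
        (fun s => -((‖q s‖ ^ 2)⁻¹ * ⟪q s * unitQuat 0, fderiv ℝ q s v⟫_ℝ)) _ t :=
      (hinv.mul (h3.inner ℝ h4)).neg
    rw [← e1, e2, h5.fderiv]
    simp [fderivInnerCLM_apply]
    ring
  have hsymm : ∀ u v, fderiv ℝ (fderiv ℝ q) t u v = fderiv ℝ (fderiv ℝ q) t v u :=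
    fun u v => (hqt.isSymmSndFDerivAt (by simpa using ENat.LEInfty.out)).eq u v
  have hpot : ∀ w, fderiv ℝ (fun t' => 1 / (2 * ‖t' - a‖)) t w =
      -((‖q t‖ ^ 2)⁻¹ ^ 3 * (4 * ⟪hopf (q t), w⟫_ℝ)) := by
    intro w
    have e : (fun t' => 1 / (2 * ‖t' - a‖)) =ᶠ[𝓝 t] fun s => (‖q s‖ ^ 2)⁻¹ := by
      filter_upwards [hU.mem_nhds ht] with s hs
      rw [norm_hopf, hh s hs, one_div]
    rw [e.fderiv_eq, hinv.fderiv]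
    have h6 := inner_hopf_dhopf (q t) (fderiv ℝ q t w)
    rw [dhopf_fderiv hU hq hh ht] at h6
    rw [h6]
    simp
    field_simp
    ring
  intro u v
  rw [hform, hform, hpot, hsymm v u]
  have h7 := inner_hopf_cross (q t) (fderiv ℝ q t u) (fderiv ℝ q t v)
  rw [dhopf_fderiv hU hq hh ht, dhopf_fderiv hU hq hh ht] at h7
  have h8 : ⟪fderiv ℝ q t v * unitQuat 0, fderiv ℝ q t u⟫_ℝ =
      -⟪fderiv ℝ q t u * unitQuat 0, fderiv ℝ q t v⟫_ℝ := by
    simp [quat_inner_eq]; ring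
  rw [h8]
  have h9 : 4 * ⟪hopf (q t), cross u v⟫_ℝ = 2 * (2 * ⟪hopf (q t), cross u v⟫_ℝ) := by ring
  rw [h9, h7]
  field_simp
  ring

end PhaseForm

end

section

/-! ### Functions on the pieces of a bow -/

variable {k : ℕ}

namespace Bow

variable (B : Bow k)

@[simp] lemma left_zero : B.left 0 = 0 := rfl

@[simp] lemma right_last : B.right (Fin.last k) = B.l := by
  rw [right, cut, Fin.succ_last, ← Fin.succ_last, Fin.cons_succ, Fin.snoc_last]

@[simp] lemma right_castSucc (σ : Fin k) : B.right σ.castSucc = B.p σ := by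
  rw [right, cut, Fin.cons_succ, Fin.snoc_castSucc]

@[simp] lemma left_succ (σ : Fin k) : B.left σ.succ = B.p σ := by
  rw [left, cut, ← Fin.succ_castSucc, Fin.cons_succ, Fin.snoc_castSucc]

lemma l_pos [NeZero k] : 0 < B.l := (B.pos 0).trans (B.lt 0)

lemma left_nonneg (i : Fin (k + 1)) : 0 ≤ B.left i := by
  induction i using Fin.cases with
  | zero => simp
  | succ σ => rw [left_succ]; exact (B.pos σ).le

lemma right_le [NeZero k] (i : Fin (k + 1)) : B.right i ≤ B.l := by
  induction i using Fin.lastCases with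
  | last => simp
  | cast σ => rw [right_castSucc]; exact (B.lt σ).le

lemma left_lt_right [NeZero k] (i : Fin (k + 1)) : B.left i < B.right i := by
  induction i using Fin.cases with
  | zero =>
    rw [left_zero]
    obtain h | ⟨σ, h⟩ := Fin.eq_castSucc_or_eq_last (0 : Fin (k + 1)) |>.symm
    · rw [h, right_last]; exact B.l_pos
    · rw [h, right_castSucc]; exact B.pos σ
  | succ σ =>
    rw [left_succ]
    obtain h | ⟨τ, h⟩ := Fin.eq_castSucc_or_eq_last σ.succ |>.symm
    · rw [h, right_last]; exact B.lt σ
    · rw [h, right_castSucc]; refine B.strictMono ?_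
      have := congrArg Fin.val h
      simp at this
      exact Fin.lt_def.2 (by omega)

lemma Icc_subset [NeZero k] (i : Fin (k + 1)) : Icc (B.left i) (B.right i) ⊆ Icc 0 B.l :=
  Icc_subset_Icc (B.left_nonneg i) (B.right_le i)

end Bow

lemma exists_mem_Icc_of_path {n : ℕ} (c : Fin (n + 2) → ℝ) {s : ℝ} (h0 : c 0 ≤ s)
    (h1 : s ≤ c (Fin.last (n + 1))) : ∃ i : Fin (n + 1), s ∈ Icc (c i.castSucc) (c i.succ) := by
  induction n with
  | zero => exact ⟨0, h0, h1⟩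
  | succ n ih =>
    by_cases h : s ≤ c (Fin.last (n + 1)).castSucc
    · obtain ⟨i, hi⟩ := ih (fun j => c j.castSucc) h0 h
      exact ⟨i.castSucc, hi⟩
    · exact ⟨Fin.last (n + 1), (not_le.1 h).le, h1⟩

variable (B : Bow k)

lemma Bow.Icc_subset_iUnion : Icc 0 B.l ⊆ ⋃ i, Icc (B.left i) (B.right i) := by
  intro s hs
  have h2 : s ≤ B.cut (Fin.last (k + 1)) := by
    have := B.right_last
    rw [Bow.right, Fin.succ_last] at this
    rw [this]; exact hs.2
  obtain ⟨i, hi⟩ := exists_mem_Icc_of_path B.cut hs.1 h2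
  exact mem_iUnion.2 ⟨i, hi⟩

lemma ae_of_forall_ae {P : ℝ → Prop}
    (h : ∀ i, ∀ᵐ s ∂(volume : Measure ℝ).restrict (Icc (B.left i) (B.right i)), P s) :
    ∀ᵐ s ∂(volume : Measure ℝ).restrict (Icc 0 B.l), P s :=
  ae_restrict_of_ae_restrict_of_subset B.Icc_subset_iUnion ((ae_restrict_iUnion_iff _ _).2 h)

lemma ae_piece [NeZero k] {P : ℝ → Prop}
    (h : ∀ᵐ s ∂(volume : Measure ℝ).restrict (Icc 0 B.l), P s) (i : Fin (k + 1)) :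
    ∀ᵐ s ∂(volume : Measure ℝ).restrict (Icc (B.left i) (B.right i)), P s :=
  ae_restrict_of_ae_restrict_of_subset (B.Icc_subset i) h

/-- The sum of the increments over the pieces, in terms of the jumps at the cuts. -/
lemma sum_increment {A : Type} [AddCommGroup A] (f : Fin (k + 1) → ℝ → A) :
    ∑ i, (f i (B.right i) - f i (B.left i)) =
      f (Fin.last k) B.l - f 0 0 - ∑ σ, (valPlus B f σ - valMinus B f σ) := by
  rw [Finset.sum_sub_distrib, Fin.sum_univ_castSucc, Fin.sum_univ_succ (fun i => f i (B.left i)),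
    Finset.sum_sub_distrib]
  simp [valPlus, valMinus]
  abel

/-- A function that is constant on the pieces and has no jumps is constant. -/
lemma eq_of_piecewise_const [NeZero k] {A : Type} (f : Fin (k + 1) → ℝ → A)
    (h : ∀ i, ∀ v ∈ Icc (B.left i) (B.right i), f i v = f i (B.left i))
    (hj : ∀ σ, valPlus B f σ = valMinus B f σ) (i : Fin (k + 1)) :
    ∀ v ∈ Icc (B.left i) (B.right i), f i v = f 0 0 := by
  induction i using Fin.induction with
  | zero => intro v hv; exact h 0 v hv
  | succ σ ih =>
    intro v hv
    rw [h _ v hv, B.left_succ]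
    have h1 := hj σ
    rw [valPlus, valMinus] at h1
    rw [h1]
    exact ih _ ⟨by simpa using (B.left_lt_right σ.castSucc).le, by simp⟩

/-- The sum over the cuts to the left of the `i`-th piece. -/
def leftSum (d : Fin k → ℝ) (i : Fin (k + 1)) : ℝ :=
  ∑ σ : Fin k, if (σ : ℕ) < (i : ℕ) then d σ else 0

@[simp] lemma leftSum_zero (d : Fin k → ℝ) : leftSum d 0 = 0 := by simp [leftSum]

@[simp] lemma leftSum_last (d : Fin k → ℝ) : leftSum d (Fin.last k) = ∑ σ, d σ := by
  simp [leftSum]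

lemma leftSum_succ (d : Fin k → ℝ) (σ : Fin k) :
    leftSum d σ.succ = leftSum d σ.castSucc + d σ := by
  have h : d σ = ∑ ρ : Fin k, if ρ = σ then d ρ else 0 := by simp
  rw [leftSum, leftSum, h, ← Finset.sum_add_distrib]
  refine Finset.sum_congr rfl fun ρ _ => ?_
  simp only [Fin.val_succ, Fin.val_castSucc]
  rcases lt_trichotomy (ρ : ℕ) σ with h | h | h
  · have : ρ ≠ σ := fun e => by simp [e] at h
    simp [h, this, Nat.lt_succ_of_lt h]
  · have : ρ = σ := Fin.ext h
    simp [this]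
  · have h1 : ρ ≠ σ := fun e => by simp [e] at h
    have h2 : ¬ (ρ : ℕ) < σ + 1 := by omega
    have h3 : ¬ (ρ : ℕ) < σ := by omega
    simp [h1, h2, h3]

/-- The cuts to the left of the `i`-th piece. -/
def leftSet (i : Fin (k + 1)) : Finset (Fin k) := Finset.univ.filter fun σ => (σ : ℕ) < (i : ℕ)

lemma leftSum_eq (d : Fin k → ℝ) (i : Fin (k + 1)) : leftSum d i = ∑ σ ∈ leftSet i, d σ := by
  rw [leftSet, Finset.sum_filter, leftSum]

/-! ### Functions of class `H¹` -/

section H1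

variable {a b : ℝ}

lemma _root_.LipschitzWith.comp_absolutelyContinuousOnInterval {X Y : Type*}
    [PseudoMetricSpace X] [PseudoMetricSpace Y] {K : NNReal} {φ : X → Y} (hφ : LipschitzWith K φ)
    {f : ℝ → X} (hf : AbsolutelyContinuousOnInterval f a b) :
    AbsolutelyContinuousOnInterval (fun x => φ (f x)) a b := by
  unfold AbsolutelyContinuousOnInterval at hf ⊢
  refine squeeze_zero (fun E => Finset.sum_nonneg fun _ _ => dist_nonneg) (fun E => ?_)
    (by simpa using hf.const_mul (K : ℝ))
  rw [Finset.mul_sum]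
  exact Finset.sum_le_sum fun i _ => hφ.dist_le_mul _ _

lemma lipschitzWith_exp_I : LipschitzWith 1 fun x : ℝ => Complex.exp (Complex.I * x) := by
  refine lipschitzWith_of_nnnorm_deriv_le (𝕜 := ℝ) (fun x => ?_) fun x => ?_
  · fun_prop
  · have h : HasDerivAt (fun x : ℝ => Complex.exp (Complex.I * x))
      (Complex.exp (Complex.I * x) * (Complex.I * 1)) x :=
      ((Complex.ofRealCLM.hasDerivAt (x := x)).const_mul Complex.I).cexp
    rw [h.deriv, ← NNReal.coe_le_coe, coe_nnnorm, norm_mul, mul_comm Complex.I,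
      Complex.norm_exp_ofReal_mul_I]
    simp

lemma ae_restrict_Icc_iff {P : ℝ → Prop} (hab : a ≤ b) :
    (∀ᵐ s ∂(volume : Measure ℝ).restrict (Icc a b), P s) ↔ ∀ᵐ s, s ∈ uIcc a b → P s := by
  rw [ae_restrict_iff' measurableSet_Icc, uIcc_of_le hab]

/-- The primitive of a square integrable function is of class `H¹`. -/
lemma isH1_primitive {φ : ℝ → ℝ} {c d₀ : ℝ} (hca : c ≤ a) (hab : a ≤ b)
    (hφ : MemLp φ 2 ((volume : Measure ℝ).restrict (Icc c b))) :
    IsH1 (fun x => (∫ s in c..x, φ s) + d₀) a b ∧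
    ∀ᵐ s ∂(volume : Measure ℝ).restrict (Icc a b),
      HasDerivAt (fun x => (∫ s in c..x, φ s) + d₀) (φ s) s := by
  have hcb : c ≤ b := hca.trans hab
  have hint : IntervalIntegrable φ volume c b := by
    rw [intervalIntegrable_iff_integrableOn_Icc_of_le hcb]
    exact hφ.integrable (by norm_num)
  have hder : ∀ᵐ s ∂(volume : Measure ℝ).restrict (Icc a b),
      HasDerivAt (fun x => (∫ s in c..x, φ s) + d₀) (φ s) s := by
    rw [ae_restrict_Icc_iff hab]
    filter_upwards [hint.ae_hasDerivAt_integral] with s hs hs'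
    refine (hs ?_ c left_mem_uIcc).add_const d₀
    rw [uIcc_of_le hab] at hs'; rw [uIcc_of_le hcb]
    exact ⟨hca.trans hs'.1, hs'.2⟩
  refine ⟨⟨?_, ?_⟩, hder⟩
  · have h1 : AbsolutelyContinuousOnInterval (fun x => ∫ s in c..x, φ s) a b :=
      (hint.absolutelyContinuousOnInterval_intervalIntegral left_mem_uIcc).mono
        (by rw [uIcc_of_le hab, uIcc_of_le hcb]; exact Icc_subset_Icc_left hca)
    have h2 : LipschitzWith 1 fun x : ℝ => x + d₀ := by
      refine LipschitzWith.of_dist_le_mul fun x y => ?_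
      simp
    exact h2.comp_absolutelyContinuousOnInterval h1
  · refine (memLp_congr_ae ?_).2 (hφ.mono_measure (Measure.restrict_mono_set _
      (Icc_subset_Icc_left hca)))
    filter_upwards [hder] with s hs using hs.deriv

lemma isH1_exp {f : ℝ → ℝ} (hab : a ≤ b) (hf : IsH1 f a b) :
    IsH1 (fun x => Complex.exp (Complex.I * (f x : ℂ))) a b ∧
    ∀ᵐ s ∂(volume : Measure ℝ).restrict (Icc a b),
      deriv (fun x => Complex.exp (Complex.I * (f x : ℂ))) s =
        Complex.exp (Complex.I * (f s : ℂ)) * (Complex.I * ((deriv f s : ℝ) : ℂ)) := by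
  have hder : ∀ᵐ s ∂(volume : Measure ℝ).restrict (Icc a b),
      deriv (fun x => Complex.exp (Complex.I * (f x : ℂ))) s =
        Complex.exp (Complex.I * (f s : ℂ)) * (Complex.I * ((deriv f s : ℝ) : ℂ)) := by
    rw [ae_restrict_Icc_iff hab]
    filter_upwards [hf.1.ae_differentiableAt] with s hs hs'
    have h1 := (hs hs').hasDerivAt
    exact (((h1.ofReal_comp).const_mul Complex.I).cexp).deriv
  refine ⟨⟨lipschitzWith_exp_I.comp_absolutelyContinuousOnInterval hf.1, ?_⟩, hder⟩
  refine MemLp.of_le hf.2 (stronglyMeasurable_deriv _ |>.aestronglyMeasurable) ?_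
  filter_upwards [hder] with s hs
  rw [hs, norm_mul, mul_comm Complex.I, Complex.norm_exp_ofReal_mul_I]
  simp

end H1

end

section

/-! ### The Hilbert space of data -/

variable {k : ℕ} (B : Bow k)

/-- Lebesgue measure on the interval. -/
abbrev Bow.vol : Measure ℝ := (volume : Measure ℝ).restrict (Icc 0 B.l)

/-- The `L²` component as a linear function of the data. -/
def fstL : Dat B →L[ℝ] Lp ℍ[ℝ] 2 B.vol := WithLp.fstL 2 ℝ _ _

/-- The bifundamental components as linear functions of the data. -/
def sndL (σ : Fin k) : Dat B →L[ℝ] ℍ[ℝ] :=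
  (PiLp.proj 2 (fun _ : Fin k => ℍ[ℝ]) σ).comp (WithLp.sndL 2 ℝ _ _)

/-- The constant functions. -/
def constL : ℍ[ℝ] →L[ℝ] Lp ℍ[ℝ] 2 B.vol := Lp.constL 2 B.vol ℝ

/-- The imaginary part of a quaternion valued function. -/
def imPart : Lp ℍ[ℝ] 2 B.vol →L[ℝ] Lp ℍ[ℝ] 2 B.vol :=
  ContinuousLinearMap.compLpL 2 B.vol (imQuat.comp imVecL)

/-- The primitive of the real part of the `L²` component. -/
def primL (v : ℝ) : Dat B →L[ℝ] ℝ :=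
  (innerSL ℝ (indicatorConstLp 2 (measurableSet_Icc (a := 0) (b := v))
    (measure_ne_top B.vol _) (1 : ℍ[ℝ]))).comp (fstL B)

variable {B}

@[simp] lemma fstL_apply (x : Dat B) : fstL B x = x.fst := rfl
@[simp] lemma sndL_apply (σ : Fin k) (x : Dat B) : sndL B σ x = x.snd σ := rfl

lemma constL_ae (q : ℍ[ℝ]) : ∀ᵐ s ∂B.vol, constL B q s = q := Lp.coeFn_const 2 B.vol q

lemma imPart_ae (T : Lp ℍ[ℝ] 2 B.vol) : ∀ᵐ s ∂B.vol, imPart B T s = imQuat (imVec (T s)) :=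
  ContinuousLinearMap.coeFn_compLpL _ _

lemma imPart_constL (q : ℍ[ℝ]) : imPart B (constL B q) = constL B (imQuat (imVec q)) := by
  apply Lp.ext
  filter_upwards [imPart_ae (constL B q), constL_ae (B := B) q,
    constL_ae (B := B) (imQuat (imVec q))] with s h1 h2 h3
  rw [h1, h2, h3]

lemma Dat.ext_iff' {x y : Dat B} : x = y ↔ x.fst = y.fst ∧ ∀ σ, x.snd σ = y.snd σ := by
  constructor
  · rintro rfl; exact ⟨rfl, fun _ => rfl⟩
  · rintro ⟨h1, h2⟩
    refine (WithLp.ofLp_injective 2) (Prod.ext h1 ((WithLp.ofLp_injective 2) (funext h2)))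

lemma dat_inner (x y : Dat B) :
    ⟪x, y⟫_ℝ = ⟪x.fst, y.fst⟫_ℝ + ∑ σ, ⟪x.snd σ, y.snd σ⟫_ℝ := by
  rw [WithLp.prod_inner_apply, PiLp.inner_apply]; rfl

lemma memLp_re (T : Lp ℍ[ℝ] 2 B.vol) : MemLp (fun s => (T s).re) 2 B.vol :=
  reL.comp_memLp' (Lp.memLp T)

lemma memLp_imVec (T : Lp ℍ[ℝ] 2 B.vol) (j : Fin 3) : MemLp (fun s => imVec (T s) j) 2 B.vol :=
  ((EuclideanSpace.proj (𝕜 := ℝ) j).comp imVecL).comp_memLp' (Lp.memLp T)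

lemma intervalIntegrable_of_memLp {φ : ℝ → ℝ} (hφ : MemLp φ 2 B.vol) {v w : ℝ}
    (hv : v ∈ Icc 0 B.l) (hw : w ∈ Icc 0 B.l) : IntervalIntegrable φ volume v w := by
  have h0 : (0 : ℝ) ≤ B.l := hv.1.trans hv.2
  have : IntervalIntegrable φ volume 0 B.l := by
    rw [intervalIntegrable_iff_integrableOn_Icc_of_le h0]
    exact hφ.integrable (by norm_num)
  refine this.mono_set ?_
  rw [uIcc_of_le h0]
  exact uIcc_subset_Icc hv hw

/-- The definition of `primL` as an inner product with an indicator function makes it linear and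
continuous for every `v`; it is the integral for `v` in `[0, l]`. -/
lemma primL_eq {v : ℝ} (hv : v ∈ Icc 0 B.l) (x : Dat B) :
    primL B v x = ∫ r in (0 : ℝ)..v, (x.fst r).re := by
  have h1 : primL B v x = ⟪(1 : ℍ[ℝ]), ∫ r in Icc 0 v, x.fst r ∂B.vol⟫_ℝ :=
    L2.inner_indicatorConstLp_eq_inner_setIntegral ℝ _ _ _ _
  have hint : Integrable x.fst (B.vol.restrict (Icc 0 v)) :=
    ((Lp.memLp x.fst).integrable (by norm_num)).restrict
  have h2 : ∀ a : ℍ[ℝ], ⟪(1 : ℍ[ℝ]), a⟫_ℝ = reL a := fun a => by simp [quat_inner_eq]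
  rw [h1, h2, ← reL.integral_comp_comm hint, Measure.restrict_restrict measurableSet_Icc,
    Icc_inter_Icc, sup_idem, inf_eq_left.2 hv.2, integral_Icc_eq_integral_Ioc,
    intervalIntegral.integral_of_le hv.1]
  rfl

lemma primL_constL [NeZero k] {v : ℝ} (hv : v ∈ Icc 0 B.l) {x : Dat B} {q : ℍ[ℝ]}
    (hx : x.fst = constL B q) : primL B v x = v * q.re := by
  rw [primL_eq hv, intervalIntegral.integral_congr_ae_restrict (g := fun _ => q.re)]
  · simp
  · rw [uIoc_of_le hv.1]
    have h := constL_ae (B := B) q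
    rw [← hx] at h
    filter_upwards [ae_restrict_of_ae_restrict_of_subset
      (Ioc_subset_Icc_self.trans (Icc_subset_Icc_right hv.2)) h] with s hs
    rw [hs]

section Pieces

variable [NeZero k]

lemma Bow.mem_Icc {i : Fin (k + 1)} {v : ℝ} (hv : v ∈ Icc (B.left i) (B.right i)) :
    v ∈ Icc 0 B.l := B.Icc_subset i hv

lemma Bow.zero_mem : (0 : ℝ) ∈ Icc 0 B.l := ⟨le_rfl, B.l_pos.le⟩
lemma Bow.l_mem : B.l ∈ Icc 0 B.l := ⟨B.l_pos.le, le_rfl⟩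
lemma Bow.left_mem (i : Fin (k + 1)) : B.left i ∈ Icc 0 B.l :=
  B.Icc_subset i ⟨le_rfl, (B.left_lt_right i).le⟩
lemma Bow.right_mem (i : Fin (k + 1)) : B.right i ∈ Icc 0 B.l :=
  B.Icc_subset i ⟨(B.left_lt_right i).le, le_rfl⟩

/-- The primitive from `0` is one function for all pieces, so it has no jumps in `sum_increment`. -/
lemma sum_integral {F : ℝ → ℝ} (hF : IntervalIntegrable F volume 0 B.l) :
    ∑ i, ∫ s in (B.left i)..(B.right i), F s = ∫ s in (0 : ℝ)..B.l, F s := by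
  have h := sum_increment B (fun _ v => ∫ s in (0 : ℝ)..v, F s)
  simp only [valPlus, valMinus, sub_self, Finset.sum_const_zero, sub_zero,
    intervalIntegral.integral_same] at h
  rw [← h]
  refine Finset.sum_congr rfl fun i _ => ?_
  have hm : ∀ v ∈ Icc 0 B.l, IntervalIntegrable F volume 0 v := fun v hv =>
    hF.mono_set (by rw [uIcc_of_le B.l_pos.le]; exact uIcc_subset_Icc Bow.zero_mem hv)
  exact (intervalIntegral.integral_interval_sub_left (hm _ (Bow.right_mem i))
    (hm _ (Bow.left_mem i))).symm

lemma memLp_left {φ : ℝ → ℝ} (hφ : MemLp φ 2 B.vol) (i : Fin (k + 1)) :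
    MemLp φ 2 ((volume : Measure ℝ).restrict (Icc 0 (B.right i))) :=
  hφ.mono_measure (Measure.restrict_mono_set _ (Icc_subset_Icc_right (B.right_le i)))

/-- A function of class `H¹` on the bow with given derivative and jumps. -/
lemma exists_bowH1 {φ : ℝ → ℝ} (hφ : MemLp φ 2 B.vol) {d : Fin k → ℝ}
    (h : (∫ s in (0 : ℝ)..B.l, φ s) + ∑ σ, d σ = 0) :
    ∃ f : Fin (k + 1) → ℝ → ℝ, IsBowH1 B f ∧ f 0 0 = 0 ∧
      (∀ i, ∀ᵐ s ∂(volume : Measure ℝ).restrict (Icc (B.left i) (B.right i)),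
        deriv (f i) s = φ s) ∧ (∀ σ, valPlus B f σ - valMinus B f σ = d σ) ∧
      ∀ i v, f i v = (∫ s in (0 : ℝ)..v, φ s) + leftSum d i := by
  have hH := fun i => isH1_primitive (d₀ := leftSum d i) (B.left_nonneg i)
    (B.left_lt_right i).le (memLp_left hφ i)
  refine ⟨fun i v => (∫ s in (0 : ℝ)..v, φ s) + leftSum d i, ⟨fun i => (hH i).1, ?_⟩, ?_,
    fun i => ?_, fun σ => ?_, fun _ _ => rfl⟩
  · simp [h]
  · simp
  · filter_upwards [(hH i).2] with s hs using hs.deriv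
  · simp only [valPlus, valMinus, leftSum_succ]; ring

/-- The increments of a function of class `H¹` on the bow. -/
lemma bowH1_sum_deriv {f : Fin (k + 1) → ℝ → ℝ} (hf : IsBowH1 B f) :
    (∑ i, ∫ s in (B.left i)..(B.right i), deriv (f i) s) +
      ∑ σ, (valPlus B f σ - valMinus B f σ) = 0 := by
  have h : ∀ i, ∫ s in (B.left i)..(B.right i), deriv (f i) s =
      f i (B.right i) - f i (B.left i) := fun i => (hf.1 i).1.integral_deriv_eq_sub
  simp only [h]
  rw [sum_increment, hf.2]
  ring

end Pieces

/-! ### The based gauge group -/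

section Gauge

variable [NeZero k]

/-- The data `y` are obtained from `x` by the gauge transformation with jumps `θ`. -/
structure GaugeRel (x y : Dat B) (θ : Fin k → ℝ) : Prop where
  im : imPart B x.fst = imPart B y.fst
  snd : ∀ σ, y.snd σ = rsmul (x.snd σ) (Complex.exp (Complex.I * (θ σ : ℂ)))
  sum : ∑ σ, θ σ + (primL B B.l y - primL B B.l x) = 0

/-- The argument at a point of the gauge transformation that relates `x` and `y`. -/
def gaugeAngle (x y : Dat B) (θ : Fin k → ℝ) (i : Fin (k + 1)) (v : ℝ) : ℝ :=
  leftSum θ i + (primL B v y - primL B v x)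

lemma norm_exp_I (a : ℝ) : ‖Complex.exp (Complex.I * (a : ℂ))‖ = 1 := by
  rw [mul_comm, Complex.norm_exp_ofReal_mul_I]

lemma integral_re_sub {v : ℝ} (hv : v ∈ Icc 0 B.l) (x y : Dat B) :
    ∫ s in (0 : ℝ)..v, ((y.fst s).re - (x.fst s).re) = primL B v y - primL B v x := by
  rw [primL_eq hv, primL_eq hv, intervalIntegral.integral_sub]
  · exact intervalIntegrable_of_memLp (memLp_re y.fst) Bow.zero_mem hv
  · exact intervalIntegrable_of_memLp (memLp_re x.fst) Bow.zero_mem hv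

/-- The gauge transformation is `exp (i f)`, where `f` vanishes at `0`, has the difference of the
`t₀` as derivative and the `θ_σ` as jumps; the total being zero means that `f` closes up on the
circle. -/
lemma GaugeRel.exists_gauge {x y : Dat B} {θ : Fin k → ℝ} (h : GaugeRel x y θ) :
    ∃ g, IsBasedGauge B g ∧ GaugeAct B g x y ∧ ∀ i, ∀ v ∈ Icc (B.left i) (B.right i),
      g i v = Complex.exp (Complex.I * (gaugeAngle x y θ i v : ℂ)) := by
  have hφ : MemLp (fun s => (y.fst s).re - (x.fst s).re) 2 B.vol :=
    (memLp_re y.fst).sub (memLp_re x.fst)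
  obtain ⟨f, hf, hf0, hfd, hfj, hfv⟩ := exists_bowH1 hφ (d := θ) (by
    rw [integral_re_sub Bow.l_mem]; linarith [h.sum])
  have hE := fun i => isH1_exp (B.left_lt_right i).le (hf.1 i)
  refine ⟨fun i s => Complex.exp (Complex.I * (f i s : ℂ)), ⟨⟨fun i => (hE i).1, ?_⟩, ?_, ?_⟩,
    ⟨fun i => ?_, fun σ => ?_⟩, fun i v hv => ?_⟩
  · simp only [hf.2]
  · intro i s _; exact norm_exp_I _
  · simp [hf0]
  · have him : ∀ᵐ s ∂B.vol, imQuat (imVec (x.fst s)) = imQuat (imVec (y.fst s)) := by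
      filter_upwards [imPart_ae x.fst, imPart_ae y.fst] with s h1 h2
      rw [← h1, ← h2, h.im]
    filter_upwards [(hE i).2, hfd i, ae_piece B him i] with s h1 h2 h3
    rw [h1, h2, inv_mul_cancel_left₀ (Complex.exp_ne_zero _)]
    have h4 := congrArg (fun q : ℍ[ℝ] => q.imI) h3
    have h5 := congrArg (fun q : ℍ[ℝ] => q.imJ) h3
    have h6 := congrArg (fun q : ℍ[ℝ] => q.imK) h3
    simp only [imI_imQuat, imJ_imQuat, imK_imQuat, imVec_zero', imVec_one', imVec_two'] at h4 h5 h6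
    apply Quaternion.ext <;> simp [h4, h5, h6]
  · rw [h.snd σ]
    congr 1
    simp only [valMinus, valPlus]
    rw [← Complex.exp_neg, ← Complex.exp_add, ← hfj σ]
    congr 1
    simp only [valMinus, valPlus]
    push_cast; ring
  · dsimp only
    rw [hfv, integral_re_sub (Bow.mem_Icc hv), gaugeAngle, add_comm]

lemma ae_differentiableAt_complex {f : ℝ → ℂ} {a b : ℝ}
    (hf : AbsolutelyContinuousOnInterval f a b) :
    ∀ᵐ s, s ∈ uIcc a b → DifferentiableAt ℝ f s := by
  have h1 : LipschitzWith 1 Complex.re := by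
    refine LipschitzWith.of_dist_le_mul fun x y => ?_
    rw [Real.dist_eq, ← Complex.sub_re, Complex.dist_eq, NNReal.coe_one, one_mul]
    exact Complex.abs_re_le_norm _
  have h2 : LipschitzWith 1 Complex.im := by
    refine LipschitzWith.of_dist_le_mul fun x y => ?_
    rw [Real.dist_eq, ← Complex.sub_im, Complex.dist_eq, NNReal.coe_one, one_mul]
    exact Complex.abs_im_le_norm _
  filter_upwards [(h1.comp_absolutelyContinuousOnInterval hf).ae_differentiableAt,
    (h2.comp_absolutelyContinuousOnInterval hf).ae_differentiableAt] with s h3 h4 hs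
  have h5 : DifferentiableAt ℝ (fun x => (((f x).re : ℝ) : ℂ) + (((f x).im : ℝ) : ℂ) * Complex.I) s :=
    (Complex.ofRealCLM.differentiableAt.comp s (h3 hs)).add
      ((Complex.ofRealCLM.differentiableAt.comp s (h4 hs)).mul_const _)
  simpa only [Complex.re_add_im] using h5

/-- Unitarity makes `g⁻¹ g'` purely imaginary, so that its imaginary part, which is all that
`GaugeAct` records, determines `g'`. -/
lemma inv_mul_deriv_eq {g : ℝ → ℂ} {s : ℝ} (hd : DifferentiableAt ℝ g s)
    (h : ∀ᶠ r in 𝓝 s, ‖g r‖ = 1) :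
    deriv g s = g s * (Complex.I * (((g s)⁻¹ * deriv g s).im : ℂ)) := by
  have h1 : HasDerivAt (fun r => ‖g r‖ ^ 2) 0 s := by
    refine (hasDerivAt_const s (1 : ℝ)).congr_of_eventuallyEq ?_
    filter_upwards [h] with r hr
    rw [hr]; norm_num
  have h2 := h1.unique hd.hasDerivAt.norm_sq
  have hn : ‖g s‖ = 1 := h.self_of_nhds
  have hne : g s ≠ 0 := by rw [← norm_ne_zero_iff, hn]; norm_num
  have h3 : ((g s)⁻¹ * deriv g s).re = 0 := by
    rw [Complex.inv_def, Complex.normSq_eq_norm_sq, hn]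
    rw [Complex.inner] at h2
    have : (deriv g s * (starRingEnd ℂ) (g s)).re = 0 := by linarith
    rw [mul_comm] at this
    simpa using this
  have h4 : (g s)⁻¹ * deriv g s = Complex.I * (((g s)⁻¹ * deriv g s).im : ℂ) := by
    generalize (g s)⁻¹ * deriv g s = w at h3 ⊢
    apply Complex.ext <;> simp [h3]
  rw [← h4, mul_inv_cancel_left₀ hne]

/-- A gauge transformation is the exponential of the primitive of its logarithmic derivative. -/
lemma gauge_eq_exp {x y : Dat B} {g : Fin (k + 1) → ℝ → ℂ} (hg : IsBasedGauge B g)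
    (hxy : GaugeAct B g x y) {θ : Fin k → ℝ}
    (hθ : ∀ σ, valPlus B g σ = valMinus B g σ * Complex.exp (Complex.I * (θ σ : ℂ)))
    (i : Fin (k + 1)) : ∀ v ∈ Icc (B.left i) (B.right i),
      g i v = Complex.exp (Complex.I * (gaugeAngle x y θ i v : ℂ)) := by
  set φ : ℝ → ℝ := fun s => (y.fst s).re - (x.fst s).re with hφd
  have hφ : MemLp φ 2 B.vol := (memLp_re y.fst).sub (memLp_re x.fst)
  -- Minus the expected angle of `g`; the claim is that `G = g exp (i f)` is identically `1`. On
  -- each piece it is absolutely continuous with derivative zero almost everywhere, and its jumps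
  -- are trivial.
  set f : Fin (k + 1) → ℝ → ℝ := fun i v => (∫ s in (0 : ℝ)..v, -φ s) + -leftSum θ i with hf
  have hH := fun i => isH1_primitive (d₀ := -leftSum θ i) (B.left_nonneg i)
    (B.left_lt_right i).le (memLp_left hφ i).neg
  have hE := fun i => isH1_exp (B.left_lt_right i).le (hH i).1
  set G : Fin (k + 1) → ℝ → ℂ := fun i v => g i v * Complex.exp (Complex.I * (f i v : ℂ)) with hG
  have hconst : ∀ i, ∀ v ∈ Icc (B.left i) (B.right i), G i v = G i (B.left i) := by
    intro i
    have hle := (B.left_lt_right i).le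
    have hac : AbsolutelyContinuousOnInterval (G i) (B.left i) (B.right i) :=
      (hg.1.1 i).1.smul (hE i).1.1
    obtain ⟨C, hC⟩ := hac.const_of_ae_hasDerivAt_zero (by
      have h1 := (ae_restrict_Icc_iff hle).1 (hxy.1 i)
      have h2 := (ae_restrict_Icc_iff hle).1 (hH i).2
      -- The endpoints are discarded: `‖g‖ = 1` is known only on the closed piece, and is needed on
      -- a neighbourhood of the point.
      have h3 : ∀ᵐ s : ℝ, s ≠ B.left i ∧ s ≠ B.right i := by
        have a1 : ∀ᵐ s : ℝ, s ≠ B.left i := Measure.ae_ne _ _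
        have a2 : ∀ᵐ s : ℝ, s ≠ B.right i := Measure.ae_ne _ _
        filter_upwards [a1, a2] with s b1 b2 using ⟨b1, b2⟩
      filter_upwards [h1, h2, h3, ae_differentiableAt_complex (hg.1.1 i).1] with s h1 h2 h3 h4 hs
      have hs' : s ∈ Icc (B.left i) (B.right i) := by rwa [uIcc_of_le hle] at hs
      have hI : Ioo (B.left i) (B.right i) ∈ 𝓝 s :=
        Ioo_mem_nhds (lt_of_le_of_ne hs'.1 (Ne.symm h3.1)) (lt_of_le_of_ne hs'.2 h3.2)
      have hn : ∀ᶠ r in 𝓝 s, ‖g i r‖ = 1 := by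
        filter_upwards [hI] with r hr using hg.2.1 i r ⟨hr.1.le, hr.2.le⟩
      have h5 := inv_mul_deriv_eq (h4 hs) hn
      have h6 : φ s = ((g i s)⁻¹ * deriv (g i) s).im := by
        have := congrArg (fun q : ℍ[ℝ] => q.re) (h1 hs)
        simp only [Quaternion.re_add, Quaternion.re_coe] at this
        rw [hφd]; simp only; rw [this]; ring
      rw [← h6] at h5
      have h7 : HasDerivAt (fun v => Complex.exp (Complex.I * (f i v : ℂ)))
          (Complex.exp (Complex.I * (f i s : ℂ)) * (Complex.I * ((-φ s : ℝ) : ℂ))) s :=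
        (((h2 hs).ofReal_comp).const_mul Complex.I).cexp
      have h8 := (h4 hs).hasDerivAt.mul h7
      convert! h8 using 1
      rw [h5]; push_cast; ring)
    rw [uIcc_of_le hle] at hC
    intro v hv
    rw [hC v hv, hC _ ⟨le_rfl, hle⟩]
  have hjump : ∀ σ, valPlus B G σ = valMinus B G σ := by
    intro σ
    have h1 := hθ σ
    simp only [valPlus, valMinus] at h1
    simp only [valPlus, valMinus, hG, h1, mul_assoc, ← Complex.exp_add]
    congr 2
    simp only [hf, leftSum_succ]
    push_cast; ring
  intro v hv
  have h1 := eq_of_piecewise_const B G hconst hjump i v hv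
  have h2 : G 0 0 = 1 := by simp [hG, hf, hg.2.2]
  rw [h2] at h1
  have h3 : f i v = -gaugeAngle x y θ i v := by
    rw [hf]; simp only [gaugeAngle, intervalIntegral.integral_neg]
    rw [integral_re_sub (Bow.mem_Icc hv)]; ring
  simp only [hG, h3] at h1
  have h4 := eq_inv_of_mul_eq_one_left h1
  rw [h4, ← Complex.exp_neg]
  congr 1; push_cast; ring

/-- The arguments of the jumps of `g` give the angles only modulo `2π`. Since `g = 1` at `0 ∼ l`,
the total angle is then `2πn`, and subtracting `2πn` from the angle at one cut makes the total zero
without changing any exponential. -/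
lemma exists_gaugeRel {x y : Dat B} {g : Fin (k + 1) → ℝ → ℂ} (hg : IsBasedGauge B g)
    (hxy : GaugeAct B g x y) : ∃ θ, GaugeRel x y θ ∧ ∀ i, ∀ v ∈ Icc (B.left i) (B.right i),
      g i v = Complex.exp (Complex.I * (gaugeAngle x y θ i v : ℂ)) := by
  have hM : ∀ σ, ‖valMinus B g σ‖ = 1 := fun σ =>
    hg.2.1 _ _ ⟨by simpa using (B.left_lt_right σ.castSucc).le, by simp⟩
  have hP : ∀ σ, ‖valPlus B g σ‖ = 1 := fun σ =>
    hg.2.1 _ _ ⟨by simp, by simpa using (B.left_lt_right σ.succ).le⟩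
  have hM0 : ∀ σ, valMinus B g σ ≠ 0 := fun σ => by rw [← norm_ne_zero_iff, hM]; norm_num
  set θ₀ : Fin k → ℝ := fun σ => ((valMinus B g σ)⁻¹ * valPlus B g σ).arg with hθ₀
  have hθ : ∀ σ, Complex.exp (Complex.I * (θ₀ σ : ℂ)) = (valMinus B g σ)⁻¹ * valPlus B g σ := by
    intro σ
    have h := Complex.norm_mul_exp_arg_mul_I ((valMinus B g σ)⁻¹ * valPlus B g σ)
    rwa [norm_mul, norm_inv, hM, hP, inv_one, one_mul, Complex.ofReal_one, one_mul, mul_comm] at h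
  have hjump : ∀ θ : Fin k → ℝ, (∀ σ, Complex.exp (Complex.I * (θ σ : ℂ)) =
      (valMinus B g σ)⁻¹ * valPlus B g σ) →
      ∀ σ, valPlus B g σ = valMinus B g σ * Complex.exp (Complex.I * (θ σ : ℂ)) := by
    intro θ h σ
    rw [h, mul_inv_cancel_left₀ (hM0 σ)]
  have h1 := gauge_eq_exp hg hxy (hjump θ₀ hθ) (Fin.last k) B.l
    ⟨by simpa using (B.left_lt_right (Fin.last k)).le, by simp⟩
  rw [← hg.1.2, hg.2.2, eq_comm, Complex.exp_eq_one_iff] at h1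
  obtain ⟨n, hn⟩ := h1
  have hn' : gaugeAngle x y θ₀ (Fin.last k) B.l = n * (2 * Real.pi) := by
    have := congrArg Complex.im hn
    simpa using this
  set θ : Fin k → ℝ := Function.update θ₀ 0 (θ₀ 0 - n * (2 * Real.pi)) with hθd
  have hθ' : ∀ σ, Complex.exp (Complex.I * (θ σ : ℂ)) = (valMinus B g σ)⁻¹ * valPlus B g σ := by
    intro σ
    rw [← hθ σ]
    by_cases h : σ = 0
    · subst h
      rw [hθd, Function.update_self, Complex.exp_eq_exp_iff_exists_int]
      exact ⟨-n, by push_cast; ring⟩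
    · rw [hθd, Function.update_of_ne h]
  have hsum : ∑ σ, θ σ = ∑ σ, θ₀ σ - n * (2 * Real.pi) := by
    rw [hθd, Finset.sum_update_of_mem (Finset.mem_univ _),
      ← Finset.add_sum_erase Finset.univ θ₀ (Finset.mem_univ 0), Finset.sdiff_singleton_eq_erase]
    ring
  refine ⟨θ, ⟨?_, fun σ => ?_, ?_⟩, gauge_eq_exp hg hxy (hjump θ hθ')⟩
  · apply Lp.ext
    have h2 : ∀ᵐ s ∂B.vol, imVec (x.fst s) = imVec (y.fst s) := by
      refine ae_of_forall_ae B fun i => ?_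
      filter_upwards [hxy.1 i] with s hs
      rw [hs]
      generalize ((g i s)⁻¹ * deriv (g i) s).im = c
      apply E3_ext <;> simp
    filter_upwards [h2, imPart_ae x.fst, imPart_ae y.fst] with s a1 a2 a3
    rw [a2, a3, a1]
  · rw [hxy.2 σ, hθ']
  · rw [gaugeAngle, leftSum_last] at hn'
    rw [hsum]; linarith

end Gauge

end

section

/-! ### The level set and the horizontal vectors -/

variable {k : ℕ} {B : Bow k} [NeZero k]

/-- The point of `ℝ³` under a point of the level set. -/
def tval (ν : Fin k → E3) (x : Dat B) : E3 := hopf (x.snd 0) + ν 0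

lemma integral_mul_integrable {φ ψ : ℝ → ℝ} (hφ : MemLp φ 2 B.vol) (hψ : MemLp ψ 2 B.vol) :
    IntervalIntegrable (fun s => φ s * ψ s) volume 0 B.l := by
  rw [intervalIntegrable_iff_integrableOn_Icc_of_le B.l_pos.le]
  exact hφ.integrable_mul hψ

lemma sum_integral_deriv_mul {f : Fin (k + 1) → ℝ → ℝ} {φ ψ : ℝ → ℝ} (hφ : MemLp φ 2 B.vol)
    (hψ : MemLp ψ 2 B.vol)
    (hf : ∀ i, ∀ᵐ s ∂(volume : Measure ℝ).restrict (Icc (B.left i) (B.right i)),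
      deriv (f i) s = φ s) :
    ∑ i, ∫ s in (B.left i)..(B.right i), deriv (f i) s * ψ s = ∫ s in (0 : ℝ)..B.l, φ s * ψ s := by
  rw [← sum_integral (integral_mul_integrable hφ hψ)]
  refine Finset.sum_congr rfl fun i _ => intervalIntegral.integral_congr_ae_restrict ?_
  rw [uIoc_of_le (B.left_lt_right i).le]
  filter_upwards [ae_restrict_of_ae_restrict_of_subset Ioc_subset_Icc_self (hf i)] with s hs
  rw [hs]

/-- The pairs of total zero are the orthogonal complement of the constant pair `(1, 1, …, 1)`, whose
squared norm is `l + k`. With `κ` the mean, `(φ - κ, r - κ)` has total zero, and testing against it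
shows that its norm is zero. -/
lemma eq_const_of_orthogonal {φ : ℝ → ℝ} (hφ : MemLp φ 2 B.vol) (r : Fin k → ℝ)
    (H : ∀ ψ : ℝ → ℝ, MemLp ψ 2 B.vol → ∀ d : Fin k → ℝ,
      (∫ s in (0 : ℝ)..B.l, ψ s) + ∑ σ, d σ = 0 →
      (∫ s in (0 : ℝ)..B.l, ψ s * φ s) + ∑ σ, d σ * r σ = 0) :
    (∀ᵐ s ∂B.vol, φ s = r 0) ∧ ∀ σ, r σ = r 0 := by
  set κ : ℝ := ((∫ s in (0 : ℝ)..B.l, φ s) + ∑ σ, r σ) / (B.l + k) with hκ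
  have hl := B.l_pos
  have hk : (0 : ℝ) < B.l + k := by positivity
  have hi := intervalIntegrable_of_memLp hφ Bow.zero_mem Bow.l_mem
  have hc : MemLp (fun _ : ℝ => κ) 2 B.vol := memLp_const κ
  have hψ : MemLp (fun s => φ s - κ) 2 B.vol := hφ.sub hc
  have h0 : (∫ s in (0 : ℝ)..B.l, (φ s - κ)) + ∑ σ, (r σ - κ) = 0 := by
    rw [intervalIntegral.integral_sub hi (by simp), Finset.sum_sub_distrib]
    simp only [intervalIntegral.integral_const, Finset.sum_const, Finset.card_univ,
      Fintype.card_fin, smul_eq_mul, nsmul_eq_mul, sub_zero]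
    have : κ * (B.l + k) = (∫ s in (0 : ℝ)..B.l, φ s) + ∑ σ, r σ := div_mul_cancel₀ _ hk.ne'
    linarith
  have h1 := H _ hψ _ h0
  have h2 : (∫ s in (0 : ℝ)..B.l, (φ s - κ) * (φ s - κ)) + ∑ σ, (r σ - κ) * (r σ - κ) = 0 := by
    have e1 : ∫ s in (0 : ℝ)..B.l, (φ s - κ) * (φ s - κ) =
        (∫ s in (0 : ℝ)..B.l, (φ s - κ) * φ s) - κ * ∫ s in (0 : ℝ)..B.l, (φ s - κ) := by
      rw [← intervalIntegral.integral_const_mul, ← intervalIntegral.integral_sub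
        (integral_mul_integrable hψ hφ)
        ((intervalIntegrable_of_memLp hψ Bow.zero_mem Bow.l_mem).const_mul κ)]
      congr 1; funext s; ring
    have e2 : ∑ σ, (r σ - κ) * (r σ - κ) = ∑ σ, (r σ - κ) * r σ - κ * ∑ σ, (r σ - κ) := by
      rw [Finset.mul_sum, ← Finset.sum_sub_distrib]
      exact Finset.sum_congr rfl fun _ _ => by ring
    rw [e1, e2]
    linear_combination h1 - κ * h0
  have h3 : 0 ≤ ∫ s in (0 : ℝ)..B.l, (φ s - κ) * (φ s - κ) :=
    intervalIntegral.integral_nonneg hl.le fun _ _ => mul_self_nonneg _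
  have h4 : 0 ≤ ∑ σ, (r σ - κ) * (r σ - κ) := Finset.sum_nonneg fun _ _ => mul_self_nonneg _
  have h5 : ∑ σ, (r σ - κ) * (r σ - κ) = 0 := by linarith
  have h6 : ∫ s in (0 : ℝ)..B.l, (φ s - κ) * (φ s - κ) = 0 := by linarith
  have h7 : ∀ σ, r σ = κ := fun σ => by
    have := (Finset.sum_eq_zero_iff_of_nonneg fun _ _ => mul_self_nonneg _).1 h5 σ
      (Finset.mem_univ _)
    linarith [mul_self_eq_zero.1 this]
  refine ⟨?_, fun σ => by rw [h7, h7]⟩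
  rw [intervalIntegral.integral_of_le hl.le, ← integral_Icc_eq_integral_Ioc,
    integral_eq_zero_iff_of_nonneg (fun _ => mul_self_nonneg _)
      (hψ.integrable_mul hψ)] at h6
  filter_upwards [h6] with s hs
  rw [h7]
  linarith [mul_self_eq_zero.1 hs]

lemma imVec_ae_of_imPart {x : Lp ℍ[ℝ] 2 B.vol} {t : E3} (h : imPart B x = constL B (imQuat t)) :
    ∀ᵐ s ∂B.vol, imVec (x s) = t := by
  have h1 := imPart_ae x
  rw [h] at h1
  filter_upwards [h1, constL_ae (B := B) (imQuat t)] with s a1 a2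
  rw [a2] at a1
  rw [← imVec_imQuat t, a1, imVec_imQuat]

lemma imPart_of_imVec_ae {x : Lp ℍ[ℝ] 2 B.vol} {t : E3} (h : ∀ᵐ s ∂B.vol, imVec (x s) = t) :
    imPart B x = constL B (imQuat t) := by
  apply Lp.ext
  filter_upwards [imPart_ae x, constL_ae (B := B) (imQuat t), h] with s a1 a2 a3
  rw [a1, a2, a3]

/-- The moment map equations: the `t_j` are constant, and equal to `r_j(b_σ) + ν_{σ,j}`. -/
theorem mem_levelSet_iff {ν : Fin k → E3} {x : Dat B} : x ∈ levelSet B ν ↔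
    imPart B x.fst = constL B (imQuat (tval ν x)) ∧ ∀ σ, hopf (x.snd σ) = tval ν x - ν σ := by
  constructor
  · intro hx
    have key : ∀ j, (∀ᵐ s ∂B.vol, imVec (x.fst s) j = hopf (x.snd 0) j + ν 0 j) ∧
        ∀ σ, hopf (x.snd σ) j + ν σ j = hopf (x.snd 0) j + ν 0 j := by
      intro j
      -- The level is absorbed into the numbers attached to the cuts; every derivative and set of
      -- jumps of total zero is realized by an `H¹` function on the bow, so the equations are
      -- exactly the orthogonality.
      refine eq_const_of_orthogonal (memLp_imVec x.fst j) (fun σ => hopf (x.snd σ) j + ν σ j) ?_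
      intro ψ hψ d h0
      obtain ⟨f, hf, -, hfd, hfj, -⟩ := exists_bowH1 hψ h0
      have h1 := hx f hf j
      rw [momentMap, sum_integral_deriv_mul hψ (memLp_imVec x.fst j) hfd] at h1
      have h2 : ∑ σ, ν σ j * (valMinus B f σ - valPlus B f σ) = -∑ σ, d σ * ν σ j := by
        rw [← Finset.sum_neg_distrib]
        exact Finset.sum_congr rfl fun σ _ => by rw [← hfj]; ring
      simp only [hfj] at h1
      rw [h2] at h1
      simp only [mul_add, Finset.sum_add_distrib]
      linarith
    refine ⟨imPart_of_imVec_ae ?_, fun σ => ?_⟩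
    · filter_upwards [(key 0).1, (key 1).1, (key 2).1] with s h0 h1 h2
      exact E3_ext h0 h1 h2
    · rw [eq_sub_iff_add_eq]
      exact E3_ext ((key 0).2 σ) ((key 1).2 σ) ((key 2).2 σ)
  · rintro ⟨h1, h2⟩ f hf j
    have h3 := imVec_ae_of_imPart h1
    have h4 : ∀ i, ∫ s in (B.left i)..(B.right i), deriv (f i) s * imVec (x.fst s) j =
        (∫ s in (B.left i)..(B.right i), deriv (f i) s) * tval ν x j := by
      intro i
      rw [← intervalIntegral.integral_mul_const]
      refine intervalIntegral.integral_congr_ae_restrict ?_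
      rw [uIoc_of_le (B.left_lt_right i).le]
      filter_upwards [ae_restrict_of_ae_restrict_of_subset Ioc_subset_Icc_self
        (ae_piece B h3 i)] with s hs
      rw [hs]
    have h5 := bowH1_sum_deriv hf
    rw [momentMap]
    simp only [h4, h2, ← Finset.sum_mul, PiLp.sub_apply, mul_sub, Finset.sum_sub_distrib]
    have h7 : ∀ σ, (valPlus B f σ - valMinus B f σ) * ν σ j =
        ν σ j * valPlus B f σ - ν σ j * valMinus B f σ := fun σ => by ring
    simp only [h7, Finset.sum_sub_distrib]
    simp only [Finset.sum_sub_distrib] at h5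
    linear_combination tval ν x j * h5

/-- The vectors tangent to the orbits of the based gauge group. -/
structure IsVert (p X : Dat B) (d : Fin k → ℝ) : Prop where
  im : imPart B X.fst = 0
  snd : ∀ σ, X.snd σ = d σ • (p.snd σ * unitQuat 0)
  sum : primL B B.l X + ∑ σ, d σ = 0

lemma IsVert.ae_real {p X : Dat B} {d : Fin k → ℝ} (h : IsVert p X d) :
    ∀ᵐ s ∂B.vol, X.fst s = (((X.fst s).re : ℝ) : ℍ[ℝ]) := by
  have h1 : imPart B X.fst = constL B (imQuat 0) := by rw [h.im, map_zero, map_zero]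
  filter_upwards [imVec_ae_of_imPart h1] with s hs
  have a0 := congrArg (fun u : E3 => u 0) hs
  have a1 := congrArg (fun u : E3 => u 1) hs
  have a2 := congrArg (fun u : E3 => u 2) hs
  simp only [imVec_zero', imVec_one', imVec_two', PiLp.zero_apply] at a0 a1 a2
  apply Quaternion.ext <;> simp [a0, a1, a2]

/-- Only the derivative and the jumps of a generator `f` act, so vertical vectors can be described
without `f`. The condition `f 0 0 = 0` costs nothing, since constants act trivially. -/
lemma mem_horizontal_iff {p h : Dat B} :
    h ∈ Horizontal B p ↔ ∀ X d, IsVert p X d → ⟪X, h⟫_ℝ = 0 := by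
  constructor
  · intro hh X d hX
    obtain ⟨f, hf, hf0, hfd, hfj, -⟩ := exists_bowH1 (memLp_re X.fst) (d := d) (by
      rw [← primL_eq Bow.l_mem]; exact hX.sum)
    refine hh f X hf hf0 ⟨fun i => ?_, fun σ => ?_⟩
    · filter_upwards [hfd i, ae_piece B hX.ae_real i] with s h1 h2
      rw [h1, ← h2]
    · rw [hX.snd, hfj, rsmul_I_real]
  · intro H f X hf _ hX
    refine H X (fun σ => valPlus B f σ - valMinus B f σ) ⟨?_, fun σ => ?_, ?_⟩
    · have : imPart B X.fst = constL B (imQuat 0) := by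
        refine imPart_of_imVec_ae (ae_of_forall_ae B fun i => ?_)
        filter_upwards [hX.1 i] with s hs
        rw [hs]
        apply E3_ext <;> simp
      rw [this, map_zero, map_zero]
    · rw [hX.2 σ, rsmul_I_real]
    · refine Eq.trans ?_ (bowH1_sum_deriv hf)
      rw [primL_eq Bow.l_mem, ← sum_integral
        (intervalIntegrable_of_memLp (memLp_re X.fst) Bow.zero_mem Bow.l_mem)]
      congr 1
      refine Finset.sum_congr rfl fun i _ => intervalIntegral.integral_congr_ae_restrict ?_
      rw [uIoc_of_le (B.left_lt_right i).le]
      filter_upwards [ae_restrict_of_ae_restrict_of_subset Ioc_subset_Icc_self (hX.1 i)] with s hs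
      rw [hs]; simp

/-! ### The moment map -/

lemma leftMul_fst (q : ℍ[ℝ]) (X : Dat B) :
    (leftMul B q X).fst = (ContinuousLinearMap.mul ℝ ℍ[ℝ] q).compLp X.fst := rfl

lemma leftMul_fst_ae (q : ℍ[ℝ]) (X : Dat B) :
    ∀ᵐ s ∂B.vol, (leftMul B q X).fst s = q * X.fst s :=
  (ContinuousLinearMap.mul ℝ ℍ[ℝ] q).coeFn_compLp X.fst

@[simp] lemma leftMul_snd (q : ℍ[ℝ]) (X : Dat B) (σ : Fin k) :
    (leftMul B q X).snd σ = q * X.snd σ := rfl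

lemma inner_unitQuat_real (j : Fin 3) (c : ℝ) (a : ℍ[ℝ]) :
    ⟪unitQuat j * (c : ℍ[ℝ]), a⟫_ℝ = c * imVec a j := by
  fin_cases j <;> simp [quat_inner_eq]

/-- The moment map is linear in `T` and quadratic in the `b_σ`. The `T`-part of `X` is real, so
pairing with `e_j X` extracts `t_j`; for the `b_σ` the claim is `inner_unitQuat_mul`. -/
theorem hasFDerivAt_momentMap {f : Fin (k + 1) → ℝ → ℝ} {x X : Dat B}
    (hX : IsGenerated B f x X) (j : Fin 3) :
    HasFDerivAt (momentMap B f j) (innerSL ℝ (leftMul B (unitQuat j) X)) x := by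
  have h1 : momentMap B f j = fun y => ⟪(leftMul B (unitQuat j) X).fst, fstL B y⟫_ℝ +
      ∑ σ, (valPlus B f σ - valMinus B f σ) *
        EuclideanSpace.proj (𝕜 := ℝ) j (hopf (sndL B σ y)) := by
    funext y
    rw [momentMap]
    congr 1
    have hre : ∀ i, ∀ᵐ s ∂(volume : Measure ℝ).restrict (Icc (B.left i) (B.right i)),
        deriv (f i) s = (X.fst s).re := by
      intro i
      filter_upwards [hX.1 i] with s hs
      rw [hs, Quaternion.re_coe]
    have hreal : ∀ᵐ s ∂B.vol, X.fst s = (((X.fst s).re : ℝ) : ℍ[ℝ]) := by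
      refine ae_of_forall_ae B fun i => ?_
      filter_upwards [hX.1 i] with s hs
      rw [hs, Quaternion.re_coe]
    rw [sum_integral_deriv_mul (memLp_re X.fst) (memLp_imVec y.fst j) hre, L2.inner_def,
      intervalIntegral.integral_of_le B.l_pos.le, ← integral_Icc_eq_integral_Ioc]
    refine integral_congr_ae ?_
    filter_upwards [hreal, leftMul_fst_ae (unitQuat j) X] with s h2 h3
    rw [h3, h2, inner_unitQuat_real, Quaternion.re_coe]
    rfl
  rw [h1]
  have h2 : HasFDerivAt (fun y => ⟪(leftMul B (unitQuat j) X).fst, fstL B y⟫_ℝ)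
      ((innerSL ℝ (leftMul B (unitQuat j) X).fst).comp (fstL B)) x :=
    ((innerSL ℝ (leftMul B (unitQuat j) X).fst).comp (fstL B)).hasFDerivAt
  have h3 : ∀ σ ∈ Finset.univ, HasFDerivAt (fun y => (valPlus B f σ - valMinus B f σ) *
        EuclideanSpace.proj (𝕜 := ℝ) j (hopf (sndL B σ y)))
      ((valPlus B f σ - valMinus B f σ) • ((EuclideanSpace.proj (𝕜 := ℝ) j).comp
        ((dhopf (x.snd σ)).comp (sndL B σ)))) x := fun σ _ =>
    (((EuclideanSpace.proj (𝕜 := ℝ) j).hasFDerivAt.comp x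
      ((hasFDerivAt_hopf (x.snd σ)).comp x (sndL B σ).hasFDerivAt))).const_mul _
  refine (h2.add (HasFDerivAt.fun_sum h3)).congr_fderiv ?_
  ext y
  simp only [_root_.add_apply, ContinuousLinearMap.comp_apply, innerSL_apply_apply,
    _root_.sum_apply, _root_.smul_apply, fstL_apply, sndL_apply]
  rw [dat_inner]
  congr 1
  refine Finset.sum_congr rfl fun σ _ => ?_
  rw [leftMul_snd, hX.2 σ, rsmul_I_real, mul_smul_comm, real_inner_smul_left, inner_unitQuat_mul]
  rfl

end

section

/-! ### Construction of data -/

lemma HasDerivAt.clm {E F : Type*} [NormedAddCommGroup E] [NormedSpace ℝ E]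
    [NormedAddCommGroup F] [NormedSpace ℝ F] {c : ℝ → E} {X : E} {r : ℝ} (h : HasDerivAt c X r)
    (L : E →L[ℝ] F) : HasDerivAt (fun r => L (c r)) (L X) r :=
  L.hasFDerivAt.comp_hasDerivAt r h

lemma HasDerivAt.hopf {c : ℝ → ℍ[ℝ]} {X : ℍ[ℝ]} {r : ℝ} (h : HasDerivAt c X r) :
    HasDerivAt (fun r => hopf (c r)) (dhopf (c r) X) r :=
  HasFDerivAt.comp_hasDerivAt (l := SmallBow.hopf) r (hasFDerivAt_hopf (c r)) h

section MkDat

variable {k : ℕ} {B : Bow k}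

/-- The data with given components, as a linear map. -/
def mkDat : (Lp ℍ[ℝ] 2 B.vol × (Fin k → ℍ[ℝ])) →L[ℝ] Dat B :=
  (WithLp.prodContinuousLinearEquiv 2 ℝ (Lp ℍ[ℝ] 2 B.vol)
    (PiLp 2 (fun _ : Fin k => ℍ[ℝ]))).symm.toContinuousLinearMap.comp
    ((ContinuousLinearMap.id ℝ (Lp ℍ[ℝ] 2 B.vol)).prodMap
      (PiLp.continuousLinearEquiv 2 ℝ (fun _ : Fin k => ℍ[ℝ])).symm.toContinuousLinearMap)

@[simp] lemma mkDat_fst (T : Lp ℍ[ℝ] 2 B.vol) (b : Fin k → ℍ[ℝ]) : (mkDat (T, b)).fst = T := rfl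
@[simp] lemma mkDat_snd (T : Lp ℍ[ℝ] 2 B.vol) (b : Fin k → ℍ[ℝ]) (σ : Fin k) :
    (mkDat (T, b)).snd σ = b σ := rfl

@[simp] lemma sub_fst (x y : Dat B) : (x - y).fst = x.fst - y.fst := rfl
@[simp] lemma sub_snd (x y : Dat B) (σ : Fin k) : (x - y).snd σ = x.snd σ - y.snd σ := rfl

variable {F : Type*} [NormedAddCommGroup F] [NormedSpace ℝ F]

lemma contDiffAt_mkDat {T : F → Lp ℍ[ℝ] 2 B.vol} {b : F → Fin k → ℍ[ℝ]} {x : F}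
    (hT : ContDiffAt ℝ ∞ T x) (hb : ∀ σ, ContDiffAt ℝ ∞ (fun y => b y σ) x) :
    ContDiffAt ℝ ∞ (fun y => mkDat (B := B) (T y, b y)) x :=
  mkDat.contDiff.contDiffAt.comp x (hT.prodMk (contDiffAt_pi.2 hb))

lemma hasDerivAt_mkDat {T : ℝ → Lp ℍ[ℝ] 2 B.vol} {b : ℝ → Fin k → ℍ[ℝ]} {x : ℝ}
    {T' : Lp ℍ[ℝ] 2 B.vol} {b' : Fin k → ℍ[ℝ]}
    (hT : HasDerivAt T T' x) (hb : ∀ σ, HasDerivAt (fun y => b y σ) (b' σ) x) :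
    HasDerivAt (fun y => mkDat (B := B) (T y, b y)) (mkDat (T', b')) x :=
  (mkDat (B := B)).hasFDerivAt.comp_hasDerivAt x (hT.prodMk (hasDerivAt_pi.2 hb))

lemma contDiff_snd (σ : Fin k) : ContDiff ℝ ∞ (fun x : Dat B => x.snd σ) := (sndL B σ).contDiff

end MkDat

/-! ### Phases and holonomies relative to a frame -/

variable {k : ℕ} {B : Bow k} [NeZero k] {ν : Fin k → E3}

lemma contDiff_tval : ContDiff ℝ ∞ (tval (B := B) ν) :=
  (contDiff_hopf.comp (contDiff_snd 0)).add contDiff_const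

lemma hasFDerivAt_tval (x : Dat B) :
    HasFDerivAt (tval ν) ((dhopf (x.snd 0)).comp (sndL B 0)) x :=
  (HasFDerivAt.comp (g := hopf) x (hasFDerivAt_hopf (x.snd 0))
    (sndL B 0).hasFDerivAt).add_const (ν 0)

/-- Smooth local sections of the Hopf maps centred at the `ν_σ`, `σ ∈ s`. -/
structure IsFrame (ν : Fin k → E3) (s : Finset (Fin k)) (U : Set E3) (q : Fin k → E3 → ℍ[ℝ]) :
    Prop where
  isOpen : IsOpen U
  ne : ∀ ρ ∈ s, ∀ t ∈ U, t ≠ ν ρ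
  smooth : ∀ ρ ∈ s, ContDiffOn ℝ ∞ (q ρ) U
  hopf_eq : ∀ ρ ∈ s, ∀ t ∈ U, hopf (q ρ t) = t - ν ρ

/-- The product of the phases relative to a frame and of the holonomy of the connection. -/
def hol (ν : Fin k → E3) (s : Finset (Fin k)) (v : ℝ) (q : Fin k → E3 → ℍ[ℝ]) (x : Dat B) : ℂ :=
  (∏ ρ ∈ s, phase (q ρ (tval ν x)) (x.snd ρ)) * Complex.exp (Complex.I * (primL B v x : ℂ))

section Frame

variable {s : Finset (Fin k)} {U : Set E3} {q : Fin k → E3 → ℍ[ℝ]} {v : ℝ} {x y p X : Dat B}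

lemma IsFrame.q_ne_zero (hq : IsFrame ν s U q) {ρ : Fin k} (hρ : ρ ∈ s) {t : E3} (ht : t ∈ U) :
    q ρ t ≠ 0 := by
  rw [Ne, ← hopf_eq_zero, hq.hopf_eq ρ hρ t ht, sub_eq_zero]
  exact hq.ne ρ hρ t ht

lemma IsFrame.hopf_snd (hq : IsFrame ν s U q) (hx : x ∈ levelSet B ν) (hU : tval ν x ∈ U)
    {ρ : Fin k} (hρ : ρ ∈ s) : hopf (q ρ (tval ν x)) = hopf (x.snd ρ) := by
  rw [hq.hopf_eq ρ hρ _ hU, (mem_levelSet_iff.1 hx).2]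

lemma IsFrame.norm_snd (hq : IsFrame ν s U q) (hx : x ∈ levelSet B ν) (hU : tval ν x ∈ U)
    {ρ : Fin k} (hρ : ρ ∈ s) : ‖q ρ (tval ν x)‖ ^ 2 = ‖x.snd ρ‖ ^ 2 := by
  rw [norm_hopf, norm_hopf, hq.hopf_snd hx hU hρ]

lemma IsFrame.snd_ne_zero (hq : IsFrame ν s U q) (hx : x ∈ levelSet B ν) (hU : tval ν x ∈ U)
    {ρ : Fin k} (hρ : ρ ∈ s) : x.snd ρ ≠ 0 := by
  rw [Ne, ← hopf_eq_zero, ← hq.hopf_snd hx hU hρ, hopf_eq_zero]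
  exact hq.q_ne_zero hρ hU

lemma norm_hol (hq : IsFrame ν s U q) (hx : x ∈ levelSet B ν) (hU : tval ν x ∈ U) :
    ‖hol ν s v q x‖ = 1 := by
  rw [hol, norm_mul, norm_exp_I, norm_prod, Finset.prod_eq_one, one_mul]
  intro ρ hρ
  exact norm_phase (hq.q_ne_zero hρ hU) (hq.hopf_snd hx hU hρ)

lemma contDiffAt_phase_snd (hq : IsFrame ν s U q) (hU : tval ν x ∈ U) {ρ : Fin k} (hρ : ρ ∈ s) :
    ContDiffAt ℝ ∞ (fun x : Dat B => phase (q ρ (tval ν x)) (x.snd ρ)) x :=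
  ContDiffAt.phase (((hq.smooth ρ hρ).contDiffAt (hq.isOpen.mem_nhds hU)).comp x
    contDiff_tval.contDiffAt) (contDiff_snd ρ).contDiffAt (hq.q_ne_zero hρ hU)

lemma contDiffAt_hol (hq : IsFrame ν s U q) (hU : tval ν x ∈ U) :
    ContDiffAt ℝ ∞ (hol (B := B) ν s v q) x := by
  unfold hol
  refine ContDiffAt.mul ?_ ?_
  · exact contDiffAt_prod fun ρ hρ => contDiffAt_phase_snd hq hU hρ
  · exact (contDiffAt_const.mul
      ((Complex.ofRealCLM.contDiff.contDiffAt.comp x (primL B v).contDiff.contDiffAt))).cexp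

lemma GaugeRel.tval_eq {θ : Fin k → ℝ} (h : GaugeRel x y θ) : tval ν y = tval ν x := by
  rw [tval, tval, h.snd, hopf_rsmul_unit _ (norm_exp_I _)]

/-- The phases are multiplied by the jumps and the exponential by the change of `∫₀^v t₀`. Since the
full total vanishes, the resulting angle is zero, or minus one jump, or the angle of `g(v)`,
according to the choice of `s` and `v`. -/
lemma hol_gauge {θ : Fin k → ℝ} (h : GaugeRel x y θ) : hol ν s v q y = hol ν s v q x *
    Complex.exp (Complex.I * ((∑ ρ ∈ s, θ ρ + (primL B v y - primL B v x) : ℝ) : ℂ)) := by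
  rw [hol, hol, h.tval_eq]
  simp only [h.snd, phase_rsmul, Finset.prod_mul_distrib]
  rw [← Complex.exp_sum, ← Finset.mul_sum, mul_assoc, mul_assoc, ← Complex.exp_add,
    ← Complex.exp_add]
  congr 2
  push_cast; ring

/-- `X` is the velocity at `p` of a curve in the level set. -/
def IsVel (ν : Fin k → E3) (p X : Dat B) : Prop :=
  ∃ c : ℝ → Dat B, (∀ r, c r ∈ levelSet B ν) ∧ c 0 = p ∧ ContDiffAt ℝ ∞ c 0 ∧ HasDerivAt c X 0

lemma IsVel.mem (h : IsVel ν p X) : p ∈ levelSet B ν := by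
  obtain ⟨c, hc, rfl, -⟩ := h
  exact hc 0

/-- On the level set the vectors `hopf (b_σ)` differ by constants. -/
lemma IsVel.dhopf_eq (h : IsVel ν p X) (ρ : Fin k) :
    dhopf (p.snd ρ) (X.snd ρ) = dhopf (p.snd 0) (X.snd 0) := by
  obtain ⟨c, hc, rfl, -, hX⟩ := h
  have h1 : ∀ σ, HasDerivAt (fun r => hopf ((c r).snd σ)) (dhopf ((c 0).snd σ) (X.snd σ)) 0 :=
    fun σ => HasDerivAt.hopf (HasDerivAt.clm hX (sndL B σ))
  have h2 : HasDerivAt (fun r => hopf ((c r).snd ρ)) (dhopf ((c 0).snd 0) (X.snd 0)) 0 := by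
    refine ((h1 0).add_const (ν 0 - ν ρ)).congr_of_eventuallyEq (Eventually.of_forall fun r => ?_)
    simp only
    rw [(mem_levelSet_iff.1 (hc r)).2, tval]; abel
  exact (h1 ρ).unique h2

lemma IsVel.imPart_eq (h : IsVel ν p X) :
    imPart B X.fst = constL B (imQuat (dhopf (p.snd 0) (X.snd 0))) := by
  obtain ⟨c, hc, rfl, -, hX⟩ := h
  have h1 : HasDerivAt (fun r => imPart B (c r).fst) (imPart B X.fst) 0 :=
    (imPart B).hasFDerivAt.comp_hasDerivAt 0 ((fstL B).hasFDerivAt.comp_hasDerivAt 0 hX)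
  have h2 : HasDerivAt (fun r => imPart B (c r).fst)
      (constL B (imQuat (dhopf ((c 0).snd 0) (X.snd 0)))) 0 := by
    have h3 : HasDerivAt (fun r => tval ν (c r)) (dhopf ((c 0).snd 0) (X.snd 0)) 0 :=
      (hasFDerivAt_tval (c 0)).comp_hasDerivAt 0 hX
    have h4 := (constL B).hasFDerivAt.comp_hasDerivAt 0 (imQuat.hasFDerivAt.comp_hasDerivAt 0 h3)
    refine h4.congr_of_eventuallyEq (Eventually.of_forall fun r => ?_)
    exact (mem_levelSet_iff.1 (hc r)).1
  exact h1.unique h2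

/-- As `‖z‖ = 1`, the derivative of `z` is `i a z` with `a` real. Differentiating `w z = b` and
pairing with `b i` isolates `a`. -/
lemma hasDerivAt_phase {z : ℝ → ℂ} {w b : ℝ → ℍ[ℝ]} {w' b' : ℍ[ℝ]} (hw : HasDerivAt w w' 0)
    (hb : HasDerivAt b b' 0) (hz : DifferentiableAt ℝ z 0) (h0 : w 0 ≠ 0)
    (he : ∀ᶠ r in 𝓝 0, rsmul (w r) (z r) = b r) (hn : ∀ᶠ r in 𝓝 0, ‖z r‖ = 1) :
    HasDerivAt z (z 0 * (Complex.I * ((⟪b 0 * unitQuat 0, b'⟫_ℝ / ‖b 0‖ ^ 2 -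
      ⟪w 0 * unitQuat 0, w'⟫_ℝ / ‖w 0‖ ^ 2 : ℝ) : ℂ))) 0 := by
  have h1 := inv_mul_deriv_eq hz hn
  set a := ((z 0)⁻¹ * deriv z 0).im with ha
  have h2 : HasDerivAt b (rsmul (w 0) (z 0 * (Complex.I * (a : ℂ))) + rsmul w' (z 0)) 0 := by
    have h3 := HasDerivAt.clm (F := ℂ →L[ℝ] ℍ[ℝ]) hw rsmulL
    have h4 := h3.clm_apply hz.hasDerivAt
    rw [h1] at h4
    refine (h4.congr_of_eventuallyEq ?_).congr_deriv ?_
    · filter_upwards [he] with r hr using hr.symm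
    · simp only [rsmulL_apply]; rw [add_comm]
  have h3 := hb.unique h2
  have hb0 : b 0 = rsmul (w 0) (z 0) := he.self_of_nhds.symm
  have hn0 : ‖z 0‖ = 1 := hn.self_of_nhds
  have h4 : ⟪b 0 * unitQuat 0, b'⟫_ℝ = ‖w 0‖ ^ 2 * a + ⟪w 0 * unitQuat 0, w'⟫_ℝ := by
    rw [h3, hb0, rsmul_mul_unit, mul_comm (z 0), ← rsmul_rsmul, rsmul_I_real, inner_add_right,
      smul_rsmul, real_inner_smul_right, inner_rsmul_rsmul, inner_rsmul_rsmul, hn0,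
      inner_rotation_self]
    ring
  have hw0 : ‖w 0‖ ^ 2 ≠ 0 := by simpa using h0
  have h5 : ‖b 0‖ = ‖w 0‖ := by rw [hb0, norm_rsmul, hn0, mul_one]
  have h6 : ⟪b 0 * unitQuat 0, b'⟫_ℝ / ‖b 0‖ ^ 2 - ⟪w 0 * unitQuat 0, w'⟫_ℝ / ‖w 0‖ ^ 2 = a := by
    rw [h4, h5]; field_simp; ring
  rw [h6, ← h1]
  exact hz.hasDerivAt

lemma hasDerivAt_prod_log {ι : Type*} (s : Finset ι) {z : ι → ℝ → ℂ} {a : ι → ℂ}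
    (h : ∀ ρ ∈ s, HasDerivAt (z ρ) (z ρ 0 * a ρ) 0) :
    HasDerivAt (fun r => ∏ ρ ∈ s, z ρ r) ((∏ ρ ∈ s, z ρ 0) * ∑ ρ ∈ s, a ρ) 0 := by
  classical
  induction s using Finset.induction_on with
  | empty => simpa using hasDerivAt_const (0 : ℝ) (1 : ℂ)
  | insert i s hi ih =>
    have h1 := (h i (Finset.mem_insert_self i s)).mul
      (ih fun ρ hρ => h ρ (Finset.mem_insert_of_mem hρ))
    simp only [Finset.prod_insert hi, Finset.sum_insert hi]
    convert! h1 using 1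
    ring

/-- The logarithmic derivative of the holonomy, divided by the imaginary unit. -/
def holForm (s : Finset (Fin k)) (v : ℝ) (q : Fin k → E3 → ℍ[ℝ]) (t : E3) (p X : Dat B) : ℝ :=
  ∑ ρ ∈ s, (⟪p.snd ρ * unitQuat 0, X.snd ρ⟫_ℝ / ‖p.snd ρ‖ ^ 2 +
    phaseForm (q ρ) t (dhopf (p.snd 0) (X.snd 0))) + primL B v X

lemma hasDerivAt_hol (hq : IsFrame ν s U q) {c : ℝ → Dat B} (hc : ∀ r, c r ∈ levelSet B ν)
    (hU : tval ν (c 0) ∈ U) (hX : HasDerivAt c X 0) :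
    HasDerivAt (fun r => hol ν s v q (c r)) (hol ν s v q (c 0) *
      (Complex.I * (holForm s v q (tval ν (c 0)) (c 0) X : ℂ))) 0 := by
  have ht : HasDerivAt (fun r => tval ν (c r)) (dhopf ((c 0).snd 0) (X.snd 0)) 0 :=
    (hasFDerivAt_tval (c 0)).comp_hasDerivAt 0 hX
  have hev : ∀ᶠ r in 𝓝 (0 : ℝ), tval ν (c r) ∈ U :=
    ht.continuousAt.eventually_mem (hq.isOpen.mem_nhds hU)
  have h1 : ∀ ρ ∈ s, HasDerivAt (fun r => phase (q ρ (tval ν (c r))) ((c r).snd ρ))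
      (phase (q ρ (tval ν (c 0))) ((c 0).snd ρ) * (Complex.I *
        ((⟪(c 0).snd ρ * unitQuat 0, X.snd ρ⟫_ℝ / ‖(c 0).snd ρ‖ ^ 2 +
          phaseForm (q ρ) (tval ν (c 0)) (dhopf ((c 0).snd 0) (X.snd 0)) : ℝ) : ℂ))) 0 := by
    intro ρ hρ
    have hqd : HasFDerivAt (q ρ) (fderiv ℝ (q ρ) (tval ν (c 0))) (tval ν (c 0)) :=
      (((hq.smooth ρ hρ).contDiffAt (hq.isOpen.mem_nhds hU)).differentiableAt
        (by simp)).hasFDerivAt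
    have hz : DifferentiableAt ℝ (fun r => phase (q ρ (tval ν (c r))) ((c r).snd ρ)) 0 :=
      ((contDiffAt_phase_snd hq hU hρ).differentiableAt (by simp)).comp 0 hX.differentiableAt
    have h2 := hasDerivAt_phase (hqd.comp_hasDerivAt 0 ht)
      ((sndL B ρ).hasFDerivAt.comp_hasDerivAt 0 hX) hz (hq.q_ne_zero hρ hU)
      (by
        filter_upwards [hev] with r hr
        exact rsmul_phase (hq.q_ne_zero hρ hr) (hq.hopf_snd (hc r) hr hρ))
      (by
        filter_upwards [hev] with r hr
        exact norm_phase (hq.q_ne_zero hρ hr) (hq.hopf_snd (hc r) hr hρ))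
    rw [phaseForm_apply, ← sub_eq_add_neg]
    exact h2
  have h3 : HasDerivAt (fun r => Complex.exp (Complex.I * (primL B v (c r) : ℂ)))
      (Complex.exp (Complex.I * (primL B v (c 0) : ℂ)) * (Complex.I * (primL B v X : ℂ))) 0 :=
    ((((primL B v).hasFDerivAt.comp_hasDerivAt 0 hX).ofReal_comp).const_mul Complex.I).cexp
  have h4 := (hasDerivAt_prod_log s h1).mul h3
  unfold hol
  convert! h4 using 1
  rw [holForm]
  push_cast
  rw [← Finset.mul_sum]
  ring

end Frame

end

section

/-! ### Tangent vectors of the level set -/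

section Tangent

variable {k : ℕ} {B : Bow k} [NeZero k] {ν : Fin k → E3}

/-- Translation of the real part of the `L²` component, and rotation of the bifundamental data. -/
def shift (h : Lp ℍ[ℝ] 2 B.vol) (d : Fin k → ℝ) (x : Dat B) : Dat B :=
  mkDat (x.fst + h, fun σ => rsmul (x.snd σ) (Complex.exp (Complex.I * (d σ : ℂ))))

variable {h : Lp ℍ[ℝ] 2 B.vol} {d : Fin k → ℝ} {x y p X Y H H' V : Dat B}

@[simp] lemma shift_fst : (shift h d x).fst = x.fst + h := rfl
@[simp] lemma shift_snd (σ : Fin k) :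
    (shift h d x).snd σ = rsmul (x.snd σ) (Complex.exp (Complex.I * (d σ : ℂ))) := rfl

lemma tval_shift : tval ν (shift h d x) = tval ν x := by
  rw [tval, tval, shift_snd, hopf_rsmul_unit _ (norm_exp_I _)]

lemma shift_mem (hh : imPart B h = 0) (hx : x ∈ levelSet B ν) : shift h d x ∈ levelSet B ν := by
  rw [mem_levelSet_iff] at hx ⊢
  rw [tval_shift, shift_fst, map_add, hh, add_zero]
  refine ⟨hx.1, fun σ => ?_⟩
  rw [shift_snd, hopf_rsmul_unit _ (norm_exp_I _), hx.2]

lemma primL_shift (v : ℝ) : primL B v (shift h d x) = primL B v x + primL B v (mkDat (h, 0)) := by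
  rw [← map_add]; rfl

lemma primL_congr {v : ℝ} (hxy : x.fst = y.fst) : primL B v x = primL B v y := by
  change (innerSL ℝ _) x.fst = (innerSL ℝ _) y.fst
  rw [hxy]

lemma gaugeRel_shift (hh : imPart B h = 0) (hs : ∑ σ, d σ + primL B B.l (mkDat (h, 0)) = 0) :
    GaugeRel x (shift h d x) d where
  im := by rw [shift_fst, map_add, hh, add_zero]
  snd σ := rfl
  sum := by rw [primL_shift]; linarith

/-- A shift makes sense at every point, so the gauge transformation carrying `x` to `y` can be
applied to a whole slice through `x`; local sections through a prescribed point are made in this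
way. -/
lemma GaugeRel.eq_shift {θ : Fin k → ℝ} (hxy : GaugeRel x y θ) :
    y = shift (y.fst - x.fst) θ x ∧ imPart B (y.fst - x.fst) = 0 ∧
      ∑ σ, θ σ + primL B B.l (mkDat (y.fst - x.fst, 0)) = 0 := by
  refine ⟨Dat.ext_iff'.2 ⟨by simp, fun σ => ?_⟩, ?_, ?_⟩
  · rw [shift_snd, hxy.snd]
  · rw [map_sub, hxy.im, sub_self]
  · rw [primL_congr (y := y - x) (x := mkDat (y.fst - x.fst, 0)) rfl, map_sub, hxy.sum]

lemma GaugeRel.symm {θ : Fin k → ℝ} (h : GaugeRel x y θ) : GaugeRel y x (-θ) where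
  im := h.im.symm
  snd σ := by
    rw [h.snd, rsmul_rsmul, ← Complex.exp_add]
    simp
  sum := by
    have := h.sum
    simp only [Pi.neg_apply, Finset.sum_neg_distrib]; linarith

lemma GaugeRel.trans {z : Dat B} {θ θ' : Fin k → ℝ} (h : GaugeRel x y θ) (h' : GaugeRel y z θ') :
    GaugeRel x z (θ + θ') where
  im := h.im.trans h'.im
  snd σ := by
    rw [h'.snd, h.snd, rsmul_rsmul, ← Complex.exp_add]
    congr 2
    simp only [Pi.add_apply]; push_cast; ring
  sum := by
    have h1 := h.sum
    have h2 := h'.sum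
    simp only [Pi.add_apply, Finset.sum_add_distrib]; linarith

lemma GaugeRel.refl : GaugeRel x x 0 where
  im := rfl
  snd σ := by simp
  sum := by simp

/-- The linearized moment map equations. -/
structure IsTan (p X : Dat B) (κ : E3) : Prop where
  im : imPart B X.fst = constL B (imQuat κ)
  snd : ∀ σ, dhopf (p.snd σ) (X.snd σ) = κ

lemma IsVel.isTan (h : IsVel ν p X) : IsTan p X (dhopf (p.snd 0) (X.snd 0)) :=
  ⟨h.imPart_eq, h.dhopf_eq⟩

/-- The vectors tangent to the orthogonal complements of the gauge orbits in the level set. -/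
structure QHor (p : Dat B) (κ : ℍ[ℝ]) (H : Dat B) : Prop where
  fst : H.fst = constL B κ
  snd : ∀ σ, H.snd σ * unitQuat 0 * star (p.snd σ) = -κ

lemma QHor.inner_snd {κ : ℍ[ℝ]} (h : QHor p κ H) (σ : Fin k) :
    ⟪p.snd σ * unitQuat 0, H.snd σ⟫_ℝ = κ.re := by
  have h1 := h.snd σ
  rw [mul_unit_star, neg_inj] at h1
  have h2 := congrArg (fun a : ℍ[ℝ] => a.re) h1
  simpa using h2

lemma QHor.dhopf_snd {κ : ℍ[ℝ]} (h : QHor p κ H) (σ : Fin k) :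
    dhopf (p.snd σ) (H.snd σ) = imVec κ := by
  have h1 := h.snd σ
  rw [mul_unit_star, neg_inj] at h1
  rw [← h1]
  apply E3_ext <;> simp

lemma qHor_iff {κ : ℍ[ℝ]} : QHor p κ H ↔ H.fst = constL B κ ∧ ∀ σ,
    ⟪p.snd σ * unitQuat 0, H.snd σ⟫_ℝ = κ.re ∧ dhopf (p.snd σ) (H.snd σ) = imVec κ := by
  refine ⟨fun h => ⟨h.fst, fun σ => ⟨h.inner_snd σ, h.dhopf_snd σ⟩⟩, fun h => ⟨h.1, fun σ => ?_⟩⟩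
  rw [mul_unit_star, (h.2 σ).1, (h.2 σ).2]
  congr 1
  ext <;> simp

/-- In the defining equations `b_σ` multiplies from the right, so left multiplication of `H` by `q`
just multiplies `κ` by `q`. This is where the quaternionic structure of the quotient comes from. -/
lemma QHor.leftMul {κ : ℍ[ℝ]} (h : QHor p κ H) (q : ℍ[ℝ]) : QHor p (q * κ) (leftMul B q H) where
  fst := by
    rw [leftMul_fst, h.fst]
    apply Lp.ext
    filter_upwards [(ContinuousLinearMap.mul ℝ ℍ[ℝ] q).coeFn_compLp (constL B κ),
      constL_ae (B := B) κ, constL_ae (B := B) (q * κ)] with s h1 h2 h3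
    rw [h1, h2, h3]; rfl
  snd σ := by
    rw [leftMul_snd, mul_assoc q, mul_assoc q, h.snd, mul_neg]

lemma inner_constL (T : Lp ℍ[ℝ] 2 B.vol) (hT : imPart B T = 0) (κ : ℍ[ℝ]) :
    ⟪T, constL B κ⟫_ℝ = primL B B.l (mkDat (T, 0)) * κ.re := by
  have h1 : imPart B T = constL B (imQuat 0) := by rw [hT, map_zero, map_zero]
  rw [primL_eq Bow.l_mem, mkDat_fst, L2.inner_def, intervalIntegral.integral_of_le B.l_pos.le,
    ← integral_Icc_eq_integral_Ioc, ← integral_mul_const]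
  refine integral_congr_ae ?_
  filter_upwards [imVec_ae_of_imPart h1, constL_ae (B := B) κ] with s hs h2
  have a0 := congrArg (fun u : E3 => u 0) hs
  have a1 := congrArg (fun u : E3 => u 1) hs
  have a2 := congrArg (fun u : E3 => u 2) hs
  simp only [imVec_zero', imVec_one', imVec_two', PiLp.zero_apply] at a0 a1 a2
  rw [h2, quat_inner_eq, a0, a1, a2]
  ring

/-- Every component of `H` pairs with its vertical direction to the same number `Re κ`, so the
result is `Re κ` times the total of the vertical vector, which is zero. -/
lemma QHor.inner_vert {κ : ℍ[ℝ]} (h : QHor p κ H) (hV : IsVert p V d) : ⟪V, H⟫_ℝ = 0 := by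
  rw [dat_inner, h.fst, inner_constL _ hV.im,
    primL_congr (y := V) (x := mkDat (V.fst, 0)) rfl]
  simp only [hV.snd, real_inner_smul_left, h.inner_snd]
  rw [← Finset.sum_mul, ← add_mul, hV.sum, zero_mul]

lemma constL_inner (κ κ' : ℍ[ℝ]) : ⟪constL B κ, constL B κ'⟫_ℝ = B.l * ⟪κ, κ'⟫_ℝ := by
  rw [L2.inner_def]
  have h : ∀ᵐ s ∂B.vol, ⟪constL B κ s, constL B κ' s⟫_ℝ = ⟪κ, κ'⟫_ℝ := by
    filter_upwards [constL_ae (B := B) κ, constL_ae (B := B) κ'] with s h1 h2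
    rw [h1, h2]
  rw [integral_congr_ae h, setIntegral_const]
  simp [Measure.real, B.l_pos.le]

/-- The symplectic orthogonality of vertical and tangent vectors. -/
lemma IsVert.inner_leftMul {κ : E3} (hV : IsVert p V d) (hY : IsTan p Y κ) (j : Fin 3) :
    ⟪leftMul B (unitQuat j) V, Y⟫_ℝ = 0 := by
  have h1 : ⟪(leftMul B (unitQuat j) V).fst, Y.fst⟫_ℝ = primL B B.l V * κ j := by
    rw [primL_eq Bow.l_mem, L2.inner_def, intervalIntegral.integral_of_le B.l_pos.le,
      ← integral_Icc_eq_integral_Ioc, ← integral_mul_const]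
    refine integral_congr_ae ?_
    filter_upwards [hV.ae_real, imVec_ae_of_imPart hY.im, leftMul_fst_ae (unitQuat j) V]
      with s h2 h3 h4
    rw [h4, h2, inner_unitQuat_real, h3, Quaternion.re_coe]
  rw [dat_inner, h1]
  simp only [leftMul_snd, hV.snd, mul_smul_comm, real_inner_smul_left, inner_unitQuat_mul, hY.snd]
  rw [← Finset.sum_mul, ← add_mul, hV.sum, zero_mul]

/-- `H` is the horizontal part of `X`. -/
def IsHorPart (p X H : Dat B) : Prop := (∃ κ, QHor p κ H) ∧ ∃ d, IsVert p (X - H) d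

lemma IsHorPart.eq_of_horizontal (h : IsHorPart p X H) (hX : X ∈ Horizontal B p) : H = X := by
  obtain ⟨⟨κ, h1⟩, d, h2⟩ := h
  have h3 := mem_horizontal_iff.1 hX _ _ h2
  have h4 := h1.inner_vert h2
  have h5 : ⟪X - H, X - H⟫_ℝ = 0 := by rw [inner_sub_right, h3, h4, sub_zero]
  rw [inner_self_eq_zero, sub_eq_zero] at h5
  exact h5.symm

lemma QHor.mem_horizontal {κ : ℍ[ℝ]} (h : QHor p κ H) : H ∈ Horizontal B p :=
  mem_horizontal_iff.2 fun _ _ hX => h.inner_vert hX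

lemma leftMul_add (q : ℍ[ℝ]) (x y : Dat B) : leftMul B q (x + y) = leftMul B q x + leftMul B q y :=
  Dat.ext_iff'.2 ⟨map_add ((ContinuousLinearMap.mul ℝ ℍ[ℝ] q).compLpL 2 B.vol) _ _,
    fun σ => by simp [mul_add]⟩

lemma leftMul_one (x : Dat B) : leftMul B 1 x = x := by
  refine Dat.ext_iff'.2 ⟨Lp.ext ?_, fun σ => by simp⟩
  filter_upwards [leftMul_fst_ae 1 x] with s hs
  rw [hs, one_mul]

/-- The symplectic forms only depend on the horizontal parts. -/
lemma IsHorPart.inner_leftMul {κ : E3} (hX : IsHorPart p X H) (hY : IsHorPart p Y H')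
    (hY' : IsTan p Y κ) (j : Fin 3) : ⟪leftMul B (unitQuat j) X, Y⟫_ℝ =
      ⟪leftMul B (unitQuat j) H, H'⟫_ℝ := by
  obtain ⟨⟨κ, h1⟩, d, h2⟩ := hX
  obtain ⟨-, d', h2'⟩ := hY
  rw [← sub_add_cancel X H, leftMul_add, inner_add_left, h2.inner_leftMul hY', zero_add,
    ← sub_add_cancel Y H', inner_add_right, real_inner_comm, (h1.leftMul _).inner_vert h2', zero_add]

/-- The metric only depends on the horizontal parts, if one of the vectors is horizontal. -/
lemma IsHorPart.inner_eq (hX : IsHorPart p X H) (hY : IsHorPart p Y H')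
    (hX' : X ∈ Horizontal B p) : ⟪X, Y⟫_ℝ = ⟪leftMul B 1 H, H'⟫_ℝ := by
  have h := hX.eq_of_horizontal hX'
  obtain ⟨⟨κ, h1⟩, -⟩ := hX
  obtain ⟨-, d', h2'⟩ := hY
  rw [leftMul_one, ← h, ← sub_add_cancel Y H', inner_add_right, real_inner_comm, h1.inner_vert h2',
    zero_add]

/-- The potential, without the contribution of the points outside of `s`. -/
def partialPotential (B : Bow k) (s : Finset (Fin k)) (p : Dat B) : ℝ :=
  B.l + ∑ ρ ∈ s, 1 / ‖p.snd ρ‖ ^ 2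

lemma partialPotential_pos (s : Finset (Fin k)) (p : Dat B) : 0 < partialPotential B s p :=
  add_pos_of_pos_of_nonneg B.l_pos (Finset.sum_nonneg fun _ _ => by positivity)

/-- The derivative of the total holonomy, without the contribution of the points outside `s`. -/
def partialHol (B : Bow k) (s : Finset (Fin k)) (p X : Dat B) : ℝ :=
  ∑ ρ ∈ s, ⟪p.snd ρ * unitQuat 0, X.snd ρ⟫_ℝ / ‖p.snd ρ‖ ^ 2 + primL B B.l X

/-- Multiplication of the defining equation by `b_σ i` on the right. Where `b_σ = 0` the equation
says instead that `κ = 0`, and `H_σ` is free. -/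
lemma QHor.snd_eq {κ : ℍ[ℝ]} (h : QHor p κ H) {σ : Fin k} (hσ : p.snd σ ≠ 0) :
    H.snd σ = (1 / ‖p.snd σ‖ ^ 2) • (κ * p.snd σ * unitQuat 0) := by
  have h1 : H.snd σ * unitQuat 0 * (star (p.snd σ) * p.snd σ) * unitQuat 0 =
      -(κ * p.snd σ * unitQuat 0) := by
    rw [← mul_assoc, h.snd, neg_mul, neg_mul]
  have h2 : star (p.snd σ) * p.snd σ = ((‖p.snd σ‖ ^ 2 : ℝ) : ℍ[ℝ]) := by
    rw [Quaternion.star_mul_self, Quaternion.normSq_eq_norm_mul_self, sq]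
  have h3 : unitQuat 0 * unitQuat 0 = -1 := by ext <;> simp
  rw [h2, Quaternion.mul_coe_eq_smul, smul_mul_assoc, mul_assoc, h3, mul_neg, mul_one, smul_neg,
    neg_inj] at h1
  have hp : ‖p.snd σ‖ ^ 2 ≠ 0 := by simpa using hσ
  rw [← h1, smul_smul, one_div_mul_cancel hp, one_smul]

lemma inner_mul_mul_right (a b c : ℍ[ℝ]) : ⟪a * c, b * c⟫_ℝ = ‖c‖ ^ 2 * ⟪a, b⟫_ℝ := by
  rw [quat_norm_sq, quat_inner_eq, quat_inner_eq]
  simp; ring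

lemma norm_unitQuat_zero : ‖unitQuat 0‖ ^ 2 = 1 := by
  rw [quat_norm_sq]; simp

/-- The component at `ρ ∈ s` is `|b_ρ|⁻² κ b_ρ i` and contributes `⟪qκ, κ'⟫ / |b_ρ|²`, and the
constant `T`-part contributes `l ⟪qκ, κ'⟫`: together they give the potential. The components outside
`s` are kept as they are, since there `b_ρ` may vanish. -/
lemma QHor.inner_leftMul {κ κ' : ℍ[ℝ]} (h : QHor p κ H) (h' : QHor p κ' H') (q : ℍ[ℝ])
    {s : Finset (Fin k)} (hs : ∀ ρ ∈ s, p.snd ρ ≠ 0) : ⟪SmallBow.leftMul B q H, H'⟫_ℝ =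
      partialPotential B s p * ⟪q * κ, κ'⟫_ℝ + ∑ ρ ∈ sᶜ, ⟪q * H.snd ρ, H'.snd ρ⟫_ℝ := by
  rw [dat_inner, (h.leftMul q).fst, h'.fst, constL_inner, ← Finset.sum_add_sum_compl s,
    partialPotential, add_mul, Finset.sum_mul, add_assoc]
  congr 2
  refine Finset.sum_congr rfl fun ρ hρ => ?_
  have hp : ‖p.snd ρ‖ ^ 2 ≠ 0 := by simpa using hs ρ hρ
  rw [(h.leftMul q).snd_eq (hs ρ hρ), h'.snd_eq (hs ρ hρ), real_inner_smul_left,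
    real_inner_smul_right, inner_mul_mul_right, inner_mul_mul_right, norm_unitQuat_zero]
  field_simp

lemma QHor.dhopf_eq {κ : ℍ[ℝ]} (h : QHor p κ H) (hV : IsVert p (X - H) d) (σ : Fin k) :
    dhopf (p.snd σ) (X.snd σ) = imVec κ := by
  have h1 := hV.snd σ
  rw [sub_snd, sub_eq_iff_eq_add] at h1
  rw [h1, map_add, map_smul, dhopf_rotation, smul_zero, zero_add, h.dhopf_snd]

lemma QHor.inner_eq {κ : ℍ[ℝ]} (h : QHor p κ H) (hV : IsVert p (X - H) d) (σ : Fin k) :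
    ⟪p.snd σ * unitQuat 0, X.snd σ⟫_ℝ = κ.re + d σ * ‖p.snd σ‖ ^ 2 := by
  have h1 := hV.snd σ
  rw [sub_snd, sub_eq_iff_eq_add] at h1
  rw [h1, inner_add_right, real_inner_smul_right, inner_rotation_self, h.inner_snd, add_comm]

/-- The vertical part has total zero, so only its jumps outside `s` are seen by the holonomy. For
`s` everything, this determines `Re κ` from the velocity. -/
lemma QHor.partialHol_eq {κ : ℍ[ℝ]} (h : QHor p κ H) (hV : IsVert p (X - H) d)
    {s : Finset (Fin k)} (hs : ∀ ρ ∈ s, p.snd ρ ≠ 0) :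
    partialHol B s p X = κ.re * partialPotential B s p - ∑ ρ ∈ sᶜ, d ρ := by
  have h1 : primL B B.l X = primL B B.l (X - H) + B.l * κ.re := by
    rw [map_sub, primL_constL Bow.l_mem h.fst, sub_add_cancel]
  have h2 := hV.sum
  rw [← Finset.sum_add_sum_compl s] at h2
  have h3 : ∑ ρ ∈ s, ⟪p.snd ρ * unitQuat 0, X.snd ρ⟫_ℝ / ‖p.snd ρ‖ ^ 2 =
      κ.re * ∑ ρ ∈ s, 1 / ‖p.snd ρ‖ ^ 2 + ∑ ρ ∈ s, d ρ := by
    rw [Finset.mul_sum, ← Finset.sum_add_distrib]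
    refine Finset.sum_congr rfl fun ρ hρ => ?_
    have hp : ‖p.snd ρ‖ ^ 2 ≠ 0 := by simpa using hs ρ hρ
    rw [h.inner_eq hV, add_div, mul_div_cancel_right₀ _ hp, mul_one_div]
  rw [partialHol, partialPotential, h1, h3]
  linarith

lemma imPart_eq_zero_of_re {T : Lp ℍ[ℝ] 2 B.vol} {κ : ℍ[ℝ]}
    (h : imPart B T = constL B (imQuat (imVec κ))) : imPart B (T - constL B κ) = 0 := by
  rw [map_sub, h, imPart_constL, sub_self]

/-- The unknowns are `c = Re κ` and the jumps `d` of the vertical part. For `ρ ≠ σ` the equation at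
`ρ` gives `d_ρ` after division by `|b_ρ|²`; the total being zero then gives `d_σ = c W - ζ`; the
equation at `σ` becomes `c (1 + W |b_σ|²) = a + ζ |b_σ|²`, which is solvable even if `b_σ = 0`. -/
lemma IsTan.exists_isHorPart {κ : E3} (h : IsTan p X κ) (σ : Fin k)
    (hσ : ∀ ρ, ρ ≠ σ → p.snd ρ ≠ 0) : ∃ H, IsHorPart p X H := by
  classical
  set s := Finset.univ.erase σ with hs
  set W := partialPotential B s p with hW
  have hWpos : 0 < W := partialPotential_pos s p
  set ζ := partialHol B s p X with hζ
  set a := ⟪p.snd σ * unitQuat 0, X.snd σ⟫_ℝ with ha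
  set c := (a + ζ * ‖p.snd σ‖ ^ 2) / (1 + W * ‖p.snd σ‖ ^ 2) with hc
  have hden : 1 + W * ‖p.snd σ‖ ^ 2 ≠ 0 := by positivity
  have hc' : c * (1 + W * ‖p.snd σ‖ ^ 2) = a + ζ * ‖p.snd σ‖ ^ 2 := div_mul_cancel₀ _ hden
  set d : Fin k → ℝ := fun ρ => if ρ = σ then c * W - ζ else
    (⟪p.snd ρ * unitQuat 0, X.snd ρ⟫_ℝ - c) / ‖p.snd ρ‖ ^ 2 with hd
  set κq : ℍ[ℝ] := (c : ℍ[ℝ]) + imQuat κ with hκ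
  have hκre : κq.re = c := by simp [hκ]
  have hκim : imVec κq = κ := by apply E3_ext <;> simp [hκ]
  set H : Dat B := mkDat (constL B κq, fun ρ => X.snd ρ - d ρ • (p.snd ρ * unitQuat 0)) with hH
  refine ⟨H, ⟨κq, qHor_iff.2 ⟨rfl, fun ρ => ⟨?_, ?_⟩⟩⟩, d, ?_, fun ρ => ?_, ?_⟩
  · rw [hH, mkDat_snd, inner_sub_right, real_inner_smul_right, inner_rotation_self, hκre]
    by_cases hρ : ρ = σ
    · subst hρ
      simp only [hd, if_true]
      linear_combination -hc'
    · have hp : ‖p.snd ρ‖ ^ 2 ≠ 0 := by simpa using hσ ρ hρ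
      simp only [hd, if_neg hρ]
      rw [div_mul_cancel₀ _ hp, sub_sub_cancel]
  · rw [hH, mkDat_snd, map_sub, map_smul, dhopf_rotation, smul_zero, sub_zero, h.snd, hκim]
  · rw [sub_fst, hH, mkDat_fst]
    exact imPart_eq_zero_of_re (by rw [h.im, hκim])
  · rw [hH, sub_snd, mkDat_snd, sub_sub_cancel]
  · have h1 : primL B B.l H = B.l * c := by rw [primL_constL Bow.l_mem (q := κq) rfl, hκre]
    have h2 : ∑ ρ ∈ s, d ρ = ∑ ρ ∈ s, ⟪p.snd ρ * unitQuat 0, X.snd ρ⟫_ℝ / ‖p.snd ρ‖ ^ 2 -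
        c * ∑ ρ ∈ s, 1 / ‖p.snd ρ‖ ^ 2 := by
      rw [Finset.mul_sum, ← Finset.sum_sub_distrib]
      refine Finset.sum_congr rfl fun ρ hρ => ?_
      simp only [hd, if_neg (Finset.ne_of_mem_erase hρ)]
      ring
    have h3 : d σ = c * W - ζ := by simp [hd]
    rw [← Finset.sum_erase_add _ _ (Finset.mem_univ σ), map_sub, h1, h3, hW, hζ, ← hs, h2,
      partialHol, partialPotential]
    ring

end Tangent

end

section

/-! ### Coordinates on the moduli space -/

section Chart

variable {k : ℕ} {B : Bow k} [NeZero k] {ν : Fin k → E3}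

lemma exists_isFrame (s : Finset (Fin k)) (t : E3) (h : ∀ ρ ∈ s, t ≠ ν ρ) : ∃ U q, t ∈ U ∧
    IsFrame ν s U q ∧ ∀ ρ ∈ s, ∀ t, hopf (q ρ t) = t - ν ρ := by
  classical
  have h1 : ∀ ρ : Fin k, ∃ (q : E3 → ℍ[ℝ]) (U : Set E3), ρ ∈ s → (∀ r, hopf (q r) = r) ∧
      IsOpen U ∧ t - ν ρ ∈ U ∧ (0 : E3) ∉ U ∧ ContDiffOn ℝ ∞ q U := by
    intro ρ
    by_cases hρ : ρ ∈ s
    · obtain ⟨q, hq, U, hU⟩ := exists_hopf_section (sub_ne_zero.2 (h ρ hρ))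
      exact ⟨q, U, fun _ => ⟨hq, hU⟩⟩
    · exact ⟨0, univ, fun h => absurd h hρ⟩
  choose q U hqU using h1
  refine ⟨⋂ ρ ∈ s, (fun t => t - ν ρ) ⁻¹' U ρ, fun ρ t => q ρ (t - ν ρ), ?_, ⟨?_, ?_, ?_, ?_⟩, ?_⟩
  · exact mem_iInter₂.2 fun ρ hρ => (hqU ρ hρ).2.2.1
  · exact isOpen_biInter_finset fun ρ hρ =>
      (hqU ρ hρ).2.1.preimage (continuous_id.sub continuous_const)
  · rintro ρ hρ t ht rfl
    have := mem_iInter₂.1 ht ρ hρ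
    simp only [mem_preimage, sub_self] at this
    exact (hqU ρ hρ).2.2.2.1 this
  · intro ρ hρ
    exact (hqU ρ hρ).2.2.2.2.comp (contDiff_id.sub contDiff_const).contDiffOn
      fun t ht => mem_iInter₂.1 ht ρ hρ
  · exact fun ρ hρ t _ => (hqU ρ hρ).1 _
  · exact fun ρ hρ t => (hqU ρ hρ).1 _

/-- The choices from which a coordinate system on the moduli space is made: the component that is
used as a coordinate, and a frame for the phases of the others. -/
structure ChartData (ν : Fin k → E3) where
  σ : Fin k
  U : Set E3
  q : Fin k → E3 → ℍ[ℝ]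
  frame : IsFrame ν (Finset.univ.erase σ) U q
  hopf_eq : ∀ ρ ∈ Finset.univ.erase σ, ∀ t, hopf (q ρ t) = t - ν ρ

/-- The centres are distinct, so at most one component vanishes over `t`, and that one is taken as
the coordinate. -/
lemma exists_chartData (hν : Injective ν) (t : E3) : ∃ C : ChartData ν, t ∈ C.U := by
  have h1 : ∃ σ, ∀ ρ ∈ Finset.univ.erase σ, t ≠ ν ρ := by
    by_cases h : ∃ σ, t = ν σ
    · obtain ⟨σ, rfl⟩ := h
      exact ⟨σ, fun ρ hρ h => Finset.ne_of_mem_erase hρ (hν h).symm⟩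
    · push Not at h
      exact ⟨0, fun ρ _ => h ρ⟩
  obtain ⟨σ, hσ⟩ := h1
  obtain ⟨U, q, ht, hU, hq⟩ := exists_isFrame _ t hσ
  exact ⟨⟨σ, U, q, hU, hq⟩, ht⟩

lemma hol_eq_exp {s : Finset (Fin k)} {U : Set E3} {q : Fin k → E3 → ℍ[ℝ]} {v : ℝ} {x : Dat B}
    (hq : IsFrame ν s U q) (hU : tval ν x ∈ U) {θ : Fin k → ℝ}
    (hx : ∀ ρ ∈ s, x.snd ρ = rsmul (q ρ (tval ν x)) (Complex.exp (Complex.I * (θ ρ : ℂ)))) :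
    hol ν s v q x = Complex.exp (Complex.I * ((∑ ρ ∈ s, θ ρ + primL B v x : ℝ) : ℂ)) := by
  have h1 : ∀ ρ ∈ s, phase (q ρ (tval ν x)) (x.snd ρ) = Complex.exp (Complex.I * (θ ρ : ℂ)) :=
    fun ρ hρ => by rw [hx ρ hρ, phase_rsmul, phase_self (hq.q_ne_zero hρ hU), one_mul]
  rw [hol, Finset.prod_congr rfl h1, ← Complex.exp_sum, ← Complex.exp_add, ← Finset.mul_sum]
  congr 1
  push_cast; ring

namespace ChartData

variable (C : ChartData ν) {x y p X Y H H' : Dat B} {b : ℍ[ℝ]}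

/-- The indices of the components that are not used as coordinates. -/
abbrev s : Finset (Fin k) := Finset.univ.erase C.σ

/-- The coordinate, as a function on the space of data. -/
def coord (x : Dat B) : ℍ[ℝ] := rsmul (x.snd C.σ) (hol ν C.s B.l C.q x)

/-- The point of `ℝ³` under the point with coordinate `b`. -/
def pt (b : ℍ[ℝ]) : E3 := hopf b + ν C.σ

/-- The standard point of the level set with coordinate `b`. -/
def lift (B : Bow k) (b : ℍ[ℝ]) : Dat B :=
  mkDat (constL B (imQuat (C.pt b)), fun ρ => if ρ = C.σ then b else C.q ρ (C.pt b))

lemma mem_s {ρ : Fin k} (h : ρ ≠ C.σ) : ρ ∈ C.s := Finset.mem_erase.2 ⟨h, Finset.mem_univ _⟩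

lemma lift_snd_self : (C.lift B b).snd C.σ = b := by simp [lift]

lemma lift_snd {ρ : Fin k} (h : ρ ≠ C.σ) : (C.lift B b).snd ρ = C.q ρ (C.pt b) := by
  simp [lift, h]

lemma hopf_lift (ρ : Fin k) : hopf ((C.lift B b).snd ρ) = C.pt b - ν ρ := by
  by_cases h : ρ = C.σ
  · subst h; rw [lift_snd_self, pt]; abel
  · rw [C.lift_snd h, C.hopf_eq ρ (C.mem_s h)]

lemma tval_lift : tval ν (C.lift B b) = C.pt b := by
  rw [tval, hopf_lift, sub_add_cancel]

lemma lift_mem : C.lift B b ∈ levelSet B ν := by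
  rw [mem_levelSet_iff, tval_lift]
  refine ⟨?_, C.hopf_lift⟩
  rw [lift, mkDat_fst, imPart_constL, imVec_imQuat]

lemma pt_coord (hx : x ∈ levelSet B ν) (hU : tval ν x ∈ C.U) : C.pt (C.coord x) = tval ν x := by
  rw [pt, coord, hopf_rsmul_unit _ (norm_hol C.frame hx hU), (mem_levelSet_iff.1 hx).2]
  abel

/-- On the slice the remaining phases and the integral of `t₀` are trivial, so `hol = 1`. -/
lemma coord_lift (hU : C.pt b ∈ C.U) : C.coord (C.lift B b) = b := by
  have h1 : hol ν C.s B.l C.q (C.lift B b) = 1 := by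
    rw [hol_eq_exp C.frame (by rwa [tval_lift]) (θ := 0) fun ρ hρ => by
      rw [C.lift_snd (Finset.ne_of_mem_erase hρ), tval_lift]; simp]
    rw [primL_constL (q := imQuat (C.pt b)) Bow.l_mem rfl]
    simp
  rw [coord, h1, rsmul_one, lift_snd_self]

lemma exists_phases {s : Finset (Fin k)} {U : Set E3} {q : Fin k → E3 → ℍ[ℝ]}
    (hq : IsFrame ν s U q) (hx : x ∈ levelSet B ν) (hU : tval ν x ∈ U) : ∃ θ : Fin k → ℝ,
    ∀ ρ ∈ s, x.snd ρ = rsmul (q ρ (tval ν x)) (Complex.exp (Complex.I * (θ ρ : ℂ))) := by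
  have h : ∀ ρ, ∃ θ : ℝ, ρ ∈ s →
      x.snd ρ = rsmul (q ρ (tval ν x)) (Complex.exp (Complex.I * (θ : ℂ))) := by
    intro ρ
    by_cases hρ : ρ ∈ s
    · obtain ⟨θ, h⟩ := exists_norm_one_rsmul (hq.hopf_snd hx hU hρ)
      exact ⟨θ, fun _ => h⟩
    · exact ⟨0, fun h => absurd h hρ⟩
  choose θ hθ using h
  exact ⟨θ, hθ⟩

/-- The jumps are the phases of `x` relative to the frame, except at `σ`, where the total forces
`-a`; this is exactly the phase by which `coord x` differs from `b_σ`. -/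
lemma gaugeRel_lift_coord (hx : x ∈ levelSet B ν) (hU : tval ν x ∈ C.U) :
    ∃ θ, GaugeRel (C.lift B (C.coord x)) x θ := by
  classical
  obtain ⟨θ, hθ⟩ := exists_phases C.frame hx hU
  have hol_eq := hol_eq_exp (v := B.l) C.frame hU hθ
  set a := ∑ ρ ∈ C.s, θ ρ + primL B B.l x with ha
  have hpt := C.pt_coord hx hU
  refine ⟨fun ρ => if ρ = C.σ then -a else θ ρ, ?_, fun ρ => ?_, ?_⟩
  · rw [(mem_levelSet_iff.1 hx).1, (mem_levelSet_iff.1 C.lift_mem).1, tval_lift, hpt]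
  · by_cases hρ : ρ = C.σ
    · subst hρ
      rw [lift_snd_self, coord, hol_eq, rsmul_rsmul, ← Complex.exp_add]
      simp
    · rw [C.lift_snd hρ, hpt, if_neg hρ, hθ ρ (C.mem_s hρ)]
  · rw [primL_constL (x := C.lift B (C.coord x)) (q := imQuat (C.pt (C.coord x))) Bow.l_mem rfl,
      ← Finset.sum_erase_add _ _ (Finset.mem_univ C.σ), if_pos rfl,
      Finset.sum_congr rfl fun ρ hρ => if_neg (Finset.ne_of_mem_erase hρ), ha, re_imQuat]
    ring

/-- The component `b_σ` gains `exp (i θ_σ)` and, the total being zero, `hol` gains the inverse. -/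
lemma coord_gauge {θ : Fin k → ℝ} (h : GaugeRel x y θ) : C.coord y = C.coord x := by
  classical
  rw [coord, coord, hol_gauge h, h.snd, rsmul_rsmul, mul_left_comm, ← Complex.exp_add]
  have h1 := h.sum
  rw [← Finset.sum_erase_add _ _ (Finset.mem_univ C.σ)] at h1
  have h2 : Complex.I * (θ C.σ : ℂ) + Complex.I *
      ((∑ ρ ∈ C.s, θ ρ + (primL B B.l y - primL B B.l x) : ℝ) : ℂ) = 0 := by
    rw [← mul_add, ← Complex.ofReal_add, ← mul_zero Complex.I, ← Complex.ofReal_zero]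
    congr 2
    linarith
  rw [h2, Complex.exp_zero, mul_one]

lemma contDiffAt_coord (hU : tval ν x ∈ C.U) : ContDiffAt ℝ ∞ (C.coord (B := B)) x := by
  have h1 : ContDiff ℝ ∞ (fun a : ℍ[ℝ] × ℂ => rsmul a.1 a.2) :=
    ContinuousLinearMap.isBoundedBilinearMap (E := ℍ[ℝ]) (F := ℂ) (G := ℍ[ℝ]) rsmulL |>.contDiff
  exact h1.contDiffAt.comp x
    ((contDiff_snd C.σ).contDiffAt.prodMk (contDiffAt_hol C.frame hU))

lemma contDiff_pt : ContDiff ℝ ∞ C.pt := contDiff_hopf.add contDiff_const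

lemma isOpen_target : IsOpen (C.pt ⁻¹' C.U) := C.frame.isOpen.preimage C.contDiff_pt.continuous

lemma contDiffAt_q {ρ : Fin k} (hρ : ρ ∈ C.s) (hU : C.pt b ∈ C.U) :
    ContDiffAt ℝ ∞ (fun b => C.q ρ (C.pt b)) b :=
  ((C.frame.smooth ρ hρ).contDiffAt (C.frame.isOpen.mem_nhds hU)).comp b
    C.contDiff_pt.contDiffAt

lemma contDiffAt_lift (hU : C.pt b ∈ C.U) : ContDiffAt ℝ ∞ (C.lift B) b := by
  refine contDiffAt_mkDat ?_ fun ρ => ?_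
  · exact (constL B).contDiff.contDiffAt.comp b
      (imQuat.contDiff.contDiffAt.comp b C.contDiff_pt.contDiffAt)
  · by_cases hρ : ρ = C.σ
    · simp only [hρ, if_true]; exact contDiffAt_id
    · simp only [if_neg hρ]; exact C.contDiffAt_q (C.mem_s hρ) hU

/-! #### The metric and the symplectic forms in coordinates -/

/-- The potential, without the contribution of the centre of the chart. -/
def pot (B : Bow k) (b : ℍ[ℝ]) : ℝ := B.l + ∑ ρ ∈ C.s, 1 / ‖C.q ρ (C.pt b)‖ ^ 2

/-- The connection form, without the contribution of the centre of the chart. -/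
def conn (b : ℍ[ℝ]) : ℍ[ℝ] →L[ℝ] ℝ := ∑ ρ ∈ C.s, (phaseForm (C.q ρ) (C.pt b)).comp (dhopf b)

/-- The one-form `W ⟪b i, ·⟫ + η`. -/
def ell (B : Bow k) (b : ℍ[ℝ]) : ℍ[ℝ] →L[ℝ] ℝ :=
  C.pot B b • innerSL ℝ (b * unitQuat 0) + C.conn b

/-- The component `σ` of the horizontal lift of a vector. -/
def horL (B : Bow k) (b : ℍ[ℝ]) : ℍ[ℝ] →L[ℝ] ℍ[ℝ] :=
  ContinuousLinearMap.id ℝ ℍ[ℝ] -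
    (1 + C.pot B b * ‖b‖ ^ 2)⁻¹ • (C.ell B b).smulRight (b * unitQuat 0)

/-- The inverse of `horL`. -/
def horInv (B : Bow k) (b : ℍ[ℝ]) : ℍ[ℝ] →L[ℝ] ℍ[ℝ] :=
  ContinuousLinearMap.id ℝ ℍ[ℝ] + (C.ell B b).smulRight (b * unitQuat 0)

/-- The bilinear form `⟪q · , ·⟫` on the moduli space, in coordinates. -/
def form (B : Bow k) (q b : ℍ[ℝ]) : ℍ[ℝ] →L[ℝ] ℍ[ℝ] →L[ℝ] ℝ :=
  (1 + C.pot B b * ‖b‖ ^ 2) • (innerSL ℝ).bilinearComp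
    ((ContinuousLinearMap.mul ℝ ℍ[ℝ] q).comp (C.horL B b)) (C.horL B b)

lemma horL_apply (β : ℍ[ℝ]) : C.horL B b β =
    β - ((1 + C.pot B b * ‖b‖ ^ 2)⁻¹ * C.ell B b β) • (b * unitQuat 0) := by
  simp [horL, smul_smul]

lemma horInv_apply (β : ℍ[ℝ]) : C.horInv B b β = β + C.ell B b β • (b * unitQuat 0) := rfl

lemma form_apply (q β β' : ℍ[ℝ]) : C.form B q b β β' =
    (1 + C.pot B b * ‖b‖ ^ 2) * ⟪q * C.horL B b β, C.horL B b β'⟫_ℝ := rfl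

lemma ell_apply (β : ℍ[ℝ]) :
    C.ell B b β = C.pot B b * ⟪b * unitQuat 0, β⟫_ℝ + C.conn b β := rfl

lemma conn_apply (β : ℍ[ℝ]) :
    C.conn b β = ∑ ρ ∈ C.s, phaseForm (C.q ρ) (C.pt b) (dhopf b β) := by
  simp [conn, _root_.sum_apply]

lemma ell_rotation : C.ell B b (b * unitQuat 0) = C.pot B b * ‖b‖ ^ 2 := by
  rw [ell_apply, inner_rotation_self, conn_apply]
  simp [dhopf_rotation]

lemma pot_pos : 0 < C.pot B b :=
  add_pos_of_pos_of_nonneg B.l_pos (Finset.sum_nonneg fun _ _ => by positivity)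

lemma den_pos : 0 < 1 + C.pot B b * ‖b‖ ^ 2 := by
  have := C.pot_pos (B := B) (b := b)
  positivity

lemma horL_horInv (β : ℍ[ℝ]) : C.horL B b (C.horInv B b β) = β := by
  have h := (C.den_pos (B := B) (b := b)).ne'
  rw [horL_apply, horInv_apply, map_add, map_smul, ell_rotation, smul_eq_mul,
    show C.ell B b β + C.ell B b β * (C.pot B b * ‖b‖ ^ 2) =
      (1 + C.pot B b * ‖b‖ ^ 2) * C.ell B b β by ring, inv_mul_cancel_left₀ h, add_sub_cancel_right]

lemma horInv_horL (β : ℍ[ℝ]) : C.horInv B b (C.horL B b β) = β := by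
  have h := (C.den_pos (B := B) (b := b)).ne'
  rw [horInv_apply, horL_apply, map_sub, map_smul, ell_rotation, smul_eq_mul, sub_add,
    ← sub_smul]
  have : (1 + C.pot B b * ‖b‖ ^ 2)⁻¹ * C.ell B b β - (C.ell B b β -
      (1 + C.pot B b * ‖b‖ ^ 2)⁻¹ * C.ell B b β * (C.pot B b * ‖b‖ ^ 2)) = 0 := by
    field_simp; ring
  rw [this, zero_smul, sub_zero]

lemma contDiffAt_form (q β β' : ℍ[ℝ]) (hU : C.pt b ∈ C.U) :
    ContDiffAt ℝ ∞ (fun b => C.form B q b β β') b := by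
  have hrot : ContDiffAt ℝ ∞ (fun b : ℍ[ℝ] => b * unitQuat 0) b :=
    contDiffAt_id.mul contDiffAt_const
  have hpot : ContDiffAt ℝ ∞ (C.pot B) b := by
    refine contDiffAt_const.add (ContDiffAt.sum fun ρ hρ => ?_)
    refine contDiffAt_const.div ((C.contDiffAt_q hρ hU).norm_sq ℝ) ?_
    simpa using C.frame.q_ne_zero hρ hU
  have hconn : ∀ β, ContDiffAt ℝ ∞ (fun b => C.conn b β) b := by
    intro β
    simp only [conn_apply]
    refine ContDiffAt.sum fun ρ hρ => ?_
    have h1 : ContDiffAt ℝ ∞ (fun b => phaseForm (C.q ρ) (C.pt b)) b :=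
      ((contDiffOn_phaseForm C.frame.isOpen (C.frame.smooth ρ hρ)
        (fun t ht => C.frame.q_ne_zero hρ ht)).contDiffAt (C.frame.isOpen.mem_nhds hU)).comp b
        C.contDiff_pt.contDiffAt
    exact h1.clm_apply (contDiff_dhopf.contDiffAt.clm_apply contDiffAt_const)
  have hell : ∀ β, ContDiffAt ℝ ∞ (fun b => C.ell B b β) b := by
    intro β
    simp only [ell_apply]
    exact (hpot.mul (hrot.inner ℝ contDiffAt_const)).add (hconn β)
  have hden : ContDiffAt ℝ ∞ (fun b => 1 + C.pot B b * ‖b‖ ^ 2) b :=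
    contDiffAt_const.add (hpot.mul (contDiffAt_id.norm_sq ℝ))
  have hhor : ∀ β, ContDiffAt ℝ ∞ (fun b => C.horL B b β) b := by
    intro β
    simp only [horL_apply]
    exact contDiffAt_const.sub (((hden.inv C.den_pos.ne').mul (hell β)).smul hrot)
  simp only [form_apply]
  exact hden.mul ((contDiffAt_const.mul (hhor β)).inner ℝ (hhor β'))

lemma pot_coord (hx : x ∈ levelSet B ν) (hU : tval ν x ∈ C.U) :
    C.pot B (C.coord x) = partialPotential B C.s x := by
  rw [pot, partialPotential, C.pt_coord hx hU]
  congr 1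
  exact Finset.sum_congr rfl fun ρ hρ => by rw [C.frame.norm_snd hx hU hρ]

lemma hasDerivAt_coord {c : ℝ → Dat B} (hc : ∀ r, c r ∈ levelSet B ν)
    (hU : tval ν (c 0) ∈ C.U) (hX : HasDerivAt c X 0) :
    HasDerivAt (fun r => C.coord (c r)) (rsmul (X.snd C.σ) (hol ν C.s B.l C.q (c 0)) +
      holForm C.s B.l C.q (tval ν (c 0)) (c 0) X • (C.coord (c 0) * unitQuat 0)) 0 := by
  have h1 := (HasDerivAt.clm (F := ℂ →L[ℝ] ℍ[ℝ]) (HasDerivAt.clm hX (sndL B C.σ)) rsmulL).clm_apply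
    (hasDerivAt_hol (v := B.l) C.frame hc hU hX)
  refine h1.congr_deriv ?_
  simp only [rsmulL_apply, sndL_apply]
  rw [← rsmul_rsmul, rsmul_I_real]
  rfl

/-- The horizontal part of the velocity of a curve, in coordinates. -/
lemma horL_coord {c : ℝ → Dat B} (hc : ∀ r, c r ∈ levelSet B ν)
    (hU : tval ν (c 0) ∈ C.U) (hX : HasDerivAt c X 0) {β : ℍ[ℝ]}
    (hβ : HasDerivAt (fun r => C.coord (c r)) β 0) (hH : IsHorPart (c 0) X H) :
    C.horL B (C.coord (c 0)) β = rsmul (H.snd C.σ) (hol ν C.s B.l C.q (c 0)) := by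
  obtain ⟨⟨κ, h1⟩, d, h2⟩ := hH
  set p := c 0 with hp
  set Z := hol ν C.s B.l C.q p with hZ
  have hZ1 : ‖Z‖ = 1 := norm_hol C.frame (hc 0) hU
  have hb : C.coord p = rsmul (p.snd C.σ) Z := rfl
  have hnb : ‖C.coord p‖ = ‖p.snd C.σ‖ := by rw [hb, norm_rsmul, hZ1, mul_one]
  have e1 := hβ.unique (C.hasDerivAt_coord hc hU hX)
  set a := holForm C.s B.l C.q (tval ν p) p X with ha
  have hcompl : (C.s)ᶜ = {C.σ} := by ext; simp [s]
  have e2 : partialHol B C.s p X = κ.re * C.pot B (C.coord p) - d C.σ := by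
    rw [h1.partialHol_eq h2 fun ρ hρ => C.frame.snd_ne_zero (hc 0) hU hρ, hcompl,
      Finset.sum_singleton, C.pot_coord (hc 0) hU]
  have hκ : dhopf (p.snd 0) (X.snd 0) = dhopf (p.snd C.σ) (X.snd C.σ) := by
    rw [h1.dhopf_eq h2, h1.dhopf_eq h2]
  have hdβ : dhopf (C.coord p) β = dhopf (p.snd C.σ) (X.snd C.σ) := by
    rw [e1, map_add, map_smul, dhopf_rotation, smul_zero, add_zero, hb, dhopf_rsmul_unit _ _ hZ1]
  have e3 : a = partialHol B C.s p X + C.conn (C.coord p) β := by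
    rw [ha, holForm, partialHol, conn_apply, hdβ, ← hκ, C.pt_coord (hc 0) hU,
      Finset.sum_add_distrib]
    ring
  have e4 : ⟪C.coord p * unitQuat 0, β⟫_ℝ =
      κ.re + d C.σ * ‖C.coord p‖ ^ 2 + a * ‖C.coord p‖ ^ 2 := by
    rw [e1, inner_add_right, real_inner_smul_right, inner_rotation_self, hb, rsmul_mul_unit,
      inner_rsmul_rsmul, hZ1, h1.inner_eq h2, ← hb, hnb]
    ring
  -- With `b = coord p` and `Z = hol`, the rotated components satisfy `β = X_σ Z + a b i` and `H_σ Z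
  -- = X_σ Z - d_σ b i`, so `β` has to be corrected by `(a + d_σ) b i`. This equation recovers `a +
  -- d_σ` from `β` alone, which explains the form of `ell` and `horL`.
  have e5 : C.ell B (C.coord p) β = (1 + C.pot B (C.coord p) * ‖C.coord p‖ ^ 2) * (a + d C.σ) := by
    rw [ell_apply, e4, e3, e2]; ring
  rw [horL_apply, e5, inv_mul_cancel_left₀ C.den_pos.ne', e1]
  have h3 := h2.snd C.σ
  rw [sub_snd, sub_eq_iff_eq_add] at h3
  rw [h3, add_rsmul, smul_rsmul, ← rsmul_mul_unit, ← hb, add_smul]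
  abel

/-- The bilinear form in coordinates is that of the horizontal parts. -/
lemma form_coord {c c' : ℝ → Dat B} (hc : ∀ r, c r ∈ levelSet B ν)
    (hc' : ∀ r, c' r ∈ levelSet B ν) (hcc : c' 0 = c 0)
    (hU : tval ν (c 0) ∈ C.U) (hX : HasDerivAt c X 0) (hY : HasDerivAt c' Y 0) {β β' : ℍ[ℝ]}
    (hβ : HasDerivAt (fun r => C.coord (c r)) β 0)
    (hβ' : HasDerivAt (fun r => C.coord (c' r)) β' 0) (hH : IsHorPart (c 0) X H)
    (hH' : IsHorPart (c 0) Y H') (q : ℍ[ℝ]) :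
    C.form B q (C.coord (c 0)) β β' = ⟪leftMul B q H, H'⟫_ℝ := by
  have e1 := C.horL_coord hc hU hX hβ hH
  have e2 := C.horL_coord hc' (by rwa [hcc]) hY hβ' (by rwa [hcc])
  rw [hcc] at e2
  obtain ⟨⟨κ, h1⟩, -⟩ := hH
  obtain ⟨⟨κ', h1'⟩, -⟩ := hH'
  set p := c 0 with hp
  have hZ1 : ‖hol ν C.s B.l C.q p‖ = 1 := norm_hol C.frame (hc 0) hU
  have hnb : ‖C.coord p‖ = ‖p.snd C.σ‖ := by rw [coord, norm_rsmul, hZ1, mul_one]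
  have hcompl : (C.s)ᶜ = {C.σ} := by ext; simp [s]
  -- Since `κ = -H_σ i b̄_σ`, both terms of `QHor.inner_leftMul` are multiples of the pairing of the
  -- `σ` components, with factors `W |b|²` and `1`; no division by `|b|` occurs.
  have e3 : ⟪q * κ, κ'⟫_ℝ = ‖C.coord p‖ ^ 2 * ⟪q * H.snd C.σ, H'.snd C.σ⟫_ℝ := by
    have h2 := h1.snd C.σ
    have h2' := h1'.snd C.σ
    rw [← neg_neg κ, ← neg_neg κ', ← h2, ← h2', mul_neg, inner_neg_neg,
      ← mul_assoc, ← mul_assoc, inner_mul_mul_right, inner_mul_mul_right, norm_unitQuat_zero,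
      norm_star, hnb, one_mul]
  rw [form_apply, e1, e2, mul_rsmul, inner_rsmul_rsmul, hZ1,
    h1.inner_leftMul h1' q (s := C.s) fun ρ hρ => C.frame.snd_ne_zero (hc 0) hU hρ, hcompl,
    Finset.sum_singleton, ← C.pot_coord (hc 0) hU, e3]
  ring

/-- The bilinear form is invariant under rotations. -/
lemma form_rsmul (q β β' : ℍ[ℝ]) {z : ℂ} (hz : ‖z‖ = 1) :
    C.form B q (rsmul b z) (rsmul β z) (rsmul β' z) = C.form B q b β β' := by
  have hpt : C.pt (rsmul b z) = C.pt b := by rw [pt, hopf_rsmul_unit _ hz, pt]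
  have hpot : C.pot B (rsmul b z) = C.pot B b := by rw [pot, hpt, pot]
  have hn : ‖rsmul b z‖ = ‖b‖ := by rw [norm_rsmul, hz, mul_one]
  have hell : ∀ β, C.ell B (rsmul b z) (rsmul β z) = C.ell B b β := by
    intro β
    rw [ell_apply, ell_apply, hpot, conn_apply, conn_apply, hpt, dhopf_rsmul_unit _ _ hz,
      rsmul_mul_unit, inner_rsmul_rsmul, hz]
    ring
  have hhor : ∀ β, C.horL B (rsmul b z) (rsmul β z) = rsmul (C.horL B b β) z := by
    intro β
    rw [horL_apply, horL_apply, hpot, hn, hell, sub_rsmul, smul_rsmul, rsmul_mul_unit]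
  rw [form_apply, form_apply, hhor, hhor, hpot, hn, mul_rsmul, inner_rsmul_rsmul, hz]
  ring

end ChartData

end Chart

end

section

/-! ### The moduli space as a manifold -/

section Moduli

variable {k : ℕ} {B : Bow k} [NeZero k] {ν : Fin k → E3}

/-- `GaugeRel` is reflexive, symmetric and transitive, so the equivalence relation generated by the
action is no larger. -/
lemma proj_eq_iff {x y : levelSet B ν} :
    proj B ν x = proj B ν y ↔ ∃ θ, GaugeRel (x : Dat B) y θ := by
  constructor
  · intro h
    have h1 := Quot.eqvGen_exact h
    clear h
    induction h1 with
    | rel x y h =>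
      obtain ⟨g, hg, hxy⟩ := h
      obtain ⟨θ, hθ, -⟩ := exists_gaugeRel hg hxy
      exact ⟨θ, hθ⟩
    | refl x => exact ⟨0, GaugeRel.refl⟩
    | symm x y _ ih => obtain ⟨θ, hθ⟩ := ih; exact ⟨_, hθ.symm⟩
    | trans x y z _ _ ih1 ih2 =>
      obtain ⟨θ, hθ⟩ := ih1
      obtain ⟨θ', hθ'⟩ := ih2
      exact ⟨_, hθ.trans hθ'⟩
  · rintro ⟨θ, hθ⟩
    obtain ⟨g, hg, hxy, -⟩ := hθ.exists_gauge
    exact Quot.sound ⟨g, hg, hxy⟩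

lemma proj_surjective : Surjective (proj B ν) := Quot.mk_surjective

lemma isQuotientMap_proj : IsQuotientMap (proj B ν) := isQuotientMap_quot_mk

lemma continuous_proj : Continuous (proj B ν) := continuous_quot_mk

/-- The map from the moduli space to `ℝ³`. -/
def Moduli.toE3 (m : Moduli B ν) : E3 :=
  Quot.lift (fun x : levelSet B ν => tval ν (x : Dat B)) (by
    rintro x y ⟨g, hg, hxy⟩
    obtain ⟨θ, hθ, -⟩ := exists_gaugeRel hg hxy
    exact hθ.tval_eq.symm) m

@[simp] lemma Moduli.toE3_proj (x : levelSet B ν) : (proj B ν x).toE3 = tval ν (x : Dat B) := rfl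

lemma Moduli.continuous_toE3 : Continuous (Moduli.toE3 : Moduli B ν → E3) :=
  isQuotientMap_proj.continuous_iff.2 (contDiff_tval.continuous.comp continuous_subtype_val)

namespace ChartData

variable (C : ChartData ν)

/-- The coordinate of a point of the moduli space. -/
def mcoord (m : Moduli B ν) : ℍ[ℝ] :=
  Quot.lift (fun x : levelSet B ν => C.coord (x : Dat B)) (by
    rintro x y ⟨g, hg, hxy⟩
    obtain ⟨θ, hθ, -⟩ := exists_gaugeRel hg hxy
    exact (C.coord_gauge hθ).symm) m

@[simp] lemma mcoord_proj (x : levelSet B ν) : C.mcoord (proj B ν x) = C.coord (x : Dat B) := rfl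

/-- The standard point of the level set with given coordinate. -/
def liftN (B : Bow k) (b : ℍ[ℝ]) : levelSet B ν := ⟨C.lift B b, C.lift_mem⟩

lemma proj_liftN_mcoord {m : Moduli B ν} (hm : m.toE3 ∈ C.U) :
    proj B ν (C.liftN B (C.mcoord m)) = m := by
  obtain ⟨x, rfl⟩ := proj_surjective m
  exact proj_eq_iff.2 (C.gaugeRel_lift_coord x.2 hm)

@[simp] lemma toE3_proj_liftN (b : ℍ[ℝ]) : (proj B ν (C.liftN B b)).toE3 = C.pt b := C.tval_lift

lemma mcoord_proj_liftN {b : ℍ[ℝ]} (hb : C.pt b ∈ C.U) :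
    C.mcoord (proj B ν (C.liftN B b)) = b := C.coord_lift hb

lemma pt_mcoord {m : Moduli B ν} (hm : m.toE3 ∈ C.U) : C.pt (C.mcoord m) = m.toE3 := by
  obtain ⟨x, rfl⟩ := proj_surjective m
  exact C.pt_coord x.2 hm

/-- The identification of the coordinates with the model space. -/
abbrev e : ℍ[ℝ] ≃L[ℝ] E4 := Quaternion.linearIsometryEquivTuple.toContinuousLinearEquiv

/-- The coordinate system as a chart. -/
def chart (B : Bow k) : OpenPartialHomeomorph (Moduli B ν) E4 where
  toFun m := e (C.mcoord m)
  invFun u := proj B ν (C.liftN B (e.symm u))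
  source := Moduli.toE3 ⁻¹' C.U
  target := e.symm ⁻¹' (C.pt ⁻¹' C.U)
  map_source' m hm := by
    simp only [mem_preimage, ContinuousLinearEquiv.symm_apply_apply] at hm ⊢
    rwa [C.pt_mcoord hm]
  map_target' u hu := by
    simp only [mem_preimage, toE3_proj_liftN] at hu ⊢
    exact hu
  left_inv' m hm := by rw [ContinuousLinearEquiv.symm_apply_apply, C.proj_liftN_mcoord hm]
  right_inv' u hu := by rw [C.mcoord_proj_liftN hu, ContinuousLinearEquiv.apply_symm_apply]
  open_source := C.frame.isOpen.preimage Moduli.continuous_toE3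
  open_target := C.isOpen_target.preimage e.symm.continuous
  continuousOn_toFun := by
    refine (isQuotientMap_proj.continuousOn_isOpen_iff
      (C.frame.isOpen.preimage Moduli.continuous_toE3)).2 ?_
    refine e.continuous.comp_continuousOn fun x hx => ContinuousAt.continuousWithinAt ?_
    exact (C.contDiffAt_coord hx).continuousAt.comp continuous_subtype_val.continuousAt
  continuousOn_invFun := by
    refine continuous_proj.comp_continuousOn fun u hu => ContinuousAt.continuousWithinAt ?_
    refine IsInducing.subtypeVal.continuousAt_iff.2 ?_
    exact (C.contDiffAt_lift hu).continuousAt.comp e.symm.continuous.continuousAt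

lemma chart_apply (m : Moduli B ν) : C.chart B m = e (C.mcoord m) := rfl
lemma chart_symm_apply (u : E4) : (C.chart B).symm u = proj B ν (C.liftN B (e.symm u)) := rfl

end ChartData

open ChartData (e)

variable [hν : Fact (Injective ν)]

/-- A coordinate system around a point of the moduli space. -/
def dataAt (m : Moduli B ν) : ChartData ν := (exists_chartData hν.out m.toE3).choose

lemma mem_dataAt (m : Moduli B ν) : m.toE3 ∈ (dataAt m).U :=
  (exists_chartData hν.out m.toE3).choose_spec

instance : ChartedSpace E4 (Moduli B ν) where
  atlas := range fun C : ChartData ν => C.chart B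
  chartAt m := (dataAt m).chart B
  mem_chart_source := mem_dataAt
  chart_mem_atlas _ := mem_range_self _

/-- A change of charts is the slice of one followed by the coordinate of the other, both smooth maps
from or to the space of data. -/
instance : IsManifold 𝓘(ℝ, E4) ∞ (Moduli B ν) := by
  refine isManifold_of_contDiffOn 𝓘(ℝ, E4) ∞ _ ?_
  rintro _ _ ⟨C, rfl⟩ ⟨C', rfl⟩ u hu
  have h1 : C.pt (e.symm u) ∈ C.U := hu.1.1
  have h2 : C.pt (e.symm u) ∈ C'.U := by
    have h : ((C.chart B).symm u).toE3 ∈ C'.U := hu.1.2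
    rwa [C.chart_symm_apply, C.toE3_proj_liftN] at h
  refine ContDiffAt.contDiffWithinAt ?_
  have h3 : ContDiffAt ℝ ∞ (fun u => C'.coord (C.lift B (e.symm u))) u :=
    (C'.contDiffAt_coord (by rwa [C.tval_lift])).comp u
      ((C.contDiffAt_lift h1).comp u e.symm.contDiff.contDiffAt)
  exact e.contDiff.contDiffAt.comp u h3

section Maps

variable {F : Type} [NormedAddCommGroup F] [NormedSpace ℝ F] {c : F → levelSet B ν} {x : F}

lemma continuousAt_proj_comp (hc : ContDiffAt ℝ ∞ (fun y => (c y : Dat B)) x) :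
    ContinuousAt (fun y => proj B ν (c y)) x :=
  continuous_proj.continuousAt.comp (IsInducing.subtypeVal.continuousAt_iff.2 hc.continuousAt)

lemma contDiffAt_coord_comp (C : ChartData ν) (hc : ContDiffAt ℝ ∞ (fun y => (c y : Dat B)) x)
    (hU : (proj B ν (c x)).toE3 ∈ C.U) : ContDiffAt ℝ ∞ (fun y => C.coord (c y : Dat B)) x :=
  ContDiffAt.comp (g := C.coord (B := B)) x (C.contDiffAt_coord hU) hc

lemma contMDiffAt_proj_comp (hc : ContDiffAt ℝ ∞ (fun y => (c y : Dat B)) x) :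
    ContMDiffAt 𝓘(ℝ, F) 𝓘(ℝ, E4) ∞ (fun y => proj B ν (c y)) x := by
  rw [contMDiffAt_iff]
  refine ⟨continuousAt_proj_comp hc, ContDiffAt.contDiffWithinAt ?_⟩
  exact e.contDiff.contDiffAt.comp x
    (contDiffAt_coord_comp _ hc (mem_dataAt (proj B ν (c x))))

/-- The tangent space at a point is read in the preferred chart there, so the velocity is the
derivative of that chart's coordinate. -/
lemma projDeriv_eq (hc : ContDiffAt ℝ ∞ (fun y => (c y : Dat B)) x) (v : F) :
    projDeriv B ν c x v =
      e (fderiv ℝ (fun y => (dataAt (proj B ν (c x))).coord (c y : Dat B)) x v) := by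
  have h1 := (contDiffAt_coord_comp _ hc (mem_dataAt (proj B ν (c x)))).differentiableAt
    (by simp)
  have h2 : HasMFDerivAt 𝓘(ℝ, F) 𝓘(ℝ, E4) (fun y => proj B ν (c y)) x
      ((e : ℍ[ℝ] →L[ℝ] E4).comp
        (fderiv ℝ (fun y => (dataAt (proj B ν (c x))).coord (c y : Dat B)) x)) := by
    refine ⟨continuousAt_proj_comp hc, HasFDerivAt.hasFDerivWithinAt ?_⟩
    exact (e : ℍ[ℝ] →L[ℝ] E4).hasFDerivAt.comp x h1.hasFDerivAt
  rw [projDeriv, h2.mfderiv]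
  rfl

end Maps

end Moduli

end

section

/-! ### The metric and the two-forms on the moduli space -/

section Metric

open ChartData (e)

variable {k : ℕ} {B : Bow k} [NeZero k] {ν : Fin k → E3}

section Maps

variable {F : Type} [NormedAddCommGroup F] [NormedSpace ℝ F] {c : F → levelSet B ν} {x v w : F}
  {H H' : Dat B}

lemma hasDerivAt_line (hc : ContDiffAt ℝ ∞ (fun y => (c y : Dat B)) x) (v : F) :
    HasDerivAt (fun r : ℝ => (c (x + r • v) : Dat B)) (fderiv ℝ (fun y => (c y : Dat B)) x v) 0 :=
  ((hc.differentiableAt (by simp)).hasFDerivAt.hasLineDerivAt v :)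

lemma isVel_fderiv (hc : ContDiffAt ℝ ∞ (fun y => (c y : Dat B)) x) (v : F) :
    IsVel ν (c x : Dat B) (fderiv ℝ (fun y => (c y : Dat B)) x v) := by
  refine ⟨fun r => c (x + r • v), fun r => (c _).2, by simp, ?_, hasDerivAt_line hc v⟩
  have h1 : ContDiffAt ℝ ∞ (fun r : ℝ => x + r • v) 0 :=
    contDiffAt_const.add (contDiffAt_id.smul contDiffAt_const)
  have h2 : ContDiffAt ℝ ∞ (fun y => (c y : Dat B)) (x + (0 : ℝ) • v) := by simpa using hc
  exact ContDiffAt.comp (g := fun y => (c y : Dat B)) 0 h2 h1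

variable [hν : Fact (Injective ν)]

lemma form_fderiv (C : ChartData ν) (hc : ContDiffAt ℝ ∞ (fun y => (c y : Dat B)) x)
    (hU : (proj B ν (c x)).toE3 ∈ C.U)
    (hH : IsHorPart (c x : Dat B) (fderiv ℝ (fun y => (c y : Dat B)) x v) H)
    (hH' : IsHorPart (c x : Dat B) (fderiv ℝ (fun y => (c y : Dat B)) x w) H') (q : ℍ[ℝ]) :
    C.form B q (C.coord (c x : Dat B)) (fderiv ℝ (fun y => C.coord (c y : Dat B)) x v)
      (fderiv ℝ (fun y => C.coord (c y : Dat B)) x w) = ⟪leftMul B q H, H'⟫_ℝ := by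
  have e0 : ∀ v : F, x + (0 : ℝ) • v = x := fun v => by simp
  have hd := (contDiffAt_coord_comp C hc hU).differentiableAt (by simp)
  have h := C.form_coord (c := fun r => (c (x + r • v) : Dat B))
    (c' := fun r => (c (x + r • w) : Dat B)) (H := H) (H' := H') (fun r => (c _).2)
    (fun r => (c _).2) (by simp only [e0]) (by simp only [e0]; exact hU) (hasDerivAt_line hc v)
    (hasDerivAt_line hc w) (hd.hasFDerivAt.hasLineDerivAt v) (hd.hasFDerivAt.hasLineDerivAt w)
    (by simp only [e0]; exact hH) (by simp only [e0]; exact hH') q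
  simp only [e0] at h
  exact h

end Maps

variable [hν : Fact (Injective ν)]

lemma exists_isHorPart {p X : Dat B} (h : IsVel ν p X) : ∃ H, IsHorPart p X H := by
  obtain ⟨C, hC⟩ := exists_chartData hν.out (tval ν p)
  exact h.isTan.exists_isHorPart C.σ fun ρ hρ => C.frame.snd_ne_zero h.mem hC (C.mem_s hρ)

/-- The bilinear form on the moduli space induced by `⟪q ·, ·⟫`. -/
def mform (B : Bow k) (ν : Fin k → E3) [Fact (Injective ν)] (q : ℍ[ℝ]) :
    BilinField (Moduli B ν) := fun m =>
  ((dataAt m).form B q ((dataAt m).mcoord m)).bilinearComp (e.symm : E4 →L[ℝ] ℍ[ℝ])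
    (e.symm : E4 →L[ℝ] ℍ[ℝ])

lemma mform_apply (q : ℍ[ℝ]) (m : Moduli B ν) (u v : E4) : mform B ν q m u v =
    (dataAt m).form B q ((dataAt m).mcoord m) (e.symm u) (e.symm v) := rfl

section Maps

variable {F : Type} [NormedAddCommGroup F] [NormedSpace ℝ F] {c : F → levelSet B ν} {x v w : F}
  {H H' : Dat B}

/-- The definition of `mform` uses a different chart at each point; the right side mentions none.
Independence of the chart, and with it smoothness, follows. -/
lemma mform_projDeriv (hc : ContDiffAt ℝ ∞ (fun y => (c y : Dat B)) x)
    (hH : IsHorPart (c x : Dat B) (fderiv ℝ (fun y => (c y : Dat B)) x v) H)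
    (hH' : IsHorPart (c x : Dat B) (fderiv ℝ (fun y => (c y : Dat B)) x w) H') (q : ℍ[ℝ]) :
    mform B ν q (proj B ν (c x)) (projDeriv B ν c x v) (projDeriv B ν c x w) =
      ⟪leftMul B q H, H'⟫_ℝ := by
  rw [projDeriv_eq hc, projDeriv_eq hc]
  refine (mform_apply _ _ _ _).trans ?_
  rw [ContinuousLinearEquiv.symm_apply_apply, ContinuousLinearEquiv.symm_apply_apply]
  exact form_fderiv _ hc (mem_dataAt _) hH hH' q

/-- The bilinear forms can be calculated in any coordinate system. -/
lemma mform_projDeriv_eq (C : ChartData ν) (hc : ContDiffAt ℝ ∞ (fun y => (c y : Dat B)) x)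
    (hU : (proj B ν (c x)).toE3 ∈ C.U) (v w : F) (q : ℍ[ℝ]) :
    mform B ν q (proj B ν (c x)) (projDeriv B ν c x v) (projDeriv B ν c x w) =
      C.form B q (C.coord (c x : Dat B)) (fderiv ℝ (fun y => C.coord (c y : Dat B)) x v)
        (fderiv ℝ (fun y => C.coord (c y : Dat B)) x w) := by
  obtain ⟨H, hH⟩ := exists_isHorPart (isVel_fderiv hc v)
  obtain ⟨H', hH'⟩ := exists_isHorPart (isVel_fderiv hc w)
  rw [mform_projDeriv hc hH hH', form_fderiv C hc hU hH hH']

end Maps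

namespace ChartData

variable (C : ChartData ν) {b : ℍ[ℝ]} {u : E4}

lemma fderiv_coord_lift (hb : C.pt b ∈ C.U) :
    fderiv ℝ (fun b => C.coord (C.lift B b)) b = ContinuousLinearMap.id ℝ ℍ[ℝ] := by
  have h : (fun b => C.coord (C.lift B b)) =ᶠ[𝓝 b] id := by
    filter_upwards [C.isOpen_target.mem_nhds hb] with b' hb' using C.coord_lift hb'
  rw [h.fderiv_eq, fderiv_id]

lemma contDiffAt_liftN (hb : C.pt b ∈ C.U) :
    ContDiffAt ℝ ∞ (fun b => (C.liftN B b : Dat B)) b := C.contDiffAt_lift hb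

lemma mform_liftN (hb : C.pt b ∈ C.U) (β β' q : ℍ[ℝ]) :
    mform B ν q (proj B ν (C.liftN B b)) (projDeriv B ν (C.liftN B) b β)
      (projDeriv B ν (C.liftN B) b β') = C.form B q b β β' := by
  rw [mform_projDeriv_eq C (C.contDiffAt_liftN hb) (by rwa [C.toE3_proj_liftN])]
  simp only [liftN]
  rw [C.fderiv_coord_lift hb, C.coord_lift hb]
  rfl

lemma contDiffAt_liftN_e (hu : C.pt (e.symm u) ∈ C.U) :
    ContDiffAt ℝ ∞ (fun u => (C.liftN B (e.symm u) : Dat B)) u :=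
  ContDiffAt.comp (g := fun b => (C.liftN B b : Dat B)) u (C.contDiffAt_liftN hu)
    e.symm.contDiff.contDiffAt

lemma mform_liftN_e (hu : C.pt (e.symm u) ∈ C.U) (v w : E4) (q : ℍ[ℝ]) :
    mform B ν q (proj B ν (C.liftN B (e.symm u)))
      (projDeriv B ν (fun u => C.liftN B (e.symm u)) u v)
      (projDeriv B ν (fun u => C.liftN B (e.symm u)) u w) =
        C.form B q (e.symm u) (e.symm v) (e.symm w) := by
  rw [mform_projDeriv_eq (c := fun u => C.liftN B (e.symm u)) C (C.contDiffAt_liftN_e hu)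
    (by rwa [C.toE3_proj_liftN])]
  have h : fderiv ℝ (fun u => C.coord (C.lift B (e.symm u))) u = (e.symm : E4 →L[ℝ] ℍ[ℝ]) := by
    have h1 : (fun u => C.coord (C.lift B (e.symm u))) =ᶠ[𝓝 u] e.symm := by
      filter_upwards [(C.isOpen_target.preimage e.symm.continuous).mem_nhds hu] with b' hb'
        using C.coord_lift hb'
    rw [h1.fderiv_eq]
    exact (e.symm : E4 →L[ℝ] ℍ[ℝ]).fderiv
  simp only [liftN]
  rw [h, C.coord_lift hu]
  rfl

end ChartData

/-! ### Smoothness of fields of bilinear forms, read in charts -/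

lemma trivializationAt_tangent_symm {M : Type} [TopologicalSpace M] [ChartedSpace E4 M]
    [IsManifold 𝓘(ℝ, E4) ∞ M] {m₀ m : M} (hm : m ∈ (chartAt E4 m₀).source) (v : E4) :
    (trivializationAt E4 (TangentSpace 𝓘(ℝ, E4) : M → Type) m₀).symm m v =
      mfderiv 𝓘(ℝ, E4) 𝓘(ℝ, E4) (extChartAt 𝓘(ℝ, E4) m₀).symm (extChartAt 𝓘(ℝ, E4) m₀ m) v := by
  have h4 := TangentBundle.symmL_trivializationAt (I := 𝓘(ℝ, E4)) hm
  have h5 := congrArg (fun L => L v) h4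
  rw [Bundle.Trivialization.symmL_apply _ hm] at h5
  simp only [modelWithCornersSelf_coe, range_id, mfderivWithin_univ] at h5
  exact h5

/-- A field of bilinear forms is smooth if its expressions in the charts are smooth. -/
lemma contMDiffAt_bilinField {M : Type} [TopologicalSpace M] [ChartedSpace E4 M]
    [IsManifold 𝓘(ℝ, E4) ∞ M] (g : BilinField M) (m₀ : M) (G : E4 → (E4 →L[ℝ] E4 →L[ℝ] ℝ))
    (hG : ContDiffAt ℝ ∞ G (extChartAt 𝓘(ℝ, E4) m₀ m₀))
    (h : ∀ u ∈ (extChartAt 𝓘(ℝ, E4) m₀).target, ∀ v w : E4,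
      g ((extChartAt 𝓘(ℝ, E4) m₀).symm u)
        (mfderiv 𝓘(ℝ, E4) 𝓘(ℝ, E4) (extChartAt 𝓘(ℝ, E4) m₀).symm u v)
        (mfderiv 𝓘(ℝ, E4) 𝓘(ℝ, E4) (extChartAt 𝓘(ℝ, E4) m₀).symm u w) = G u v w) :
    ContMDiffAt 𝓘(ℝ, E4) (𝓘(ℝ, E4).prod 𝓘(ℝ, E4 →L[ℝ] E4 →L[ℝ] ℝ)) ∞
      (fun m : M => Bundle.TotalSpace.mk' (E4 →L[ℝ] E4 →L[ℝ] ℝ)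
        (E := fun m : M => TangentSpace 𝓘(ℝ, E4) m →L[ℝ] TangentSpace 𝓘(ℝ, E4) m →L[ℝ] ℝ)
        m (g m)) m₀ := by
  refine (contMDiffAt_hom_bundle _).2 ⟨contMDiffAt_id, ?_⟩
  have h1 : ContMDiffAt 𝓘(ℝ, E4) 𝓘(ℝ, E4 →L[ℝ] E4 →L[ℝ] ℝ) ∞
      (fun m : M => G (extChartAt 𝓘(ℝ, E4) m₀ m)) m₀ :=
    hG.contMDiffAt.comp m₀ contMDiffAt_extChartAt
  refine h1.congr_of_eventuallyEq ?_
  filter_upwards [extChartAt_source_mem_nhds (I := 𝓘(ℝ, E4)) m₀] with m hm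
  have hm' : m ∈ (chartAt E4 m₀).source := by rwa [← extChartAt_source 𝓘(ℝ, E4)]
  ext v w
  rw [inCoordinates_apply_eq₂ hm' hm' (Set.mem_univ _), trivializationAt_tangent_symm hm',
    trivializationAt_tangent_symm hm']
  simp only [Bundle.Trivial.fiberBundle_trivializationAt',
    Bundle.Trivial.linearMapAt_trivialization, LinearMap.id_coe, id_eq]
  have h2 := h _ ((extChartAt 𝓘(ℝ, E4) m₀).map_source hm) v w
  rw [(extChartAt 𝓘(ℝ, E4) m₀).left_inv hm] at h2
  exact h2

lemma coe_extChartAt (m₀ : Moduli B ν) :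
    (extChartAt 𝓘(ℝ, E4) m₀ : Moduli B ν → E4) = (dataAt m₀).chart B := by
  rw [extChartAt_coe]; rfl

lemma coe_extChartAt_symm (m₀ : Moduli B ν) :
    ((extChartAt 𝓘(ℝ, E4) m₀).symm : E4 → Moduli B ν) =
      fun u => proj B ν ((dataAt m₀).liftN B (e.symm u)) := by
  rw [extChartAt_coe_symm]; rfl

lemma contMDiffAt_mform (m₀ : Moduli B ν) (q : ℍ[ℝ]) :
    ContMDiffAt 𝓘(ℝ, E4) (𝓘(ℝ, E4).prod 𝓘(ℝ, E4 →L[ℝ] E4 →L[ℝ] ℝ)) ∞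
      (fun m : Moduli B ν => Bundle.TotalSpace.mk' (E4 →L[ℝ] E4 →L[ℝ] ℝ)
        (E := fun m : Moduli B ν => TangentSpace 𝓘(ℝ, E4) m →L[ℝ] TangentSpace 𝓘(ℝ, E4) m →L[ℝ] ℝ)
        m (mform B ν q m)) m₀ := by
  set C := dataAt m₀ with hC
  have hm₀ : m₀.toE3 ∈ C.U := mem_dataAt m₀
  refine contMDiffAt_bilinField _ m₀ (fun u =>
    (C.form B q (e.symm u)).bilinearComp (e.symm : E4 →L[ℝ] ℍ[ℝ]) (e.symm : E4 →L[ℝ] ℍ[ℝ])) ?_ ?_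
  · have hGs : ContDiffOn ℝ ∞ (fun u => (C.form B q (e.symm u)).bilinearComp
        (e.symm : E4 →L[ℝ] ℍ[ℝ]) (e.symm : E4 →L[ℝ] ℍ[ℝ])) (C.chart B).target := by
      refine contDiffOn_clm_apply.2 fun v => contDiffOn_clm_apply.2 fun w => ?_
      intro u hu
      exact ((C.contDiffAt_form q (e.symm v) (e.symm w) hu).comp u
        e.symm.contDiff.contDiffAt).contDiffWithinAt
    rw [coe_extChartAt]
    exact hGs.contDiffAt ((C.chart B).open_target.mem_nhds ((C.chart B).map_source hm₀))
  · intro u hu v w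
    have hu' : C.pt (e.symm u) ∈ C.U := by
      rw [extChartAt_target] at hu
      exact hu.1
    rw [coe_extChartAt_symm]
    exact C.mform_liftN_e hu' v w q

end Metric

end

section

/-! ### The hyperkähler quotient -/

section Quotient

open ChartData (e)

variable {k : ℕ} {B : Bow k} [NeZero k] {ν : Fin k → E3}

lemma unitQuat_skew (j : Fin 3) (a b : ℍ[ℝ]) : ⟪unitQuat j * a, b⟫_ℝ = -⟪unitQuat j * b, a⟫_ℝ := by
  fin_cases j <;> simp [quat_inner_eq] <;> ring

lemma unitQuat_mul_self (j : Fin 3) (a : ℍ[ℝ]) : unitQuat j * (unitQuat j * a) = -a := by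
  fin_cases j <;> ext <;> simp

lemma unitQuat_zero_mul_one (a : ℍ[ℝ]) : unitQuat 0 * (unitQuat 1 * a) = unitQuat 2 * a := by
  ext <;> simp

/-- Left multiplication by a quaternion as a linear map. -/
def leftMulL (B : Bow k) (q : ℍ[ℝ]) : Dat B →L[ℝ] Dat B :=
  mkDat.comp (((ContinuousLinearMap.compLpL 2 B.vol (ContinuousLinearMap.mul ℝ ℍ[ℝ] q)).comp
    (fstL B)).prod (ContinuousLinearMap.pi fun σ =>
      (ContinuousLinearMap.mul ℝ ℍ[ℝ] q).comp (sndL B σ)))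

lemma leftMulL_apply (q : ℍ[ℝ]) (X : Dat B) : leftMulL B q X = leftMul B q X := rfl

lemma leftMul_skew (j : Fin 3) (X Y : Dat B) :
    ⟪leftMul B (unitQuat j) X, Y⟫_ℝ = -⟪leftMul B (unitQuat j) Y, X⟫_ℝ := by
  rw [dat_inner, dat_inner, neg_add, ← Finset.sum_neg_distrib, L2.inner_def, L2.inner_def,
    ← integral_neg]
  congr 1
  · refine integral_congr_ae ?_
    filter_upwards [leftMul_fst_ae (unitQuat j) X, leftMul_fst_ae (unitQuat j) Y] with s h1 h2
    rw [h1, h2, unitQuat_skew]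
  · exact Finset.sum_congr rfl fun σ _ => unitQuat_skew j _ _

lemma leftMulL_skew (j : Fin 3) (X Y : Dat B) :
    ⟪leftMulL B (unitQuat j) X, Y⟫_ℝ = -⟪leftMulL B (unitQuat j) Y, X⟫_ℝ := by
  rw [leftMulL_apply, leftMulL_apply, leftMul_skew]

variable [hν : Fact (Injective ν)]

/-- The metric of the hyperkähler quotient. -/
def moduliMetric (B : Bow k) (ν : Fin k → E3) [Fact (Injective ν)] :
    SmoothMetric (Moduli B ν) where
  inner m := mform B ν 1 m
  symm m u v := by
    refine (mform_apply 1 m u v).trans (Eq.trans ?_ (mform_apply 1 m v u).symm)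
    rw [ChartData.form_apply, ChartData.form_apply, one_mul, one_mul, real_inner_comm]
  pos m v hv := by
    refine lt_of_lt_of_eq ?_ (mform_apply 1 m v v).symm
    rw [ChartData.form_apply, one_mul]
    refine mul_pos (ChartData.den_pos _) (real_inner_self_pos.2 fun h => hv ?_)
    have h1 := (dataAt m).horInv_horL (B := B) (b := (dataAt m).mcoord m) (e.symm v)
    rw [h, map_zero] at h1
    exact (map_eq_zero_iff e.symm e.symm.injective).1 h1.symm
  -- The factor `1 + W |b|²` is at least `1`, so `horL` maps the unit ball of the metric into the
  -- ordinary unit ball, and the norm of its inverse bounds the former.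
  isVonNBounded m := by
    have h : {v : E4 | mform B ν 1 m v v < 1} ⊆ Metric.closedBall (0 : E4)
        ‖(dataAt m).horInv B ((dataAt m).mcoord m)‖ := by
      intro v hv
      rw [mem_ofPred_eq, mform_apply, ChartData.form_apply, one_mul, real_inner_self_eq_norm_sq] at hv
      set a := (dataAt m).horL B ((dataAt m).mcoord m) (e.symm v) with ha
      have h1 : ‖a‖ ^ 2 ≤ 1 := by
        have h2 := (dataAt m).pot_pos (B := B) (b := (dataAt m).mcoord m)
        nlinarith [sq_nonneg ‖a‖, mul_nonneg (mul_nonneg h2.le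
          (sq_nonneg ‖(dataAt m).mcoord m‖)) (sq_nonneg ‖a‖)]
      have h2 : ‖a‖ ≤ 1 := by nlinarith [norm_nonneg a]
      have h3 : ‖e.symm v‖ = ‖v‖ := Quaternion.linearIsometryEquivTuple.symm.norm_map v
      rw [mem_closedBall_zero_iff, ← h3, ← (dataAt m).horInv_horL (B := B)
        (b := (dataAt m).mcoord m) (e.symm v), ← ha]
      exact (ContinuousLinearMap.le_opNorm _ _).trans (mul_le_of_le_one_right (norm_nonneg _) h2)
    exact (NormedSpace.isVonNBounded_closedBall ℝ E4 _).subset h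
  contMDiff m := contMDiffAt_mform m 1

/-- The symplectic forms of the hyperkähler quotient. -/
def moduliForm (B : Bow k) (ν : Fin k → E3) [Fact (Injective ν)] (j : Fin 3) :
    BilinField (Moduli B ν) := mform B ν (unitQuat j)

variable {F : Type} [NormedAddCommGroup F] [NormedSpace ℝ F]

lemma moduliMetric_projDeriv {c : F → levelSet B ν} {x : F}
    (hc : ContDiffAt ℝ ∞ (fun y => (c y : Dat B)) x) (v w : F)
    (hv : fderiv ℝ (fun y => (c y : Dat B)) x v ∈ Horizontal B (c x)) :
    mform B ν 1 (proj B ν (c x)) (projDeriv B ν c x v) (projDeriv B ν c x w) =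
      ⟪fderiv ℝ (fun y => (c y : Dat B)) x v, fderiv ℝ (fun y => (c y : Dat B)) x w⟫_ℝ := by
  obtain ⟨H, hH⟩ := exists_isHorPart (isVel_fderiv hc v)
  obtain ⟨H', hH'⟩ := exists_isHorPart (isVel_fderiv hc w)
  rw [mform_projDeriv hc hH hH', hH.inner_eq hH' hv]

lemma moduliForm_projDeriv {c : F → levelSet B ν} {x : F}
    (hc : ContDiffAt ℝ ∞ (fun y => (c y : Dat B)) x) (v w : F) (j : Fin 3) :
    moduliForm B ν j (proj B ν (c x)) (projDeriv B ν c x v) (projDeriv B ν c x w) =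
      ⟪leftMul B (unitQuat j) (fderiv ℝ (fun y => (c y : Dat B)) x v),
        fderiv ℝ (fun y => (c y : Dat B)) x w⟫_ℝ := by
  obtain ⟨H, hH⟩ := exists_isHorPart (isVel_fderiv hc v)
  obtain ⟨H', hH'⟩ := exists_isHorPart (isVel_fderiv hc w)
  rw [moduliForm, mform_projDeriv hc hH hH', hH.inner_leftMul hH' (isVel_fderiv hc w).isTan]

/-! ### Local lifts and closedness of the two-forms -/

lemma form_congr {Ω : BilinField (Moduli B ν)} {φ : F → Moduli B ν} {c : F → levelSet B ν} {x : F}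
    (h : φ =ᶠ[𝓝 x] fun y => proj B ν (c y)) (u v : F) :
    Ω (φ x) (mfderiv 𝓘(ℝ, F) 𝓘(ℝ, E4) φ x u) (mfderiv 𝓘(ℝ, F) 𝓘(ℝ, E4) φ x v) =
      Ω (proj B ν (c x)) (projDeriv B ν c x u) (projDeriv B ν c x v) := by
  have h1 : φ x = proj B ν (c x) := h.self_of_nhds
  have h2 : (mfderiv 𝓘(ℝ, F) 𝓘(ℝ, E4) φ x : F →L[ℝ] E4) =
      (mfderiv 𝓘(ℝ, F) 𝓘(ℝ, E4) (fun y => proj B ν (c y)) x : F →L[ℝ] E4) := h.mfderiv_eq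
  -- The tangent spaces depend on the base point; treating all vectors as elements of `E4` allows
  -- the base point to be replaced.
  have h3 : ∀ (m m' : Moduli B ν) (a b a' b' : E4), m = m' → a = a' → b = b' →
      (Ω m (a : E4) (b : E4) : ℝ) = Ω m' (a' : E4) (b' : E4) := by
    rintro m _ a b _ _ rfl rfl rfl; rfl
  exact h3 _ _ _ _ _ _ h1 (congrArg (fun L : F →L[ℝ] E4 => L u) h2)
    (congrArg (fun L : F →L[ℝ] E4 => L v) h2)

/-- The slice of a chart around `φ x`, composed with `φ`. -/
lemma ContMDiffAt.exists_lift {φ : F → Moduli B ν} {x : F}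
    (hφ : ∀ᶠ y in 𝓝 x, ContMDiffAt 𝓘(ℝ, F) 𝓘(ℝ, E4) ∞ φ y) :
    ∃ c : F → levelSet B ν, ∀ᶠ y in 𝓝 x, ContDiffAt ℝ ∞ (fun y => (c y : Dat B)) y ∧
      φ =ᶠ[𝓝 y] fun y => proj B ν (c y) := by
  set C := dataAt (φ x) with hC
  have h0 : ∀ᶠ y in 𝓝 x, φ y ∈ (C.chart B).source :=
    hφ.self_of_nhds.continuousAt.eventually_mem ((C.chart B).open_source.mem_nhds (mem_dataAt _))
  refine ⟨fun y => C.liftN B (C.mcoord (φ y)), ?_⟩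
  filter_upwards [hφ, h0.eventually_nhds] with y h1 h2
  have hy : φ y ∈ (C.chart B).source := h2.self_of_nhds
  have h3 : ContMDiffAt 𝓘(ℝ, E4) 𝓘(ℝ, E4) ∞ (C.chart B) (φ y) :=
    contMDiffAt_extChartAt' (I := 𝓘(ℝ, E4)) (x := φ x) hy
  have h4 : ContDiffAt ℝ ∞ (fun y => C.mcoord (φ y)) y := by
    have h5 : ContDiffAt ℝ ∞ (fun y => e.symm (C.chart B (φ y))) y :=
      e.symm.contDiff.contDiffAt.comp y (h3.comp y h1).contDiffAt
    simp only [ChartData.chart_apply, ContinuousLinearEquiv.symm_apply_apply] at h5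
    exact h5
  refine ⟨?_, ?_⟩
  · refine ContDiffAt.comp (g := fun b => (C.liftN B b : Dat B)) y (C.contDiffAt_liftN ?_) h4
    rw [C.pt_mcoord hy]; exact hy
  · filter_upwards [h2] with y' hy'
    exact (C.proj_liftN_mcoord hy').symm

lemma contDiffAt_inner_fderiv {c : E4 → Dat B} {y : E4} (hc : ContDiffAt ℝ ∞ c y)
    (L : Dat B →L[ℝ] Dat B) (u v : E4) :
    ContDiffAt ℝ ∞ (fun y => ⟪L (fderiv ℝ c y u), fderiv ℝ c y v⟫_ℝ) y := by
  have hd := hc.fderiv_right (m := ∞) (by simp)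
  have h1 : ∀ u, ContDiffAt ℝ ∞ (fun y => fderiv ℝ c y u) y := fun u =>
    hd.clm_apply contDiffAt_const
  exact (ContDiffAt.comp (g := L) y L.contDiff.contDiffAt (h1 u)).inner ℝ (h1 v)

/-- The pullback of a constant skew form is closed: in the cyclic sum the terms with second
derivatives of `c` cancel in pairs, by symmetry of the second derivative and skewness of `L`. -/
lemma closed_of_skew {c : E4 → Dat B} {y : E4} (hc : ContDiffAt ℝ ∞ c y) (L : Dat B →L[ℝ] Dat B)
    (hL : ∀ a b, ⟪L a, b⟫_ℝ = -⟪L b, a⟫_ℝ) (u v w : E4) :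
    fderiv ℝ (fun y => ⟪L (fderiv ℝ c y v), fderiv ℝ c y w⟫_ℝ) y u +
    fderiv ℝ (fun y => ⟪L (fderiv ℝ c y w), fderiv ℝ c y u⟫_ℝ) y v +
    fderiv ℝ (fun y => ⟪L (fderiv ℝ c y u), fderiv ℝ c y v⟫_ℝ) y w = 0 := by
  have hd : HasFDerivAt (fderiv ℝ c) (fderiv ℝ (fderiv ℝ c) y) y :=
    ((hc.fderiv_right (m := ∞) (by simp)).differentiableAt (by simp)).hasFDerivAt
  have hv : ∀ v, HasFDerivAt (fun y => fderiv ℝ c y v)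
      ((fderiv ℝ (fderiv ℝ c) y).flip v) y := fun v => by
    simpa using hd.clm_apply (hasFDerivAt_const v y)
  have key : ∀ v w u, fderiv ℝ (fun y => ⟪L (fderiv ℝ c y v), fderiv ℝ c y w⟫_ℝ) y u =
      ⟪L (fderiv ℝ c y v), fderiv ℝ (fderiv ℝ c) y u w⟫_ℝ +
        ⟪L (fderiv ℝ (fderiv ℝ c) y u v), fderiv ℝ c y w⟫_ℝ := by
    intro v w u
    have h1 : HasFDerivAt (fun y => L (fderiv ℝ c y v))
        (L.comp ((fderiv ℝ (fderiv ℝ c) y).flip v)) y := L.hasFDerivAt.comp y (hv v)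
    rw [(h1.inner ℝ (hv w)).fderiv]
    simp
  have hs : IsSymmSndFDerivAt ℝ c y := hc.isSymmSndFDerivAt (by simpa using ENat.LEInfty.out)
  rw [key, key, key, hL (fderiv ℝ (fderiv ℝ c) y u v), hL (fderiv ℝ (fderiv ℝ c) y v w),
    hL (fderiv ℝ (fderiv ℝ c) y w u), hs u v, hs v w, hs w u]
  ring

lemma moduliForm_mfderiv {φ : F → Moduli B ν} {c : F → levelSet B ν} {x : F}
    (hc : ContDiffAt ℝ ∞ (fun y => (c y : Dat B)) x) (h : φ =ᶠ[𝓝 x] fun y => proj B ν (c y))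
    (u v : F) (j : Fin 3) :
    moduliForm B ν j (φ x) (mfderiv 𝓘(ℝ, F) 𝓘(ℝ, E4) φ x u) (mfderiv 𝓘(ℝ, F) 𝓘(ℝ, E4) φ x v) =
      ⟪leftMulL B (unitQuat j) (fderiv ℝ (fun y => (c y : Dat B)) x u),
        fderiv ℝ (fun y => (c y : Dat B)) x v⟫_ℝ := by
  rw [form_congr (Ω := moduliForm B ν j) h u v, moduliForm_projDeriv hc u v j, leftMulL_apply]

/-- Locally the pullback by `φ` is the pullback of the flat form by a lift of `φ`, so nothing has to
be differentiated in the charts. -/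
lemma isClosedTwoForm_moduliForm (j : Fin 3) : IsClosedTwoForm (moduliForm B ν j) := by
  refine ⟨fun m u v => ?_, fun O φ hO hφ => ?_⟩
  · refine (mform_apply _ m u v).trans (Eq.trans ?_ (congrArg Neg.neg (mform_apply _ m v u).symm))
    rw [ChartData.form_apply, ChartData.form_apply, unitQuat_skew, mul_neg]
  · intro pb
    have key : ∀ y ∈ O, ∃ c : E4 → levelSet B ν, ContDiffAt ℝ ∞ (fun y => (c y : Dat B)) y ∧
        ∀ u v, pb u v =ᶠ[𝓝 y] fun y => ⟪leftMulL B (unitQuat j)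
          (fderiv ℝ (fun y => (c y : Dat B)) y u), fderiv ℝ (fun y => (c y : Dat B)) y v⟫_ℝ := by
      intro y hy
      have h1 : ∀ᶠ y in 𝓝 y, ContMDiffAt 𝓘(ℝ, E4) 𝓘(ℝ, E4) ∞ φ y := by
        filter_upwards [hO.mem_nhds hy] with y' hy' using hφ.contMDiffAt (hO.mem_nhds hy')
      obtain ⟨c, hc⟩ := ContMDiffAt.exists_lift h1
      refine ⟨c, hc.self_of_nhds.1, fun u v => ?_⟩
      filter_upwards [hc] with y' hy'
      exact moduliForm_mfderiv hy'.1 hy'.2 u v j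
    refine ⟨fun u v y hy => ?_, fun y hy u v w => ?_⟩
    · obtain ⟨c, hc, h⟩ := key y hy
      refine (ContDiffAt.congr_of_eventuallyEq ?_ (h u v)).contDiffWithinAt
      exact contDiffAt_inner_fderiv hc _ u v
    · obtain ⟨c, hc, h⟩ := key y hy
      rw [(h v w).fderiv_eq, (h w u).fderiv_eq, (h u v).fderiv_eq]
      exact closed_of_skew hc (leftMulL B (unitQuat j)) (leftMulL_skew j) u v w

/-- The complex structures are the `e_j` conjugated by `horL`; the quaternion relations are then
inherited, and both metric and forms have the shape `(1 + W |b|²) ⟪q horL ·, horL ·⟫`. -/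
theorem isHyperkahler_moduli : IsHyperkahler (moduliMetric B ν) (moduliForm B ν) := by
  refine ⟨isClosedTwoForm_moduliForm, fun j m => (e : ℍ[ℝ] →L[ℝ] E4).comp
    (((dataAt m).horInv B ((dataAt m).mcoord m)).comp
      ((ContinuousLinearMap.mul ℝ ℍ[ℝ] (unitQuat j)).comp
        (((dataAt m).horL B ((dataAt m).mcoord m)).comp (e.symm : E4 →L[ℝ] ℍ[ℝ])))), ?_, ?_, ?_⟩
  · intro j m u v
    change (dataAt m).form B 1 _ (e.symm (e ((dataAt m).horInv B _ (unitQuat j *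
      (dataAt m).horL B _ (e.symm u))))) (e.symm v) = (dataAt m).form B (unitQuat j) _ _ _
    rw [ContinuousLinearEquiv.symm_apply_apply, ChartData.form_apply, ChartData.form_apply,
      ChartData.horL_horInv, one_mul]
    rfl
  · intro j m u
    change e ((dataAt m).horInv B _ (unitQuat j * (dataAt m).horL B _ (e.symm (e
      ((dataAt m).horInv B _ (unitQuat j * (dataAt m).horL B _ (e.symm u))))))) = -u
    rw [ContinuousLinearEquiv.symm_apply_apply, ChartData.horL_horInv, unitQuat_mul_self, map_neg,
      map_neg, ChartData.horInv_horL]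
    exact congrArg Neg.neg (e.apply_symm_apply u)
  · intro m u
    change e ((dataAt m).horInv B _ (unitQuat 0 * (dataAt m).horL B _ (e.symm (e
      ((dataAt m).horInv B _ (unitQuat 1 * (dataAt m).horL B _ (e.symm u))))))) =
      e ((dataAt m).horInv B _ (unitQuat 2 * (dataAt m).horL B _ (e.symm u)))
    rw [ContinuousLinearEquiv.symm_apply_apply, ChartData.horL_horInv, unitQuat_zero_mul_one]

end Quotient

end

section

/-! ### The projection to the moduli space -/

section Submersion

open ChartData (e)

variable {k : ℕ} {B : Bow k} [NeZero k] {ν : Fin k → E3}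

lemma hasDerivAt_exp_I {d : ℝ → ℝ} {d' r : ℝ} (hd : HasDerivAt d d' r) :
    HasDerivAt (fun r => Complex.exp (Complex.I * (d r : ℂ)))
      (Complex.exp (Complex.I * (d r : ℂ)) * (Complex.I * (d' : ℂ))) r :=
  (hd.ofReal_comp.const_mul Complex.I).cexp

lemma ContDiffAt.rsmul {F : Type*} [NormedAddCommGroup F] [NormedSpace ℝ F] {b : F → ℍ[ℝ]}
    {z : F → ℂ} {x : F} (hb : ContDiffAt ℝ ∞ b x) (hz : ContDiffAt ℝ ∞ z x) :
    ContDiffAt ℝ ∞ (fun y => rsmul (b y) (z y)) x := by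
  have h1 : ContDiff ℝ ∞ (fun a : ℍ[ℝ] × ℂ => SmallBow.rsmul a.1 a.2) :=
    ContinuousLinearMap.isBoundedBilinearMap (E := ℍ[ℝ]) (F := ℂ) (G := ℍ[ℝ]) rsmulL |>.contDiff
  exact h1.contDiffAt.comp x (hb.prodMk hz)

lemma contDiffAt_exp_I {F : Type*} [NormedAddCommGroup F] [NormedSpace ℝ F] {d : F → ℝ}
    {x : F} (hd : ContDiffAt ℝ ∞ d x) :
    ContDiffAt ℝ ∞ (fun y => Complex.exp (Complex.I * (d y : ℂ))) x :=
  (contDiffAt_const.mul (Complex.ofRealCLM.contDiff.contDiffAt.comp x hd)).cexp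

lemma contDiffAt_shift {F : Type*} [NormedAddCommGroup F] [NormedSpace ℝ F]
    {h : F → Lp ℍ[ℝ] 2 B.vol} {d : F → Fin k → ℝ} {c : F → Dat B} {x : F}
    (hh : ContDiffAt ℝ ∞ h x) (hd : ∀ σ, ContDiffAt ℝ ∞ (fun y => d y σ) x)
    (hc : ContDiffAt ℝ ∞ c x) : ContDiffAt ℝ ∞ (fun y => shift (h y) (d y) (c y)) x :=
  contDiffAt_mkDat (((fstL B).contDiff.contDiffAt.comp x hc).add hh) fun σ =>
    ContDiffAt.rsmul ((contDiff_snd σ).contDiffAt.comp x hc) (contDiffAt_exp_I (hd σ))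

lemma hasDerivAt_shift {h : ℝ → Lp ℍ[ℝ] 2 B.vol} {d : ℝ → Fin k → ℝ} {c : ℝ → Dat B} {r : ℝ}
    {h' : Lp ℍ[ℝ] 2 B.vol} {d' : Fin k → ℝ} {X : Dat B} (hh : HasDerivAt h h' r)
    (hd : ∀ σ, HasDerivAt (fun r => d r σ) (d' σ) r) (hc : HasDerivAt c X r) :
    HasDerivAt (fun r => shift (h r) (d r) (c r)) (mkDat (X.fst + h', fun σ =>
      rsmul (X.snd σ) (Complex.exp (Complex.I * (d r σ : ℂ))) +
        d' σ • ((shift (h r) (d r) (c r)).snd σ * unitQuat 0))) r := by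
  refine hasDerivAt_mkDat ((HasDerivAt.clm hc (fstL B)).add hh) fun σ => ?_
  have h1 := (HasDerivAt.clm (F := ℂ →L[ℝ] ℍ[ℝ]) (HasDerivAt.clm hc (sndL B σ)) rsmulL).clm_apply
    (hasDerivAt_exp_I (hd σ))
  refine h1.congr_deriv ?_
  simp only [rsmulL_apply, sndL_apply, shift_snd]
  rw [← rsmul_rsmul, rsmul_I_real]

variable [hν : Fact (Injective ν)]

lemma ChartData.contMDiffAt_mcoord (C : ChartData ν) {m : Moduli B ν} (hm : m.toE3 ∈ C.U) :
    ContMDiffAt 𝓘(ℝ, E4) 𝓘(ℝ, ℍ[ℝ]) ∞ C.mcoord m := by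
  have h1 : C.chart B ∈ IsManifold.maximalAtlas 𝓘(ℝ, E4) ∞ (Moduli B ν) :=
    IsManifold.subset_maximalAtlas (mem_range_self C)
  have h2 : ContMDiffAt 𝓘(ℝ, E4) 𝓘(ℝ, E4) ∞ (C.chart B) m :=
    contMDiffAt_of_mem_maximalAtlas h1 hm
  have h3 : (C.mcoord : Moduli B ν → ℍ[ℝ]) = e.symm ∘ C.chart B := by
    funext m
    rw [comp_apply, C.chart_apply, ContinuousLinearEquiv.symm_apply_apply]
  rw [h3]
  exact e.symm.contDiff.contDiffAt.contMDiffAt.comp m h2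

/-- The slice of a chart meets the orbit of `x`, and the shift that carries the meeting point to `x`
carries the slice to a section through `x`. -/
lemma exists_local_section (x : levelSet B ν) : ∃ s : Moduli B ν → levelSet B ν,
    s (proj B ν x) = x ∧ (∀ᶠ m in 𝓝 (proj B ν x), proj B ν (s m) = m) ∧
    ContMDiffAt 𝓘(ℝ, E4) 𝓘(ℝ, Dat B) ∞ (fun m => (s m : Dat B)) (proj B ν x) := by
  obtain ⟨C, hC⟩ := exists_chartData hν.out (tval ν (x : Dat B))
  obtain ⟨θ, hθ⟩ := C.gaugeRel_lift_coord x.2 hC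
  obtain ⟨h1, h2, hs⟩ := hθ.eq_shift
  set h := (x : Dat B).fst - (C.lift B (C.coord (x : Dat B))).fst with hh
  refine ⟨fun m => ⟨shift h θ (C.lift B (C.mcoord m)), shift_mem h2 C.lift_mem⟩,
    Subtype.ext h1.symm, ?_, ?_⟩
  · have h3 : ∀ᶠ m in 𝓝 (proj B ν x), m.toE3 ∈ C.U :=
      Moduli.continuous_toE3.continuousAt.eventually_mem (C.frame.isOpen.mem_nhds hC)
    filter_upwards [h3] with m hm
    refine Eq.trans ?_ (C.proj_liftN_mcoord hm)
    exact (proj_eq_iff.2 ⟨θ, gaugeRel_shift h2 hs⟩).symm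
  · have h4 : ContDiffAt ℝ ∞ (fun b => shift h θ (C.lift B b)) (C.mcoord (proj B ν x)) :=
      contDiffAt_shift contDiffAt_const (fun σ => contDiffAt_const) (C.contDiffAt_lift (by
        rw [C.pt_mcoord (m := proj B ν x) hC]; exact hC))
    exact h4.contMDiffAt.comp (proj B ν x) (C.contMDiffAt_mcoord hC)

/-- A straight line in the slice, shifted so as to pass through `x`, has some velocity `X` with
vertical part `X - H`. Subtracting `r` times this vertical part from the parameters of the shift
moves the curve only inside the orbits, so its coordinates are unchanged, and makes the velocity
`H`. -/
lemma exists_horizontal_lift (x : levelSet B ν) (u : TangentSpace 𝓘(ℝ, E4) (proj B ν x)) :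
    ∃ c : ℝ → levelSet B ν, c 0 = x ∧ ContDiffAt ℝ ∞ (fun r => (c r : Dat B)) 0 ∧
      deriv (fun r => (c r : Dat B)) 0 ∈ Horizontal B x ∧ projDeriv B ν c 0 1 = u := by
  set C := dataAt (proj B ν x) with hCdef
  have hC : tval ν (x : Dat B) ∈ C.U := mem_dataAt (proj B ν x)
  set b := C.coord (x : Dat B) with hb
  set β : ℍ[ℝ] := e.symm u with hβ
  have hpt : C.pt b ∈ C.U := by rw [hb, C.pt_coord x.2 hC]; exact hC
  obtain ⟨θ, hθ⟩ := C.gaugeRel_lift_coord x.2 hC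
  obtain ⟨h1, h2, hs⟩ := hθ.eq_shift
  set h := (x : Dat B).fst - (C.lift B b).fst with hh
  have hline : HasDerivAt (fun r : ℝ => b + r • β) β 0 := by
    simpa using ((hasDerivAt_id (0 : ℝ)).smul_const β).const_add b
  have hline' : ContDiffAt ℝ ∞ (fun r : ℝ => b + r • β) 0 :=
    contDiffAt_const.add (contDiffAt_id.smul contDiffAt_const)
  have hlift : ContDiffAt ℝ ∞ (fun r : ℝ => C.lift B (b + r • β)) 0 := by
    have h3 : ContDiffAt ℝ ∞ (C.lift B) (b + (0 : ℝ) • β) := by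
      simpa using C.contDiffAt_lift hpt
    exact ContDiffAt.comp (g := C.lift B) 0 h3 hline'
  obtain ⟨Y, hY⟩ : ∃ Y, HasDerivAt (fun r : ℝ => C.lift B (b + r • β)) Y 0 :=
    ⟨_, (hlift.differentiableAt (by simp)).hasDerivAt⟩
  have hX := hasDerivAt_shift (hasDerivAt_const (0 : ℝ) h)
    (fun σ => hasDerivAt_const (0 : ℝ) (θ σ)) hY
  set X := mkDat (Y.fst + 0, fun σ =>
      rsmul (Y.snd σ) (Complex.exp (Complex.I * (θ σ : ℂ))) +
        (0 : ℝ) • ((shift h θ (C.lift B (b + (0 : ℝ) • β))).snd σ * unitQuat 0)) with hXdef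
  have h0 : C.lift B (b + (0 : ℝ) • β) = C.lift B b := by simp
  have hvel : IsVel ν (x : Dat B) X := by
    refine ⟨fun r => shift h θ (C.lift B (b + r • β)), fun r => shift_mem h2 C.lift_mem, ?_, ?_, hX⟩
    · simp only [h0]; exact h1.symm
    · exact contDiffAt_shift contDiffAt_const (fun σ => contDiffAt_const) hlift
  obtain ⟨H, ⟨κ, hH⟩, d, hd⟩ := exists_isHorPart hvel
  have hmem : ∀ r : ℝ, imPart B (h - r • (X - H).fst) = 0 := fun r => by
    rw [map_sub, map_smul, h2, hd.im, smul_zero, sub_zero]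
  have hsum : ∀ r : ℝ, ∑ σ, (θ - r • d) σ + primL B B.l (mkDat (h - r • (X - H).fst, 0)) = 0 := by
    intro r
    have h3 : mkDat (h - r • (X - H).fst, 0) = mkDat (h, 0) - r • mkDat ((X - H).fst, 0) := by
      rw [← map_smul, ← map_sub]
      congr 1
      simp
    have h4 := hd.sum
    rw [primL_congr (x := X - H) (y := mkDat ((X - H).fst, 0)) rfl] at h4
    rw [h3, map_sub, map_smul]
    simp only [Pi.sub_apply, Pi.smul_apply, Finset.sum_sub_distrib, smul_eq_mul, ← Finset.mul_sum]
    linear_combination hs - r * h4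
  set c : ℝ → levelSet B ν := fun r =>
    ⟨shift (h - r • (X - H).fst) (θ - r • d) (C.lift B (b + r • β)),
      shift_mem (hmem r) C.lift_mem⟩ with hc
  have hc0 : c 0 = x := by
    apply Subtype.ext
    simp only [hc, h0]
    rw [zero_smul, zero_smul, sub_zero, sub_zero]
    exact h1.symm
  have hcs : ContDiffAt ℝ ∞ (fun r => (c r : Dat B)) 0 := by
    refine contDiffAt_shift (contDiffAt_const.sub (contDiffAt_id.smul contDiffAt_const))
      (fun σ => ?_) hlift
    exact contDiffAt_const.sub (contDiffAt_id.mul contDiffAt_const)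
  refine ⟨c, hc0, hcs, ?_, ?_⟩
  · have h5 : HasDerivAt (fun r : ℝ => h - r • (X - H).fst) (-(X - H).fst) 0 := by
      simpa using ((hasDerivAt_id (0 : ℝ)).smul_const (X - H).fst).const_sub h
    have h6 : ∀ σ, HasDerivAt (fun r : ℝ => (θ - r • d) σ) ((-d) σ) 0 := fun σ => by
      simpa using ((hasDerivAt_id (0 : ℝ)).mul_const (d σ)).const_sub (θ σ)
    have h7 := hasDerivAt_shift h5 h6 hY
    have h8 : deriv (fun r => (c r : Dat B)) 0 = H := by
      refine h7.deriv.trans (Dat.ext_iff'.2 ⟨?_, fun σ => ?_⟩)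
      · rw [mkDat_fst, sub_fst, hXdef, mkDat_fst]
        abel
      · have h9 := hd.snd σ
        rw [sub_snd, hXdef, mkDat_snd, zero_smul, add_zero] at h9
        rw [mkDat_snd, h0, zero_smul, zero_smul, sub_zero, sub_zero, ← h1, Pi.neg_apply, neg_smul,
          ← h9]
        abel
    rw [h8]
    exact hH.mem_horizontal
  · refine (projDeriv_eq hcs 1).trans ?_
    rw [hc0, ← hCdef]
    have h10 : HasDerivAt (fun r => C.coord (c r : Dat B)) β 0 := by
      refine hline.congr_of_eventuallyEq ?_
      have h11 : ∀ᶠ r : ℝ in 𝓝 0, C.pt (b + r • β) ∈ C.U :=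
        hline.continuousAt.eventually_mem (C.isOpen_target.mem_nhds (by simpa using hpt))
      filter_upwards [h11] with r hr
      rw [C.coord_gauge (gaugeRel_shift (hmem r) (hsum r)), C.coord_lift hr]
    rw [fderiv_apply_one_eq_deriv, h10.deriv, hβ]
    exact e.apply_symm_apply u

theorem isHyperkahlerQuotient_moduli :
    IsHyperkahlerQuotient B ν (moduliMetric B ν) (moduliForm B ν) where
  smooth_proj _ _ _ _ _ hc := contMDiffAt_proj_comp hc
  local_section := exists_local_section
  horizontal_lift := exists_horizontal_lift
  metric_eq _ _ _ _ _ hc v w hv := moduliMetric_projDeriv hc v w hv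
  form_eq _ _ _ _ _ hc v w j := moduliForm_projDeriv hc v w j

end Submersion

end

section

/-! ### The circle action -/

section Action

open ChartData (e)

variable {k : ℕ} {B : Bow k} [NeZero k] {ν : Fin k → E3}

/-- Shifts with equal imaginary parts and equal totals agree modulo gauge transformations. -/
lemma gaugeRel_shift_shift {x y : Dat B} {θ : Fin k → ℝ} (hxy : GaugeRel x y θ)
    {h h' : Lp ℍ[ℝ] 2 B.vol} {d d' : Fin k → ℝ} (hh : imPart B h = imPart B h')
    (hd : ∑ σ, d' σ + primL B B.l (mkDat (h', 0)) = ∑ σ, d σ + primL B B.l (mkDat (h, 0))) :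
    GaugeRel (shift h d x) (shift h' d' y) (θ + d' - d) where
  im := by rw [shift_fst, shift_fst, map_add, map_add, hxy.im, hh]
  snd σ := by
    rw [shift_snd, shift_snd, hxy.snd, rsmul_rsmul, rsmul_rsmul, ← Complex.exp_add,
      ← Complex.exp_add]
    congr 2
    simp only [Pi.add_apply, Pi.sub_apply]
    push_cast; ring
  sum := by
    have h1 := hxy.sum
    simp only [Pi.add_apply, Pi.sub_apply, Finset.sum_add_distrib, Finset.sum_sub_distrib]
    rw [primL_shift, primL_shift]
    linarith

lemma coe_exp_inv (ε : ℝ) :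
    (((Circle.exp ε)⁻¹ : Circle) : ℂ) = Complex.exp (Complex.I * ((-ε : ℝ) : ℂ)) := by
  rw [← Circle.exp_neg, Circle.coe_exp, mul_comm]

lemma rotate_eq (σ : Fin k) (ε : ℝ) (x : Dat B) :
    rotate B σ (Circle.exp ε) x = shift 0 (Pi.single σ (-ε)) x := by
  refine Dat.ext_iff'.2 ⟨by simp [rotate], fun ρ => ?_⟩
  rw [shift_snd, rotate, coe_exp_inv]
  by_cases h : ρ = σ
  · subst h; simp
  · simp [h]

lemma exists_exp_eq (z : Circle) : ∃ ε : ℝ, Circle.exp ε = z := ⟨_, Circle.exp_arg z⟩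

lemma rotate_mem (σ : Fin k) (z : Circle) {x : Dat B} (hx : x ∈ levelSet B ν) :
    rotate B σ z x ∈ levelSet B ν := by
  obtain ⟨ε, rfl⟩ := exists_exp_eq z
  rw [rotate_eq]
  exact shift_mem (map_zero _) hx

/-- The circle action on the moduli space. -/
def Moduli.act (z : Circle) (m : Moduli B ν) : Moduli B ν :=
  Quot.lift (fun x : levelSet B ν => proj B ν ⟨rotate B 0 z x, rotate_mem 0 z x.2⟩) (by
    rintro x y ⟨g, hg, hxy⟩
    obtain ⟨θ, hθ, -⟩ := exists_gaugeRel hg hxy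
    obtain ⟨ε, rfl⟩ := exists_exp_eq z
    refine proj_eq_iff.2 ⟨θ + Pi.single 0 (-ε) - Pi.single 0 (-ε), ?_⟩
    simp only [rotate_eq]
    exact gaugeRel_shift_shift hθ rfl rfl) m

/-- Rotating `b_σ` instead of `b_0` differs by the gauge transformation with opposite jumps at the
two cuts. -/
lemma act_proj (σ : Fin k) (ε : ℝ) (x : levelSet B ν) :
    Moduli.act (Circle.exp ε) (proj B ν x) =
      proj B ν ⟨shift 0 (Pi.single σ (-ε)) x, shift_mem (map_zero _) x.2⟩ := by
  refine proj_eq_iff.2 ⟨0 + Pi.single σ (-ε) - Pi.single 0 (-ε), ?_⟩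
  simp only [rotate_eq]
  exact gaugeRel_shift_shift GaugeRel.refl rfl (by simp)

lemma act_proj_rotate (σ : Fin k) (z : Circle) (x : levelSet B ν) :
    Moduli.act z (proj B ν x) = proj B ν ⟨rotate B σ z x, rotate_mem σ z x.2⟩ := by
  obtain ⟨ε, rfl⟩ := exists_exp_eq z
  rw [act_proj σ]
  simp only [rotate_eq]

lemma toE3_act (z : Circle) (m : Moduli B ν) : (Moduli.act z m).toE3 = m.toE3 := by
  obtain ⟨x, rfl⟩ := proj_surjective m
  obtain ⟨ε, rfl⟩ := exists_exp_eq z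
  rw [act_proj 0]
  exact tval_shift

/-- The action is realized on the component that serves as coordinate, which leaves the other phases
and `hol` alone. -/
lemma ChartData.mcoord_act (C : ChartData ν) (z : Circle) (m : Moduli B ν) :
    C.mcoord (Moduli.act z m) = rsmul (C.mcoord m) ((z⁻¹ : Circle) : ℂ) := by
  obtain ⟨x, rfl⟩ := proj_surjective m
  obtain ⟨ε, rfl⟩ := exists_exp_eq z
  rw [act_proj C.σ, mcoord_proj, mcoord_proj, coe_exp_inv]
  have h1 : hol ν C.s B.l C.q (shift 0 (Pi.single C.σ (-ε)) (x : Dat B)) =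
      hol ν C.s B.l C.q (x : Dat B) := by
    rw [hol, hol, tval_shift, primL_congr (y := (x : Dat B)) (by simp)]
    congr 1
    refine Finset.prod_congr rfl fun ρ hρ => ?_
    rw [shift_snd, Pi.single_eq_of_ne (Finset.ne_of_mem_erase hρ)]
    simp
  rw [coord, coord, h1, shift_snd, Pi.single_eq_same, rsmul_rsmul, rsmul_rsmul, mul_comm]

lemma act_one (m : Moduli B ν) : Moduli.act 1 m = m := by
  obtain ⟨x, rfl⟩ := proj_surjective m
  rw [← Circle.exp_zero, act_proj 0]
  congr 1
  apply Subtype.ext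
  exact Dat.ext_iff'.2 ⟨by simp, fun σ => by simp⟩

lemma act_mul (z w : Circle) (m : Moduli B ν) :
    Moduli.act (z * w) m = Moduli.act z (Moduli.act w m) := by
  obtain ⟨x, rfl⟩ := proj_surjective m
  obtain ⟨ε, rfl⟩ := exists_exp_eq z
  obtain ⟨δ, rfl⟩ := exists_exp_eq w
  rw [← Circle.exp_add, act_proj 0, act_proj 0, act_proj 0]
  congr 1
  apply Subtype.ext
  refine Dat.ext_iff'.2 ⟨by simp, fun σ => ?_⟩
  simp only [shift_snd, rsmul_rsmul, ← Complex.exp_add]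
  congr 2
  by_cases h : σ = 0
  · subst h; simp; ring
  · simp [h]

/-- Over the same `t` the imaginary parts agree and the `b_σ` differ by phases; the only obstruction
to gauge equivalence is the total `a`, which a rotation by `-a` removes. -/
lemma toE3_eq_iff (m m' : Moduli B ν) : m.toE3 = m'.toE3 ↔ ∃ z, Moduli.act z m = m' := by
  constructor
  · obtain ⟨x, rfl⟩ := proj_surjective m
    obtain ⟨y, rfl⟩ := proj_surjective m'
    intro h
    have h : tval ν (x : Dat B) = tval ν (y : Dat B) := h
    have h1 : ∀ σ, ∃ θ : ℝ, (y : Dat B).snd σ =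
        rsmul ((x : Dat B).snd σ) (Complex.exp (Complex.I * (θ : ℂ))) := fun σ =>
      exists_norm_one_rsmul (by
        rw [(mem_levelSet_iff.1 x.2).2, (mem_levelSet_iff.1 y.2).2, h])
    choose θ hθ using h1
    set a := ∑ σ, θ σ + (primL B B.l (y : Dat B) - primL B B.l (x : Dat B)) with ha
    refine ⟨Circle.exp (-a), ?_⟩
    rw [act_proj 0]
    refine proj_eq_iff.2 ⟨θ - Pi.single 0 a, ?_, fun σ => ?_, ?_⟩
    · rw [shift_fst, add_zero, (mem_levelSet_iff.1 x.2).1, (mem_levelSet_iff.1 y.2).1, h]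
    · rw [shift_snd, rsmul_rsmul, ← Complex.exp_add, hθ]
      congr 2
      simp only [Pi.sub_apply, neg_neg]
      push_cast; ring
    · rw [primL_congr (x := shift 0 (Pi.single 0 (- -a)) (x : Dat B)) (y := (x : Dat B)) (by simp)]
      simp only [Pi.sub_apply, Finset.sum_sub_distrib, Finset.sum_pi_single', Finset.mem_univ,
        if_true]
      linarith
  · rintro ⟨z, rfl⟩
    exact (toE3_act z m).symm

/-- Over `ν_σ` the component `b_σ` is zero, and rotating that one does nothing. -/
lemma act_fixed {m : Moduli B ν} (hm : m.toE3 ∈ range ν) (z : Circle) : Moduli.act z m = m := by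
  obtain ⟨x, rfl⟩ := proj_surjective m
  obtain ⟨ε, rfl⟩ := exists_exp_eq z
  obtain ⟨σ, hσ⟩ := hm
  have h0 : (x : Dat B).snd σ = 0 := by
    rw [← hopf_eq_zero, (mem_levelSet_iff.1 x.2).2, sub_eq_zero, hσ]
    rfl
  rw [act_proj σ]
  congr 1
  apply Subtype.ext
  refine Dat.ext_iff'.2 ⟨by simp, fun ρ => ?_⟩
  by_cases h : ρ = σ
  · subst h; rw [shift_snd, h0]; simp [rsmul]
  · simp [h]

lemma toE3_surjective (hν : Injective ν) : Surjective (Moduli.toE3 : Moduli B ν → E3) := by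
  intro t
  obtain ⟨C, -⟩ := exists_chartData hν t
  obtain ⟨b, hb⟩ := hopf_surjective (t - ν C.σ)
  refine ⟨proj B ν (C.liftN B b), ?_⟩
  rw [C.toE3_proj_liftN, ChartData.pt, hb, sub_add_cancel]

variable [hν : Fact (Injective ν)]

lemma act_free {m : Moduli B ν} (hm : m.toE3 ∉ range ν) {z : Circle} (hz : Moduli.act z m = m) :
    z = 1 := by
  set C := dataAt m with hC
  have h1 := C.mcoord_act z m
  rw [hz] at h1
  have h0 : C.mcoord m ≠ 0 := by
    intro h
    have h2 := C.pt_mcoord (mem_dataAt m)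
    rw [h, ChartData.pt, hopf_eq_zero.2 rfl, zero_add] at h2
    exact hm ⟨_, h2⟩
  have h2 : rsmul (C.mcoord m) (((z⁻¹ : Circle) : ℂ) - 1) = 0 := by
    rw [sub_eq_add_neg, rsmul_add, ← h1, show (-1 : ℂ) = ((-1 : ℝ) : ℂ) by simp, rsmul_real]
    simp
  have h3 : ((z⁻¹ : Circle) : ℂ) - 1 = 0 := by
    by_contra h
    exact h0 ((rsmul_eq_zero h).1 h2)
  have h4 : z⁻¹ = 1 := Circle.ext (by simpa [sub_eq_zero] using h3)
  rwa [inv_eq_one] at h4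

/-! ### Topology of the moduli space and smoothness of the action -/

/-- Points over different `t` are separated in `ℝ³`; points over the same `t` lie in a common chart.
-/
instance : T2Space (Moduli B ν) := by
  refine ⟨fun m m' hmm => ?_⟩
  by_cases h : m.toE3 = m'.toE3
  · set C := dataAt m with hC
    have h1 : m ∈ (C.chart B).source := mem_dataAt m
    have h2 : m' ∈ (C.chart B).source := by
      change m'.toE3 ∈ C.U
      rw [← h]; exact mem_dataAt m
    have h3 : C.chart B m ≠ C.chart B m' := fun h => hmm ((C.chart B).injOn h1 h2 h)
    obtain ⟨u, v, hu, hv, hmu, hmv, huv⟩ := t2_separation h3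
    exact ⟨_, _, (C.chart B).isOpen_inter_preimage hu, (C.chart B).isOpen_inter_preimage hv,
      ⟨h1, hmu⟩, ⟨h2, hmv⟩, (huv.preimage _).mono inter_subset_right inter_subset_right⟩
  · obtain ⟨u, v, hu, hv, hmu, hmv, huv⟩ := t2_separation h
    exact ⟨_, _, hu.preimage Moduli.continuous_toE3, hv.preimage Moduli.continuous_toE3, hmu, hmv,
      huv.preimage _⟩

instance : SecondCountableTopology (Moduli B ν) := by
  obtain ⟨T, hT, h⟩ := TopologicalSpace.isOpen_iUnion_countable
    (fun m : Moduli B ν => (dataAt m).U) fun m => (dataAt m).frame.isOpen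
  refine ChartedSpace.secondCountable_of_countable_cover E4 (s := T) ?_ hT
  refine eq_univ_of_forall fun m => ?_
  have h1 : m.toE3 ∈ ⋃ m ∈ T, (dataAt m).U := by
    rw [h]; exact mem_iUnion.2 ⟨m, mem_dataAt m⟩
  obtain ⟨m', hm', h2⟩ := mem_iUnion₂.1 h1
  exact mem_iUnion₂.2 ⟨m', hm', h2⟩

lemma contMDiff_toE3 : ContMDiff 𝓘(ℝ, E4) 𝓘(ℝ, E3) ∞ (Moduli.toE3 : Moduli B ν → E3) := by
  intro m
  have h1 := (dataAt m).contMDiffAt_mcoord (mem_dataAt m)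
  have h2 := ((dataAt m).contDiff_pt.contDiffAt (x := (dataAt m).mcoord m)).contMDiffAt.comp m h1
  refine h2.congr_of_eventuallyEq ?_
  filter_upwards [Moduli.continuous_toE3.continuousAt.eventually_mem
    ((dataAt m).frame.isOpen.mem_nhds (mem_dataAt m))] with m' hm'
  exact ((dataAt m).pt_mcoord hm').symm

lemma ChartData.act_eq (C : ChartData ν) (z : Circle) {m : Moduli B ν} (hm : m.toE3 ∈ C.U) :
    Moduli.act z m = proj B ν (C.liftN B (rsmul (C.mcoord m) ((z⁻¹ : Circle) : ℂ))) := by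
  rw [← C.mcoord_act, C.proj_liftN_mcoord]
  rwa [toE3_act]

lemma contMDiff_act : ContMDiff (𝓘(ℝ, ℝ).prod 𝓘(ℝ, E4)) 𝓘(ℝ, E4) ∞
    (fun q : ℝ × Moduli B ν => Moduli.act (Circle.exp q.1) q.2) := by
  rintro ⟨ε, m⟩
  set C := dataAt m with hC
  have hm : m.toE3 ∈ C.U := mem_dataAt m
  have h1 : ContMDiffAt (𝓘(ℝ, ℝ).prod 𝓘(ℝ, E4)) 𝓘(ℝ, ℝ × ℍ[ℝ]) ∞
      (fun q : ℝ × Moduli B ν => (q.1, C.mcoord q.2)) (ε, m) :=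
    contMDiffAt_fst.prodMk_space ((C.contMDiffAt_mcoord hm).comp (ε, m) contMDiffAt_snd)
  have h2 : ContMDiffAt 𝓘(ℝ, ℝ × ℍ[ℝ]) 𝓘(ℝ, E4) ∞ (fun a : ℝ × ℍ[ℝ] => proj B ν (C.liftN B
      (rsmul a.2 (Complex.exp (Complex.I * ((-a.1 : ℝ) : ℂ)))))) (ε, C.mcoord m) := by
    refine contMDiffAt_proj_comp (c := fun a : ℝ × ℍ[ℝ] => C.liftN B
      (rsmul a.2 (Complex.exp (Complex.I * ((-a.1 : ℝ) : ℂ))))) ?_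
    refine ContDiffAt.comp (g := C.lift B) _ (C.contDiffAt_lift ?_)
      (ContDiffAt.rsmul contDiffAt_snd (contDiffAt_exp_I contDiffAt_fst.neg))
    rw [ChartData.pt, hopf_rsmul_unit _ (norm_exp_I _)]
    change C.pt (C.mcoord m) ∈ C.U
    rwa [C.pt_mcoord hm]
  refine (ContMDiffAt.comp (ε, m) h2 h1).congr_of_eventuallyEq ?_
  filter_upwards [(Moduli.continuous_toE3.comp continuous_snd).continuousAt.eventually_mem
    (C.frame.isOpen.mem_nhds hm)] with q hq
  rw [C.act_eq _ hq, coe_exp_inv]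
  rfl

lemma ContMDiff.prodMk_right {M : Type} [TopologicalSpace M] [ChartedSpace E4 M] {f : ℝ × M → M}
    (hf : ContMDiff (𝓘(ℝ, ℝ).prod 𝓘(ℝ, E4)) 𝓘(ℝ, E4) ∞ f) (ε : ℝ) :
    ContMDiff 𝓘(ℝ, E4) 𝓘(ℝ, E4) ∞ (fun m => f (ε, m)) :=
  hf.comp (contMDiff_const.prodMk contMDiff_id)

lemma contMDiff_act_right (z : Circle) :
    ContMDiff 𝓘(ℝ, E4) 𝓘(ℝ, E4) ∞ (Moduli.act z : Moduli B ν → Moduli B ν) := by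
  obtain ⟨ε, rfl⟩ := exists_exp_eq z
  exact ContMDiff.prodMk_right contMDiff_act ε

/-- Every tangent vector is the velocity of a slice, so identities on tangent spaces can be checked
on `projDeriv`. -/
lemma exists_param (m : Moduli B ν) : ∃ (C : ChartData ν) (b : ℍ[ℝ]), C.pt b ∈ C.U ∧
    m = proj B ν (C.liftN B b) ∧ ∀ u : E4, ∃ β : ℍ[ℝ], (projDeriv B ν (C.liftN B) b β : E4) = u := by
  have h1 : (dataAt m).pt ((dataAt m).mcoord m) ∈ (dataAt m).U := by
    rw [ChartData.pt_mcoord _ (mem_dataAt m)]; exact mem_dataAt m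
  have h2 := (dataAt m).proj_liftN_mcoord (mem_dataAt m)
  refine ⟨dataAt m, (dataAt m).mcoord m, h1, h2.symm, fun u => ⟨e.symm u, ?_⟩⟩
  refine (projDeriv_eq ((dataAt m).contDiffAt_liftN h1) _).trans ?_
  rw [h2]
  have h3 := (dataAt m).fderiv_coord_lift (B := B) h1
  refine Eq.trans (congrArg (fun L : ℍ[ℝ] →L[ℝ] ℍ[ℝ] => e (L (e.symm u))) h3) ?_
  exact e.apply_symm_apply u

/-- The metric and the symplectic forms are invariant under the circle action. -/
lemma mform_act (q : ℍ[ℝ]) (z : Circle) (m : Moduli B ν) (u v : TangentSpace 𝓘(ℝ, E4) m) :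
    mform B ν q (Moduli.act z m) (mfderiv 𝓘(ℝ, E4) 𝓘(ℝ, E4) (Moduli.act z) m u)
      (mfderiv 𝓘(ℝ, E4) 𝓘(ℝ, E4) (Moduli.act z) m v) = mform B ν q m u v := by
  obtain ⟨C, b, hb, rfl, hβ⟩ := exists_param m
  obtain ⟨β, rfl⟩ := hβ u
  obtain ⟨β', rfl⟩ := hβ v
  set w : ℂ := ((z⁻¹ : Circle) : ℂ) with hw
  have hw1 : ‖w‖ = 1 := Circle.norm_coe _
  have hd : MDifferentiableAt 𝓘(ℝ, ℍ[ℝ]) 𝓘(ℝ, E4) (fun b => proj B ν (C.liftN B b)) b :=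
    (contMDiffAt_proj_comp (C.contDiffAt_liftN hb)).mdifferentiableAt (by simp)
  have hd' : MDifferentiableAt 𝓘(ℝ, E4) 𝓘(ℝ, E4) (Moduli.act z : Moduli B ν → Moduli B ν)
      (proj B ν (C.liftN B b)) := (contMDiff_act_right z _).mdifferentiableAt (by simp)
  have h1 : ∀ β, mfderiv 𝓘(ℝ, E4) 𝓘(ℝ, E4) (Moduli.act z) (proj B ν (C.liftN B b))
      (projDeriv B ν (C.liftN B) b β) = mfderiv 𝓘(ℝ, ℍ[ℝ]) 𝓘(ℝ, E4)
        (fun b => Moduli.act z (proj B ν (C.liftN B b))) b β := by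
    intro β
    have h2 := mfderiv_comp b hd' hd
    exact (congrArg (fun L : ℍ[ℝ] →L[ℝ] E4 => L β) h2).symm
  have h3 : (fun b => Moduli.act z (proj B ν (C.liftN B b))) =ᶠ[𝓝 b]
      fun b => proj B ν (C.liftN B (rsmul b w)) := by
    filter_upwards [C.isOpen_target.mem_nhds hb] with b' hb'
    rw [C.act_eq z (by rwa [C.toE3_proj_liftN]), C.mcoord_proj_liftN hb']
  rw [h1, h1]
  refine (form_congr (Ω := mform B ν q) (c := fun b => C.liftN B (rsmul b w)) h3 β β').trans ?_
  have hpt : C.pt (rsmul b w) ∈ C.U := by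
    rw [ChartData.pt, hopf_rsmul_unit _ hw1]; exact hb
  have hc : ContDiffAt ℝ ∞ (fun b => (C.liftN B (rsmul b w) : Dat B)) b :=
    ContDiffAt.comp (g := C.lift B) b (C.contDiffAt_lift hpt)
      (ContDiffAt.rsmul contDiffAt_id contDiffAt_const)
  rw [mform_projDeriv_eq (c := fun b => C.liftN B (rsmul b w)) C hc
    (by rwa [C.toE3_proj_liftN]), C.mform_liftN hb]
  have h4 : HasFDerivAt (fun b => C.coord (C.lift B (rsmul b w))) (rsmulL.flip w) b := by
    have h5 : HasFDerivAt (fun b => rsmul b w) (rsmulL.flip w) b := (rsmulL.flip w).hasFDerivAt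
    refine h5.congr_of_eventuallyEq ?_
    filter_upwards [C.isOpen_target.mem_nhds hb] with b' hb'
    refine C.coord_lift ?_
    rw [ChartData.pt, hopf_rsmul_unit _ hw1]; exact hb'
  simp only [ChartData.liftN]
  rw [h4.fderiv, C.coord_lift hpt]
  exact C.form_rsmul q β β' hw1

end Action

end

section

/-! ### Gibbons-Hawking coordinates -/

section GibbonsHawking

open ChartData (e)

variable {k : ℕ} {B : Bow k} [NeZero k] {ν : Fin k → E3} {U : Set E3} {q : Fin k → E3 → ℍ[ℝ]}
  {h h' : Lp ℍ[ℝ] 2 B.vol} {t : E3} {y : E3 × ℝ}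

lemma IsPhaseFrame.isFrame (hq : IsPhaseFrame ν U q) : IsFrame ν Finset.univ U q where
  isOpen := hq.isOpen
  ne ρ _ t ht h := hq.ne_center t ht ⟨ρ, h.symm⟩
  smooth ρ _ := hq.smooth ρ
  hopf_eq ρ _ t ht := hq.hopf_eq t ht ρ

lemma IsPhaseFrame.ne_zero (hq : IsPhaseFrame ν U q) (ht : t ∈ U) (σ : Fin k) : q σ t ≠ 0 :=
  hq.isFrame.q_ne_zero (Finset.mem_univ σ) ht

lemma IsPhaseFrame.norm_sq (hq : IsPhaseFrame ν U q) (ht : t ∈ U) (σ : Fin k) :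
    ‖q σ t‖ ^ 2 = 2 * ‖t - ν σ‖ := by
  rw [norm_hopf, hq.hopf_eq t ht]

lemma exists_isPhaseFrame (ht : t ∉ range ν) : ∃ U q, t ∈ U ∧ IsPhaseFrame ν U q := by
  obtain ⟨U, q, htU, hU, -⟩ := exists_isFrame Finset.univ t fun ρ _ h => ht ⟨ρ, h.symm⟩
  refine ⟨U, q, htU, hU.isOpen, ?_, fun σ => hU.smooth σ (Finset.mem_univ _),
    fun t ht σ => hU.hopf_eq σ (Finset.mem_univ _) t ht⟩
  rintro t ht ⟨ρ, rfl⟩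
  exact hU.ne ρ (Finset.mem_univ _) _ ht rfl

/-- The data over `t` with bifundamental components `q t`, and the holonomy given by `τ`. -/
def frameDat (h : Lp ℍ[ℝ] 2 B.vol) (q : Fin k → E3 → ℍ[ℝ]) (y : E3 × ℝ) : Dat B :=
  mkDat (constL B (imQuat y.1) + y.2 • h, fun σ => q σ y.1)

lemma tval_frameDat (hq : IsPhaseFrame ν U q) (hy : y.1 ∈ U) : tval ν (frameDat h q y) = y.1 := by
  rw [tval, frameDat, mkDat_snd, hq.hopf_eq _ hy, sub_add_cancel]

lemma frameDat_mem (hq : IsPhaseFrame ν U q) (hh : imPart B h = 0) (hy : y.1 ∈ U) :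
    frameDat h q y ∈ levelSet B ν := by
  rw [mem_levelSet_iff, tval_frameDat hq hy]
  refine ⟨?_, fun σ => by rw [frameDat, mkDat_snd, hq.hopf_eq _ hy]⟩
  rw [frameDat, mkDat_fst, map_add, map_smul, hh, imPart_constL, imVec_imQuat, smul_zero, add_zero]

lemma primL_frameDat {v : ℝ} (hv : v ∈ Icc 0 B.l) :
    primL B v (frameDat h q y) = y.2 * primL B v (mkDat (h, 0)) := by
  have h1 : frameDat h q y =
      mkDat (constL B (imQuat y.1), fun σ => q σ y.1) + y.2 • mkDat (h, 0) := by
    rw [frameDat, ← map_smul, ← map_add]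
    congr 1
    simp
  rw [h1, map_add, map_smul, primL_constL (q := imQuat y.1) hv rfl]
  simp

lemma primL_frameDat_l (hh1 : primL B B.l (mkDat (h, 0)) = -1) :
    primL B B.l (frameDat h q y) = -y.2 := by
  rw [primL_frameDat Bow.l_mem, hh1, mul_neg_one]

/-- The derivative of `frameDat`. -/
def frameDatDeriv (h : Lp ℍ[ℝ] 2 B.vol) (q : Fin k → E3 → ℍ[ℝ]) (t : E3) : E3 × ℝ →L[ℝ] Dat B :=
  mkDat.comp ((((constL B).comp imQuat).comp (ContinuousLinearMap.fst ℝ E3 ℝ) +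
    (ContinuousLinearMap.snd ℝ E3 ℝ).smulRight h).prod
    (ContinuousLinearMap.pi fun σ => (fderiv ℝ (q σ) t).comp (ContinuousLinearMap.fst ℝ E3 ℝ)))

lemma frameDatDeriv_apply (w : E3 × ℝ) : frameDatDeriv h q t w =
    mkDat (constL B (imQuat w.1) + w.2 • h, fun σ => fderiv ℝ (q σ) t w.1) := rfl

lemma contDiffAt_frameDat (hq : IsPhaseFrame ν U q) (hy : y.1 ∈ U) :
    ContDiffAt ℝ ∞ (frameDat h q) y := by
  refine contDiffAt_mkDat ?_ fun σ => ?_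
  · exact ((((constL B).comp imQuat).contDiff.contDiffAt).comp y contDiffAt_fst).add
      (contDiffAt_snd.smul contDiffAt_const)
  · exact ((hq.smooth σ).contDiffAt (hq.isOpen.mem_nhds hy)).comp y contDiffAt_fst

lemma hasFDerivAt_frameDat (hq : IsPhaseFrame ν U q) (hy : y.1 ∈ U) :
    HasFDerivAt (frameDat h q) (frameDatDeriv h q y.1) y := by
  have h1 : HasFDerivAt (fun y : E3 × ℝ => constL B (imQuat y.1) + y.2 • h)
      (((constL B).comp imQuat).comp (ContinuousLinearMap.fst ℝ E3 ℝ) +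
        (ContinuousLinearMap.snd ℝ E3 ℝ).smulRight h) y :=
    (((constL B).comp imQuat).comp (ContinuousLinearMap.fst ℝ E3 ℝ) +
        (ContinuousLinearMap.snd ℝ E3 ℝ).smulRight h).hasFDerivAt
  have h2 : HasFDerivAt (fun (y : E3 × ℝ) σ => q σ y.1) (ContinuousLinearMap.pi fun σ =>
      (fderiv ℝ (q σ) y.1).comp (ContinuousLinearMap.fst ℝ E3 ℝ)) y := by
    refine hasFDerivAt_pi.2 fun σ => ?_
    have h3 : HasFDerivAt (q σ) (fderiv ℝ (q σ) y.1) y.1 :=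
      (((hq.smooth σ).contDiffAt (hq.isOpen.mem_nhds hy)).differentiableAt (by simp)).hasFDerivAt
    exact HasFDerivAt.comp (g := q σ) y h3 hasFDerivAt_fst
  exact (mkDat (B := B)).hasFDerivAt.comp y (h1.prodMk h2)

/-- The coordinate `τ` of a point of the level set. -/
lemma gaugeRel_frameDat (hq : IsPhaseFrame ν U q) (hh : imPart B h = 0)
    (hh1 : primL B B.l (mkDat (h, 0)) = -1) {x : Dat B} (hx : x ∈ levelSet B ν)
    (hU : tval ν x ∈ U) {φ : Fin k → ℝ} (hφ : IsPhase B q x (tval ν x) φ) :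
    GaugeRel (frameDat h q (tval ν x, ∑ σ, φ σ - primL B B.l x)) x (-φ) where
  im := by
    rw [(mem_levelSet_iff.1 hx).1, (mem_levelSet_iff.1 (frameDat_mem hq hh hU)).1,
      tval_frameDat hq hU]
  snd σ := by
    rw [hφ σ, frameDat, mkDat_snd]
    simp
  sum := by
    rw [primL_frameDat_l hh1]
    simp only [Pi.neg_apply, Finset.sum_neg_distrib]
    ring

/-- Modulo gauge only the integral of `h` matters; its distribution along the interval is free, and
is used to adjust `∫₀^v t₀`. -/
lemma gaugeRel_frameDat_frameDat (hh : imPart B h = 0) (hh' : imPart B h' = 0)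
    (hh1 : primL B B.l (mkDat (h, 0)) = -1) (hh1' : primL B B.l (mkDat (h', 0)) = -1) :
    GaugeRel (frameDat h q y) (frameDat h' q y) 0 where
  im := by simp only [frameDat, mkDat_fst, map_add, map_smul, hh, hh']
  snd σ := by simp [frameDat]
  sum := by rw [primL_frameDat_l hh1, primL_frameDat_l hh1']; simp

/-- The constant function with total integral `-1`. -/
def unitHol (B : Bow k) : Lp ℍ[ℝ] 2 B.vol := constL B ((-(1 / B.l) : ℝ) : ℍ[ℝ])

lemma imVec_coe (a : ℝ) : imVec (a : ℍ[ℝ]) = 0 := by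
  apply E3_ext <;> simp

lemma imPart_unitHol : imPart B (unitHol B) = 0 := by
  rw [unitHol, imPart_constL, imVec_coe]
  simp

lemma primL_unitHol : primL B B.l (mkDat (unitHol B, 0)) = -1 := by
  rw [primL_constL (q := ((-(1 / B.l) : ℝ) : ℍ[ℝ])) Bow.l_mem rfl, Quaternion.re_coe]
  have := B.l_pos.ne'
  field_simp

variable [hν : Fact (Injective ν)]

open Classical in
/-- The standard lift of the Gibbons-Hawking coordinates to the level set. -/
def frameN (ν : Fin k → E3) [Fact (Injective ν)] (h : Lp ℍ[ℝ] 2 B.vol) (q : Fin k → E3 → ℍ[ℝ])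
    (y : E3 × ℝ) : levelSet B ν :=
  if hy : frameDat h q y ∈ levelSet B ν then ⟨frameDat h q y, hy⟩ else
    -- An arbitrary point of the level set, a default value that plays no role for `y` over `U`.
    (proj_surjective (toE3_surjective (Fact.out : Injective ν) 0).choose).choose

lemma coe_frameN (hq : IsPhaseFrame ν U q) (hh : imPart B h = 0) (hy : y.1 ∈ U) :
    (frameN ν h q y : Dat B) = frameDat h q y := by
  rw [frameN, dif_pos (frameDat_mem hq hh hy)]

lemma frameN_eventuallyEq (hq : IsPhaseFrame ν U q) (hh : imPart B h = 0) (hy : y.1 ∈ U) :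
    (fun y => (frameN ν h q y : Dat B)) =ᶠ[𝓝 y] frameDat h q := by
  filter_upwards [(hq.isOpen.preimage continuous_fst).mem_nhds hy] with y' hy'
    using coe_frameN hq hh hy'

lemma contDiffAt_frameN (hq : IsPhaseFrame ν U q) (hh : imPart B h = 0) (hy : y.1 ∈ U) :
    ContDiffAt ℝ ∞ (fun y => (frameN ν h q y : Dat B)) y :=
  (contDiffAt_frameDat hq hy).congr_of_eventuallyEq (frameN_eventuallyEq hq hh hy)

lemma fderiv_frameN (hq : IsPhaseFrame ν U q) (hh : imPart B h = 0) (hy : y.1 ∈ U) :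
    fderiv ℝ (fun y => (frameN ν h q y : Dat B)) y = frameDatDeriv h q y.1 := by
  exact (frameN_eventuallyEq hq hh hy).fderiv_eq.trans
    (hasFDerivAt_frameDat (B := B) (h := h) hq hy).fderiv

/-- The Gibbons-Hawking coordinates. -/
def ghMap (B : Bow k) (ν : Fin k → E3) [Fact (Injective ν)] (q : Fin k → E3 → ℍ[ℝ])
    (y : E3 × ℝ) : Moduli B ν := proj B ν (frameN ν (unitHol B) q y)

lemma ghMap_eq (hq : IsPhaseFrame ν U q) (hh : imPart B h = 0)
    (hh1 : primL B B.l (mkDat (h, 0)) = -1) (hy : y.1 ∈ U) :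
    ghMap B ν q y = proj B ν (frameN ν h q y) := by
  refine proj_eq_iff.2 ⟨0, ?_⟩
  rw [coe_frameN hq hh hy, coe_frameN hq imPart_unitHol hy]
  exact gaugeRel_frameDat_frameDat imPart_unitHol hh primL_unitHol hh1

lemma proj_eq_ghMap (hq : IsPhaseFrame ν U q) {x : levelSet B ν} (hU : (proj B ν x).toE3 ∈ U)
    {φ : Fin k → ℝ} (hφ : IsPhase B q x (proj B ν x).toE3 φ) :
    proj B ν x = ghMap B ν q ((proj B ν x).toE3, ∑ σ, φ σ - primL B B.l (x : Dat B)) := by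
  refine (proj_eq_iff.2 ⟨-φ, ?_⟩).symm
  rw [coe_frameN hq imPart_unitHol hU]
  exact gaugeRel_frameDat hq imPart_unitHol primL_unitHol x.2 hU hφ

lemma potential_eq (hq : IsPhaseFrame ν U q) (hy : y.1 ∈ U) :
    partialPotential B Finset.univ (frameDat h q y) = potential B.l ν y.1 := by
  rw [partialPotential, potential]
  congr 1
  exact Finset.sum_congr rfl fun σ _ => by rw [frameDat, mkDat_snd, hq.norm_sq hy]

lemma partialHol_frameDatDeriv (hh1 : primL B B.l (mkDat (h, 0)) = -1) (w : E3 × ℝ) :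
    partialHol B Finset.univ (frameDat h q y) (frameDatDeriv h q y.1 w) =
      -(w.2 + ∑ σ, phaseForm (q σ) y.1 w.1) := by
  have h1 : primL B B.l (frameDatDeriv h q y.1 w) = -w.2 := by
    rw [frameDatDeriv_apply]
    have h2 := primL_frameDat_l (q := fun σ t' => fderiv ℝ (q σ) y.1 t') (y := w) hh1
    exact h2
  rw [partialHol, h1, neg_add, ← Finset.sum_neg_distrib, add_comm]
  congr 1
  exact Finset.sum_congr rfl fun σ _ => by rw [phaseForm_apply, neg_neg]; rfl

lemma quat_inner_parts (a b : ℍ[ℝ]) : ⟪a, b⟫_ℝ = a.re * b.re + ⟪imVec a, imVec b⟫_ℝ := by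
  rw [quat_inner_eq, E3_inner_eq]; simp; ring

lemma potential_pos (t : E3) : 0 < potential B.l ν t :=
  add_pos_of_pos_of_nonneg B.l_pos (Finset.sum_nonneg fun _ _ => by positivity)

/-- The horizontal parts of the coordinate vector fields. -/
lemma frameDat_horPart (hq : IsPhaseFrame ν U q) (hh : imPart B h = 0)
    (hh1 : primL B B.l (mkDat (h, 0)) = -1) (hy : y.1 ∈ U) (w : E3 × ℝ) :
    ∃ H κ d, QHor (frameDat h q y) κ H ∧ IsVert (frameDat h q y) (frameDatDeriv h q y.1 w - H) d ∧
      imVec κ = w.1 ∧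
      κ.re = -(w.2 + ∑ σ, phaseForm (q σ) y.1 w.1) / potential B.l ν y.1 := by
  have hv := isVel_fderiv (contDiffAt_frameN (ν := ν) hq hh hy) w
  rw [fderiv_frameN hq hh hy, coe_frameN hq hh hy] at hv
  obtain ⟨H, ⟨κ, hκ⟩, d, hd⟩ := exists_isHorPart hv
  refine ⟨H, κ, d, hκ, hd, ?_, ?_⟩
  · rw [← hκ.dhopf_eq hd 0]
    exact dhopf_fderiv hq.isOpen (hq.smooth 0) (fun t ht => hq.hopf_eq t ht 0) hy w.1
  · have h1 := hκ.partialHol_eq hd (s := Finset.univ) fun ρ _ => hq.ne_zero hy ρ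
    rw [partialHol_frameDatDeriv hh1, potential_eq hq hy, Finset.compl_univ, Finset.sum_empty,
      sub_zero] at h1
    rw [h1, mul_div_cancel_right₀ _ (potential_pos _).ne']

/-- The value is `V ⟪κ, κ'⟫`, with the real parts `-(dτ + η) / V` and the imaginary parts `dt` found
in `frameDat_horPart`. -/
lemma ghMap_metric (hq : IsPhaseFrame ν U q) (hy : y.1 ∈ U) (v w : E3 × ℝ) :
    mform B ν 1 (ghMap B ν q y) (mfderiv 𝓘(ℝ, E3 × ℝ) 𝓘(ℝ, E4) (ghMap B ν q) y v)
      (mfderiv 𝓘(ℝ, E3 × ℝ) 𝓘(ℝ, E4) (ghMap B ν q) y w) =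
      potential B.l ν y.1 * ⟪v.1, w.1⟫_ℝ + (v.2 + (∑ σ, phaseForm (q σ) y.1) v.1) *
        (w.2 + (∑ σ, phaseForm (q σ) y.1) w.1) / potential B.l ν y.1 := by
  have hh := imPart_unitHol (B := B)
  obtain ⟨H, κ, d, h1, h2, h3, h4⟩ := frameDat_horPart hq hh primL_unitHol hy v
  obtain ⟨H', κ', d', h1', h2', h3', h4'⟩ := frameDat_horPart hq hh primL_unitHol hy w
  have hc := contDiffAt_frameN (ν := ν) hq hh hy
  have key := mform_projDeriv (v := v) (w := w) (H := H) (H' := H') hc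
    (by rw [fderiv_frameN hq hh hy, coe_frameN hq hh hy]; exact ⟨⟨κ, h1⟩, d, h2⟩)
    (by rw [fderiv_frameN hq hh hy, coe_frameN hq hh hy]; exact ⟨⟨κ', h1'⟩, d', h2'⟩) 1
  refine Eq.trans key ?_
  rw [h1.inner_leftMul h1' 1 (s := Finset.univ) fun ρ _ => hq.ne_zero hy ρ, Finset.compl_univ,
    Finset.sum_empty, add_zero, one_mul, quat_inner_parts, h3, h3', h4, h4', potential_eq hq hy,
    _root_.sum_apply, _root_.sum_apply]
  have := (potential_pos (B := B) (ν := ν) y.1).ne'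
  field_simp
  ring

lemma curvatureEq_sum (hq : IsPhaseFrame ν U q) (ht : t ∈ U) :
    CurvatureEq (fun t => ∑ σ, phaseForm (q σ) t) (potential B.l ν) t := by
  have hη : ∀ σ ∈ Finset.univ, DifferentiableAt ℝ (phaseForm (q σ)) t := fun σ _ =>
    ((contDiffOn_phaseForm hq.isOpen (hq.smooth σ) fun t ht => hq.ne_zero ht σ).contDiffAt
      (hq.isOpen.mem_nhds ht)).differentiableAt (by simp)
  have hf : ∀ σ ∈ Finset.univ, DifferentiableAt ℝ (fun t' => 1 / (2 * ‖t' - ν σ‖)) t := by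
    intro σ _
    have h1 : t - ν σ ≠ 0 := sub_ne_zero.2 (hq.isFrame.ne σ (Finset.mem_univ _) t ht)
    have h2 : DifferentiableAt ℝ (fun t' => ‖t' - ν σ‖) t :=
      (differentiableAt_id.sub_const (ν σ)).norm ℝ h1
    have h3 : 2 * ‖t - ν σ‖ ≠ 0 := mul_ne_zero two_ne_zero (norm_ne_zero_iff.2 h1)
    simpa only [one_div] using (h2.const_mul 2).fun_inv h3
  intro u v
  have h1 : fderiv ℝ (potential B.l ν) t =
      ∑ σ, fderiv ℝ (fun t' => 1 / (2 * ‖t' - ν σ‖)) t := by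
    rw [← fderiv_fun_sum hf]
    exact fderiv_const_add _
  rw [fderiv_fun_sum hη, h1]
  simp only [_root_.sum_apply]
  rw [← Finset.sum_sub_distrib]
  exact Finset.sum_congr rfl fun σ _ => curvatureEq_phaseForm hq.isOpen (hq.smooth σ)
    (fun t ht => hq.hopf_eq t ht σ) (fun t ht => hq.ne_zero ht σ) ht u v

lemma exp_I_eq_one_of_rsmul {b : ℍ[ℝ]} (hb : b ≠ 0) {z : ℂ} (h : b = rsmul b z) : z = 1 := by
  have h2 : rsmul b (z - 1) = 0 := by
    rw [sub_eq_add_neg, rsmul_add, ← h, show (-1 : ℂ) = ((-1 : ℝ) : ℂ) by simp, rsmul_real]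
    simp
  by_contra h3
  exact hb ((rsmul_eq_zero (sub_ne_zero.2 h3)).1 h2)

/-- Both data have the components `q_σ(t) ≠ 0`, so all jumps are in `2πℤ`, and their sum is `τ' -
τ`. Conversely the whole multiple of `2π` is put at one cut. -/
lemma ghMap_periodic (hq : IsPhaseFrame ν U q) (ht : t ∈ U) (τ τ' : ℝ) :
    ghMap B ν q (t, τ) = ghMap B ν q (t, τ') ↔ ∃ n : ℤ, τ' = τ + n * (2 * Real.pi) := by
  have hh := imPart_unitHol (B := B)
  rw [ghMap, ghMap, proj_eq_iff, coe_frameN hq hh ht, coe_frameN hq hh ht]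
  constructor
  · rintro ⟨θ, hθ⟩
    have h1 : ∀ σ, ∃ n : ℤ, θ σ = n * (2 * Real.pi) := by
      intro σ
      have h2 := exp_I_eq_one_of_rsmul (hq.ne_zero ht σ) (hθ.snd σ)
      obtain ⟨n, hn⟩ := Complex.exp_eq_one_iff.1 h2
      refine ⟨n, ?_⟩
      have h3 : Complex.I * ((θ σ : ℂ) - n * (2 * Real.pi)) = 0 := by linear_combination hn
      have h4 := (mul_eq_zero.1 h3).resolve_left Complex.I_ne_zero
      rw [sub_eq_zero] at h4
      exact_mod_cast h4
    choose n hn using h1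
    refine ⟨∑ σ, n σ, ?_⟩
    have h2 := hθ.sum
    rw [primL_frameDat_l primL_unitHol, primL_frameDat_l primL_unitHol] at h2
    push_cast
    rw [Finset.sum_mul, ← Finset.sum_congr rfl fun σ _ => hn σ]
    linarith
  · rintro ⟨n, rfl⟩
    refine ⟨Pi.single 0 (n * (2 * Real.pi)), ?_, fun σ => ?_, ?_⟩
    · simp only [frameDat, mkDat_fst, map_add, map_smul, hh, smul_zero]
    · rw [frameDat, mkDat_snd, frameDat, mkDat_snd]
      by_cases hσ : σ = 0
      · subst hσ
        have : Complex.I * (((n : ℝ) * (2 * Real.pi) : ℝ) : ℂ) = n * (2 * Real.pi * Complex.I) := by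
          push_cast; ring
        rw [Pi.single_eq_same, this, Complex.exp_int_mul_two_pi_mul_I, rsmul_one]
      · simp [hσ]
    · rw [primL_frameDat_l primL_unitHol, primL_frameDat_l primL_unitHol]
      simp only [Finset.sum_pi_single', Finset.mem_univ, if_true]
      ring

lemma ghMap_act (hq : IsPhaseFrame ν U q) (ht : t ∈ U) (τ ε : ℝ) :
    Moduli.act (Circle.exp ε) (ghMap B ν q (t, τ)) = ghMap B ν q (t, τ + ε) := by
  have hh := imPart_unitHol (B := B)
  rw [ghMap, act_proj 0, ghMap, proj_eq_iff]
  refine ⟨Pi.single 0 ε, ?_⟩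
  simp only [coe_frameN (y := (t, τ)) hq hh ht, coe_frameN (y := (t, τ + ε)) hq hh ht]
  refine ⟨?_, fun σ => ?_, ?_⟩
  · simp only [shift_fst, frameDat, mkDat_fst, map_add, map_smul, hh, smul_zero, add_zero]
  · rw [shift_snd, rsmul_rsmul, ← Complex.exp_add, frameDat, mkDat_snd, frameDat, mkDat_snd]
    by_cases hσ : σ = 0
    · subst hσ; simp
    · simp [hσ]
  · rw [primL_congr (x := shift 0 _ _) (y := frameDat (unitHol B) q (t, τ)) (by simp),
      primL_frameDat_l primL_unitHol, primL_frameDat_l primL_unitHol]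
    simp only [Finset.sum_pi_single', Finset.mem_univ, if_true]
    ring

lemma exists_isPhase (hq : IsPhaseFrame ν U q) {x : Dat B} (hx : x ∈ levelSet B ν)
    (hU : tval ν x ∈ U) : ∃ φ, IsPhase B q x (tval ν x) φ := by
  obtain ⟨θ, hθ⟩ := ChartData.exists_phases hq.isFrame hx hU
  refine ⟨-θ, fun σ => ?_⟩
  rw [hθ σ (Finset.mem_univ _)]
  simp

theorem isGibbonsHawkingChart_ghMap (hq : IsPhaseFrame ν U q) :
    IsGibbonsHawkingChart B.l ν (moduliMetric B ν) Moduli.toE3 Moduli.act U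
      (fun t => ∑ σ, phaseForm (q σ) t) (ghMap B ν q) where
  isOpen := hq.isOpen
  ne_center := hq.ne_center
  smooth_form := ContDiffOn.sum fun σ _ =>
    contDiffOn_phaseForm hq.isOpen (hq.smooth σ) fun t ht => hq.ne_zero ht σ
  curvature _ ht := curvatureEq_sum hq ht
  smooth y hy := (contMDiffAt_proj_comp
    (contDiffAt_frameN hq imPart_unitHol hy.1)).contMDiffWithinAt
  proj_eq t ht τ := by
    rw [ghMap, Moduli.toE3_proj, coe_frameN hq imPart_unitHol ht, tval_frameDat hq ht]
  covers m hm := by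
    obtain ⟨x, rfl⟩ := proj_surjective m
    obtain ⟨φ, hφ⟩ := exists_isPhase hq x.2 hm
    exact ⟨_, (proj_eq_ghMap hq hm hφ).symm⟩
  periodic _ ht := ghMap_periodic hq ht
  act_eq _ ht := ghMap_act hq ht
  metric_eq t ht τ v w := ghMap_metric (y := (t, τ)) hq ht v w

theorem isMultiTaubNUT_moduli :
    IsMultiTaubNUT B.l ν (moduliMetric B ν) Moduli.toE3 Moduli.act where
  t2 := inferInstance
  secondCountable := inferInstance
  smooth_proj := contMDiff_toE3
  surjective := toE3_surjective hν.out
  act_one := act_one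
  act_mul := act_mul
  smooth_act := contMDiff_act
  fiber := toE3_eq_iff
  fixed _ hm z := act_fixed hm z
  free _ hm _ hz := act_free hm hz
  isometric z m u v := mform_act 1 z m u v
  gibbonsHawking t ht := by
    obtain ⟨U, q, htU, hq⟩ := exists_isPhaseFrame ht
    exact ⟨U, _, _, htU, isGibbonsHawkingChart_ghMap hq⟩

end GibbonsHawking

end

section

/-! ### The tautological line bundles -/

section Taut

variable {k : ℕ} {B : Bow k} [NeZero k] {ν : Fin k → E3} {i : Fin (k + 1)} {v : ℝ}

lemma gaugeAngle_trans (x y z : Dat B) (θ θ' : Fin k → ℝ) (i : Fin (k + 1)) (v : ℝ) :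
    gaugeAngle x z (θ + θ') i v = gaugeAngle x y θ i v + gaugeAngle y z θ' i v := by
  simp only [gaugeAngle, leftSum_eq, Pi.add_apply, Finset.sum_add_distrib]
  ring

lemma gaugeAngle_refl (x : Dat B) (i : Fin (k + 1)) (v : ℝ) : gaugeAngle x x 0 i v = 0 := by
  simp [gaugeAngle, leftSum_eq]

lemma gaugeAngle_symm (x y : Dat B) (θ : Fin k → ℝ) (i : Fin (k + 1)) (v : ℝ) :
    gaugeAngle y x (-θ) i v = -gaugeAngle x y θ i v := by
  simp only [gaugeAngle, leftSum_eq, Pi.neg_apply, Finset.sum_neg_distrib]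
  ring

/-- The angle at `v` is additive under composition, so the generated equivalence relation is
explicit. The point `v` must lie in the `i`-th piece, as `g i` is controlled only there. -/
lemma Taut.mk_eq_iff (hv : v ∈ Icc (B.left i) (B.right i)) {x y : levelSet B ν} {ζ ζ' : ℂ} :
    (Taut.mk x ζ : Taut B ν i v) = Taut.mk y ζ' ↔ ∃ θ, GaugeRel (x : Dat B) y θ ∧
      ζ' = Complex.exp (-(Complex.I * (gaugeAngle (x : Dat B) y θ i v : ℂ))) * ζ := by
  constructor
  · intro h
    have key : ∀ a b : levelSet B ν × ℂ, Relation.EqvGen (fun a b : levelSet B ν × ℂ =>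
        ∃ g, IsBasedGauge B g ∧ GaugeAct B g a.1 b.1 ∧ b.2 = (g i v)⁻¹ * a.2) a b →
        ∃ θ, GaugeRel (a.1 : Dat B) b.1 θ ∧
          b.2 = Complex.exp (-(Complex.I * (gaugeAngle (a.1 : Dat B) b.1 θ i v : ℂ))) * a.2 := by
      intro a b h1
      induction h1 with
      | rel a b h =>
        obtain ⟨g, hg, hab, h2⟩ := h
        obtain ⟨θ, hθ, h3⟩ := exists_gaugeRel hg hab
        exact ⟨θ, hθ, by rw [h2, h3 i v hv, Complex.exp_neg]⟩
      | refl a => exact ⟨0, GaugeRel.refl, by simp [gaugeAngle_refl]⟩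
      | symm a b _ ih =>
        obtain ⟨θ, hθ, h2⟩ := ih
        refine ⟨_, hθ.symm, ?_⟩
        rw [h2, gaugeAngle_symm, ← mul_assoc, ← Complex.exp_add]
        simp
      | trans a b c _ _ ih1 ih2 =>
        obtain ⟨θ, hθ, h2⟩ := ih1
        obtain ⟨θ', hθ', h3⟩ := ih2
        refine ⟨_, hθ.trans hθ', ?_⟩
        rw [h3, h2, gaugeAngle_trans _ (b.1 : Dat B), ← mul_assoc, ← Complex.exp_add]
        congr 2
        push_cast
        ring
    exact key (x, ζ) (y, ζ') (Quot.eqvGen_exact h)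
  · rintro ⟨θ, hθ, h⟩
    obtain ⟨g, hg, hxy, h1⟩ := hθ.exists_gauge
    exact Quot.sound ⟨g, hg, hxy, by rw [h, h1 i v hv, Complex.exp_neg]⟩

lemma hol_gauge_left (q : Fin k → E3 → ℍ[ℝ]) {x y : Dat B} {θ : Fin k → ℝ} (h : GaugeRel x y θ) :
    hol ν (leftSet i) v q y = hol ν (leftSet i) v q x *
      Complex.exp (Complex.I * (gaugeAngle x y θ i v : ℂ)) := by
  rw [hol_gauge h, gaugeAngle, leftSum_eq]

lemma contDiffAt_exp_primL (v : ℝ) (x : Dat B) :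
    ContDiffAt ℝ ∞ (fun x : Dat B => Complex.exp (Complex.I * (primL B v x : ℂ))) x :=
  (contDiffAt_const.mul
    ((Complex.ofRealCLM.contDiff.contDiffAt.comp x (primL B v).contDiff.contDiffAt))).cexp

/-- Locally on the level set, the value at a point of the gauge transformations is a ratio of values
of a smooth unitary function. -/
lemma exists_local_gauge_function (hν : Injective ν) (i : Fin (k + 1)) (v : ℝ) (t : E3) :
    ∃ G : Dat B → ℂ, (∀ x ∈ levelSet B ν, tval ν x = t → ContDiffAt ℝ ∞ G x) ∧
      (∀ᶠ t' in 𝓝 t, ∀ x ∈ levelSet B ν, tval ν x = t' → ‖G x‖ = 1) ∧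
      ∀ (x y : Dat B) (θ : Fin k → ℝ), GaugeRel x y θ →
        G y = G x * Complex.exp (Complex.I * (gaugeAngle x y θ i v : ℂ)) := by
  classical
  by_cases hs : ∀ ρ ∈ leftSet i, t ≠ ν ρ
  · obtain ⟨U, q, htU, hq, -⟩ := exists_isFrame (leftSet i) t hs
    refine ⟨hol ν (leftSet i) v q, fun x _ hx => contDiffAt_hol hq (hx ▸ htU), ?_,
      fun x y θ h => hol_gauge_left q h⟩
    filter_upwards [hq.isOpen.mem_nhds htU] with t' ht' x hx hxt
    exact norm_hol hq hx (hxt ▸ ht')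
  -- Here `t` is the centre of a cut to the left of `v`, where the phase is undefined. The other
  -- cuts then have well-defined phases near `t`, and as the total is zero the angle at `v` can be
  -- computed going around the circle the other way.
  · push Not at hs
    obtain ⟨σ, hσ, rfl⟩ := hs
    obtain ⟨U, q, htU, hq, -⟩ := exists_isFrame (ν := ν) (leftSet i)ᶜ (ν σ) fun ρ hρ h =>
      Finset.mem_compl.1 hρ (by rwa [← hν h])
    refine ⟨fun x => (hol ν (leftSet i)ᶜ B.l q x)⁻¹ * Complex.exp (Complex.I * (primL B v x : ℂ)),
      fun x hx hxt => ((contDiffAt_hol hq (hxt ▸ htU)).inv ?_).mul (contDiffAt_exp_primL v x), ?_,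
      fun x y θ h => ?_⟩
    · rw [← norm_ne_zero_iff, norm_hol hq hx (hxt ▸ htU)]
      exact one_ne_zero
    · filter_upwards [hq.isOpen.mem_nhds htU] with t' ht' x hx hxt
      rw [norm_mul, norm_inv, norm_hol hq hx (hxt ▸ ht'), norm_exp_I, inv_one, one_mul]
    · have h1 : gaugeAngle x y θ i v = -(∑ ρ ∈ (leftSet i)ᶜ, θ ρ +
          (primL B B.l y - primL B B.l x)) + (primL B v y - primL B v x) := by
        have h2 := h.sum
        rw [← Finset.sum_add_sum_compl (leftSet i)] at h2
        rw [gaugeAngle, leftSum_eq]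
        linarith
      simp only
      rw [hol_gauge h, h1, mul_inv, ← Complex.exp_neg, mul_assoc, mul_assoc, ← Complex.exp_add,
        ← Complex.exp_add]
      congr 2
      push_cast
      ring

variable [hν : Fact (Injective ν)]

/-- With `G` transforming like `g(v)` and non-zero, a gauge transformation fixing `x` has value `1`
at `v`, which gives uniqueness; the transition function is `G(c) / G(c')`. -/
theorem isSmoothLineBundle_taut (hv : v ∈ Icc (B.left i) (B.right i)) :
    IsSmoothLineBundle B ν i v := by
  refine ⟨fun x ℓ hℓ => ?_, fun F _ _ c c' h x hc hc' he => ?_⟩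
  · obtain ⟨⟨x', ζ'⟩, rfl⟩ := Quot.exists_rep ℓ
    obtain ⟨θ, hθ⟩ := proj_eq_iff.1 (show proj B ν x' = proj B ν x from hℓ)
    refine ⟨_, ((Taut.mk_eq_iff hv).2 ⟨θ, hθ, rfl⟩).symm, fun ζ hζ => ?_⟩
    obtain ⟨θ', hθ', h1⟩ := (Taut.mk_eq_iff hv).1
      ((show _ = Taut.mk x' ζ' from hζ).trans ((Taut.mk_eq_iff hv).2 ⟨θ, hθ, rfl⟩))
    obtain ⟨G, -, hG, hG'⟩ := exists_local_gauge_function (B := B) hν.out i v (tval ν (x : Dat B))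
    have h2 : ‖G x‖ = 1 := hG.self_of_nhds x x.2 rfl
    have h3 : G x ≠ 0 := by rw [← norm_ne_zero_iff, h2]; exact one_ne_zero
    have h4 := mul_left_cancel₀ h3 ((mul_one _).trans (hG' _ _ _ hθ'))
    rw [Complex.exp_neg (Complex.I * (gaugeAngle (x : Dat B) x θ' i v : ℂ)), ← h4, inv_one,
      one_mul] at h1
    exact h1.symm
  · obtain ⟨G, hG, hG1, hG'⟩ :=
      exists_local_gauge_function (B := B) hν.out i v (tval ν (c x : Dat B))
    have htv : Tendsto (fun y => tval ν (c y : Dat B)) (𝓝 x) (𝓝 (tval ν (c x : Dat B))) :=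
      (contDiff_tval.continuous.continuousAt.comp hc.continuousAt)
    have heq : ∀ᶠ y in 𝓝 x, h y = (G (c' y))⁻¹ * G (c y) ∧ ‖h y‖ = 1 := by
      filter_upwards [he, htv.eventually hG1] with y hy hy1
      obtain ⟨θ, hθ, h1⟩ := (Taut.mk_eq_iff hv).1 hy
      have h2 := hG' _ _ _ hθ
      have h3 : G (c y) ≠ 0 := by
        rw [← norm_ne_zero_iff, hy1 _ (c y).2 rfl]; exact one_ne_zero
      constructor
      · rw [h2, h1, mul_one, Complex.exp_neg]
        field_simp
      · rw [h1, mul_one, Complex.exp_neg, norm_inv, norm_exp_I, inv_one]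
    obtain ⟨θ, hθ, -⟩ := (Taut.mk_eq_iff hv).1 he.self_of_nhds
    have htc : tval ν (c' x : Dat B) = tval ν (c x : Dat B) := hθ.tval_eq
    refine ⟨?_, heq.self_of_nhds.2⟩
    have h0 : G (c' x) ≠ 0 := by
      rw [← norm_ne_zero_iff, hG1.self_of_nhds _ (c' x).2 htc]; exact one_ne_zero
    exact ((((hG _ (c' x).2 htc).comp x hc').inv h0).mul ((hG _ (c x).2 rfl).comp x hc)
      ).congr_of_eventuallyEq (heq.mono fun y hy => hy.1)

/-! #### Trivializations -/

/-- The function `-1 / (l - v)` on `(v, l]` and zero on `[0, v]`: using it in `frameDat` changes `τ`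
without changing `∫₀^v t₀`, so `τ_l` stays zero. This is why `v < l` is needed. -/
lemma exists_unitHol_right (hv : v ∈ Icc 0 B.l) (hvl : v < B.l) : ∃ h : Lp ℍ[ℝ] 2 B.vol,
    imPart B h = 0 ∧ primL B B.l (mkDat (h, 0)) = -1 ∧ primL B v (mkDat (h, 0)) = 0 := by
  have hd : B.l - v ≠ 0 := (sub_pos.2 hvl).ne'
  set e : Lp ℍ[ℝ] 2 B.vol := indicatorConstLp 2 (measurableSet_Icc (a := 0) (b := v))
    (measure_ne_top B.vol _) (1 : ℍ[ℝ]) with he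
  have hea : ∀ᵐ s ∂B.vol, e s = (Icc 0 v).indicator (fun _ => (1 : ℍ[ℝ])) s :=
    indicatorConstLp_coeFn
  have him : imPart B e = 0 := by
    apply Lp.ext
    filter_upwards [imPart_ae e, hea, Lp.coeFn_zero ℍ[ℝ] 2 B.vol] with s h1 h2 h3
    have h4 : e s = (((Icc 0 v).indicator (fun _ => (1 : ℝ)) s : ℝ) : ℍ[ℝ]) := by
      rw [h2]
      by_cases hs : s ∈ Icc 0 v <;> simp [hs]
    rw [h1, h3, h4, imVec_coe, map_zero]
    rfl
  have him1 : imPart B (constL B 1) = 0 := by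
    rw [imPart_constL, ← Quaternion.coe_one, imVec_coe]
    simp
  have hpc : ∀ w ∈ Icc 0 B.l, primL B w (mkDat (constL B 1, 0)) = w := fun w hw => by
    rw [primL_constL (q := 1) hw rfl]; simp
  -- Both sides are the inner product of the indicators of `[0, v]` and `[0, w]`; after the exchange
  -- the integral runs over `[0, v]`, where the integrand is `1` for `w ≥ v`.
  have hpe : ∀ w, primL B w (mkDat (e, 0)) = primL B v (mkDat
      (indicatorConstLp 2 (measurableSet_Icc (a := 0) (b := w))
        (measure_ne_top B.vol _) (1 : ℍ[ℝ]), 0)) := fun w => by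
    rw [he]; exact real_inner_comm (F := Lp ℍ[ℝ] 2 B.vol) _ _
  have hew : ∀ w ∈ Icc v B.l, primL B w (mkDat (e, 0)) = v := by
    intro w hw
    rw [hpe, primL_eq hv, intervalIntegral.integral_congr_ae_restrict (g := fun _ => (1 : ℝ))]
    · simp
    · rw [uIoc_of_le hv.1]
      have h1 : ∀ᵐ s ∂B.vol, indicatorConstLp 2 (measurableSet_Icc (a := 0) (b := w))
          (measure_ne_top B.vol _) (1 : ℍ[ℝ]) s = (Icc 0 w).indicator (fun _ => (1 : ℍ[ℝ])) s :=
        indicatorConstLp_coeFn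
      filter_upwards [ae_restrict_of_ae_restrict_of_subset
        (Ioc_subset_Icc_self.trans (Icc_subset_Icc_right hv.2)) h1,
        ae_restrict_mem measurableSet_Ioc] with s hs hs'
      rw [mkDat_fst, hs, indicator_of_mem (show s ∈ Icc 0 w from ⟨hs'.1.le, hs'.2.trans hw.1⟩), Quaternion.re_one]
  have hlin : ∀ w, primL B w (mkDat ((-(B.l - v)⁻¹) • (constL B 1 - e), 0)) =
      -(B.l - v)⁻¹ * (primL B w (mkDat (constL B 1, 0)) - primL B w (mkDat (e, 0))) := by
    intro w
    rw [← map_sub, ← smul_eq_mul, ← map_smul, ← map_sub, ← map_smul]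
    simp
  refine ⟨(-(B.l - v)⁻¹) • (constL B 1 - e), ?_, ?_, ?_⟩
  · rw [map_smul, map_sub, him, him1, sub_zero, smul_zero]
  · rw [hlin, hpc _ Bow.l_mem, hew _ ⟨hv.2, le_rfl⟩]
    field_simp
  · rw [hlin, hpc _ hv, hew _ ⟨le_rfl, hv.2⟩, sub_self, mul_zero]

section Connection

open ChartData (e)

variable {U : Set E3} {q : Fin k → E3 → ℍ[ℝ]} {y : E3 × ℝ}

lemma exists_isTautTrivialization (hq : IsPhaseFrame ν U q) (hv : v ∈ Icc 0 B.l) (hvl : v < B.l) :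
    ∃ s, IsTautTrivialization B ν q (ghMap B ν q) i v (U ×ˢ univ) s := by
  obtain ⟨h, hh, hh1, hh2⟩ := exists_unitHol_right hv hvl
  refine ⟨frameN ν h q, fun y hy => (contDiffAt_frameN hq hh hy.1).contDiffWithinAt,
    fun y hy => (ghMap_eq hq hh hh1 hy.1).symm, fun y hy => ⟨0, fun σ => ?_, ?_⟩⟩
  · rw [coe_frameN hq hh hy.1, frameDat, mkDat_snd]
    simp
  · rw [← primL_eq hv, coe_frameN hq hh hy.1, primL_frameDat hv, hh2]
    simp

lemma hol_eq_one_of_tau_left (hq : IsPhaseFrame ν U q) {O : Set (E3 × ℝ)} (hO : O ⊆ U ×ˢ univ)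
    {s : E3 × ℝ → levelSet B ν} (hs : IsTautTrivialization B ν q (ghMap B ν q) i v O s)
    (hv : v ∈ Icc 0 B.l) (hy : y ∈ O) : hol ν (leftSet i) v q (s y : Dat B) = 1 := by
  have hyU : y.1 ∈ U := (hO hy).1
  have ht : tval ν (s y : Dat B) = y.1 := by
    rw [← Moduli.toE3_proj, hs.lift y hy, ghMap, Moduli.toE3_proj, coe_frameN hq imPart_unitHol hyU,
      tval_frameDat hq hyU]
  obtain ⟨φ, hφ, h1⟩ := hs.tau_left y hy
  have hq' : IsFrame ν (leftSet i) U q :=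
    ⟨hq.isOpen, fun ρ _ t ht h => hq.ne_center t ht ⟨ρ, h.symm⟩, fun ρ _ => hq.smooth ρ,
      fun ρ _ t ht => hq.hopf_eq t ht ρ⟩
  rw [hol_eq_exp (θ := -φ) hq' (ht.symm ▸ hyU) fun ρ _ => by rw [hφ ρ, ht]; simp]
  rw [← primL_eq hv] at h1
  have h2 : ∑ ρ ∈ leftSet i, (-φ) ρ + primL B v (s y : Dat B) = 0 := by
    rw [← leftSum_eq, leftSum]
    simp only [Pi.neg_apply]
    have h3 : (∑ σ : Fin k, if (σ : ℕ) < (i : ℕ) then -φ σ else 0) =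
        -∑ σ : Fin k, if (σ : ℕ) < (i : ℕ) then φ σ else 0 := by
      rw [← Finset.sum_neg_distrib]
      exact Finset.sum_congr rfl fun σ _ => by split_ifs <;> simp
    rw [h3]
    linarith
  rw [h2]
  simp

/-- Writing `hol` in terms of the phases turns the full holonomy into `e^{-iτ}`, which fixes `τ` up
to its period. -/
lemma proj_eq_ghMap_of_hol (hq : IsPhaseFrame ν U q) {x : levelSet B ν} (hU : tval ν (x : Dat B) ∈ U)
    (τ : ℝ) : proj B ν x = ghMap B ν q (tval ν (x : Dat B), τ) ↔
      hol ν Finset.univ B.l q (x : Dat B) = Complex.exp (-(Complex.I * (τ : ℂ))) := by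
  obtain ⟨φ, hφ⟩ := exists_isPhase hq x.2 hU
  have h1 := proj_eq_ghMap hq (x := x) hU hφ
  rw [Moduli.toE3_proj] at h1
  rw [h1, ghMap_periodic hq hU, hol_eq_exp (θ := -φ) hq.isFrame hU fun ρ _ => by
    rw [hφ ρ]; simp, Complex.exp_eq_exp_iff_exists_int]
  refine exists_congr fun n => ?_
  simp only [Pi.neg_apply, Finset.sum_neg_distrib]
  constructor
  · rintro rfl
    push_cast
    ring
  · intro h
    have h2 : Complex.I * ((τ : ℂ) - (((∑ σ, φ σ - primL B B.l (x : Dat B)) +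
        n * (2 * Real.pi) : ℝ) : ℂ)) = 0 := by
      push_cast at h ⊢
      linear_combination h
    have h3 := (mul_eq_zero.1 h2).resolve_left Complex.I_ne_zero
    rw [sub_eq_zero] at h3
    exact_mod_cast h3

/-! ### The connection form -/

lemma holForm_of_qHor {s : Finset (Fin k)} {p H : Dat B} {κ : ℍ[ℝ]} (hp : p ∈ levelSet B ν)
    (h : QHor p κ H) (hv : v ∈ Icc 0 B.l) :
    holForm s v q (tval ν p) p H = κ.re * (v + ∑ ρ ∈ s, 1 / (2 * ‖tval ν p - ν ρ‖)) +
      ∑ ρ ∈ s, phaseForm (q ρ) (tval ν p) (imVec κ) := by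
  rw [holForm, primL_constL hv h.fst, Finset.sum_add_distrib, mul_add, Finset.mul_sum]
  have h1 : ∑ ρ ∈ s, ⟪p.snd ρ * unitQuat 0, H.snd ρ⟫_ℝ / ‖p.snd ρ‖ ^ 2 =
      ∑ ρ ∈ s, κ.re * (1 / (2 * ‖tval ν p - ν ρ‖)) := by
    refine Finset.sum_congr rfl fun ρ hρ => ?_
    rw [h.inner_snd, norm_hopf, (mem_levelSet_iff.1 hp).2]
    ring
  rw [h1, h.dhopf_snd]
  ring

/-- The hypothesis is the formula for all cuts and `v = l`; it gives `a = -(dτ + η) / V`. Inserted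
in the formula for the cuts on the left it yields `-a_v`. -/
lemma tautForm_eq (w : E3 × ℝ) (t : E3) {a : ℝ}
    (ha : -w.2 = a * potential B.l ν t + ∑ σ, phaseForm (q σ) t w.1) :
    a * (v + ∑ ρ ∈ leftSet i, 1 / (2 * ‖t - ν ρ‖)) + ∑ ρ ∈ leftSet i, phaseForm (q ρ) t w.1 =
      -tautForm B ν q i v t w := by
  have h1 : leftPotential ν i v t = v + ∑ ρ ∈ leftSet i, 1 / (2 * ‖t - ν ρ‖) := by
    rw [← leftSum_eq, leftPotential, leftSum]
  have h2 : (∑ σ : Fin k, if (σ : ℕ) < (i : ℕ) then phaseForm (q σ) t w.1 else 0) =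
      ∑ ρ ∈ leftSet i, phaseForm (q ρ) t w.1 := leftSum_eq (fun σ => phaseForm (q σ) t w.1) i
  have h3 : w.2 + ∑ σ, phaseForm (q σ) t w.1 = -(a * potential B.l ν t) := by linarith
  rw [tautForm, h1, h2, h3]
  have := (potential_pos (B := B) (ν := ν) t).ne'
  field_simp
  ring

/-- The Gibbons-Hawking expression is positive definite. This recovers `w` from the projected
velocity of a horizontal curve. -/
lemma ghMap_mfderiv_injective (hq : IsPhaseFrame ν U q) (hy : y.1 ∈ U) :
    Injective (mfderiv 𝓘(ℝ, E3 × ℝ) 𝓘(ℝ, E4) (ghMap B ν q) y) := by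
  refine (injective_iff_map_eq_zero _).2 fun w hw => ?_
  have h1 := ghMap_metric (B := B) hq hy w w
  rw [hw, map_zero, real_inner_self_eq_norm_sq] at h1
  have hV := potential_pos (B := B) (ν := ν) y.1
  set a := w.2 + (∑ σ, phaseForm (q σ) y.1) w.1 with ha
  have h2 : 0 ≤ a * a / potential B.l ν y.1 := div_nonneg (mul_self_nonneg a) hV.le
  have h3 : 0 ≤ potential B.l ν y.1 * ‖w.1‖ ^ 2 := by positivity
  have h4 : potential B.l ν y.1 * ‖w.1‖ ^ 2 = 0 := by linarith
  have h5 : w.1 = 0 := by simpa [hV.ne'] using h4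
  have h6 : a * a / potential B.l ν y.1 = 0 := by linarith
  have h7 : a = 0 := by simpa [hV.ne'] using h6
  rw [ha, h5, map_zero, add_zero] at h7
  exact Prod.ext h5 h7

lemma mfderiv_of_curve {M F : Type} [TopologicalSpace M] [ChartedSpace E4 M]
    [NormedAddCommGroup F] [NormedSpace ℝ F] {Φ : F → M} {y : ℝ → F} {w : F} {c : ℝ → M}
    (hΦ : MDifferentiableAt 𝓘(ℝ, F) 𝓘(ℝ, E4) Φ (y 0)) (hy : HasDerivAt y w 0)
    (he : ∀ᶠ r in 𝓝 0, c r = Φ (y r)) :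
    (mfderiv 𝓘(ℝ, ℝ) 𝓘(ℝ, E4) c 0 1 : E4) = mfderiv 𝓘(ℝ, F) 𝓘(ℝ, E4) Φ (y 0) w := by
  have h1 : HasMFDerivAt 𝓘(ℝ, ℝ) 𝓘(ℝ, F) y 0 (ContinuousLinearMap.toSpanSingleton ℝ w) :=
    hy.hasFDerivAt.hasMFDerivAt
  have h2 := (hΦ.hasMFDerivAt.comp 0 h1).congr_of_eventuallyEq he
  rw [h2.mfderiv]
  change mfderiv 𝓘(ℝ, F) 𝓘(ℝ, E4) Φ (y 0) ((1 : ℝ) • w) = _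
  rw [one_smul]

/-- The coordinates of a curve in the level set. -/
lemma exists_coordinate_curve (hq : IsPhaseFrame ν U q) (hy : y.1 ∈ U) {c : ℝ → levelSet B ν}
    {X : Dat B} (hX : HasDerivAt (fun r => (c r : Dat B)) X 0)
    (h0 : proj B ν (c 0) = ghMap B ν q y) :
    ∃ z : ℝ → E3 × ℝ, z 0 = y ∧ (∀ᶠ r in 𝓝 0, proj B ν (c r) = ghMap B ν q (z r)) ∧
      HasDerivAt z (dhopf ((c 0 : Dat B).snd 0) (X.snd 0),
        -holForm Finset.univ B.l q (tval ν (c 0 : Dat B)) (c 0) X) 0 := by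
  have ht0 : tval ν (c 0 : Dat B) = y.1 := by
    rw [← Moduli.toE3_proj, h0, ghMap, Moduli.toE3_proj, coe_frameN hq imPart_unitHol hy,
      tval_frameDat hq hy]
  have hU0 : tval ν (c 0 : Dat B) ∈ U := ht0.symm ▸ hy
  have ht : HasDerivAt (fun r => tval ν (c r : Dat B)) (dhopf ((c 0 : Dat B).snd 0) (X.snd 0)) 0 :=
    HasFDerivAt.comp_hasDerivAt (l := tval (B := B) ν) (f := fun r => (c r : Dat B)) (0 : ℝ)
      (hasFDerivAt_tval (ν := ν) (c 0 : Dat B)) hX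
  have hev : ∀ᶠ r in 𝓝 (0 : ℝ), tval ν (c r : Dat B) ∈ U :=
    ht.continuousAt.eventually_mem (hq.isOpen.mem_nhds hU0)
  have hh := hasDerivAt_hol (v := B.l) hq.isFrame (c := fun r => (c r : Dat B)) (fun r => (c r).2)
    hU0 hX
  set a := holForm Finset.univ B.l q (tval ν (c 0 : Dat B)) (c 0) X with ha
  have hhol0 : hol ν Finset.univ B.l q (c 0 : Dat B) = Complex.exp (-(Complex.I * (y.2 : ℂ))) := by
    rw [← proj_eq_ghMap_of_hol hq hU0, h0, ht0]
  have hw := hh.mul_const (Complex.exp (Complex.I * (y.2 : ℂ)))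
  have hw0 : hol ν Finset.univ B.l q (c 0 : Dat B) * Complex.exp (Complex.I * (y.2 : ℂ)) = 1 := by
    rw [hhol0, ← Complex.exp_add]; simp
  -- The coordinate `τ` along the curve is `y.2` minus the argument of `hol · e^{i y.2}`; this
  -- number is `1` at the start, so the principal logarithm is differentiable there.
  have hlog := hw.clog_real (by rw [hw0]; exact Complex.one_mem_slitPlane)
  have hτ := ((Complex.imCLM.hasFDerivAt.comp_hasDerivAt (0 : ℝ) hlog).const_sub y.2)
  refine ⟨fun r => (tval ν (c r : Dat B), y.2 - (Complex.log (hol ν Finset.univ B.l q (c r : Dat B) *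
    Complex.exp (Complex.I * (y.2 : ℂ)))).im), ?_, ?_, ht.prodMk (hτ.congr_deriv ?_)⟩
  · simp only [hw0, Complex.log_one, ht0]; simp
  · filter_upwards [hev] with r hr
    rw [proj_eq_ghMap_of_hol hq hr]
    set z := hol ν Finset.univ B.l q (c r : Dat B) with hz
    have hz1 : ‖z‖ = 1 := norm_hol hq.isFrame (c r).2 hr
    have hz2 : ‖z * Complex.exp (Complex.I * (y.2 : ℂ))‖ = 1 := by
      rw [norm_mul, hz1, norm_exp_I, one_mul]
    have hz3 : z * Complex.exp (Complex.I * (y.2 : ℂ)) ≠ 0 := by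
      rw [← norm_ne_zero_iff, hz2]; exact one_ne_zero
    have h1 : Complex.log (z * Complex.exp (Complex.I * (y.2 : ℂ))) = Complex.I *
        ((Complex.log (z * Complex.exp (Complex.I * (y.2 : ℂ)))).im : ℂ) := by
      apply Complex.ext
      · rw [Complex.log_re, hz2]; simp
      · simp
    have h2 := Complex.exp_log hz3
    rw [h1] at h2
    rw [Complex.ofReal_sub, mul_sub, neg_sub, Complex.exp_sub, h2, mul_div_assoc, div_self
      (Complex.exp_ne_zero _), mul_one]
  · rw [mul_right_comm, hw0, one_mul]
    simp

/-- The natural connection in the trivialization of the tautological line bundle. -/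
theorem hasCovDeriv_taut (hq : IsPhaseFrame ν U q) (hv : v ∈ Icc (B.left i) (B.right i))
    {O : Set (E3 × ℝ)} {s : E3 × ℝ → levelSet B ν} (hO : IsOpen O) (hOU : O ⊆ U ×ˢ univ)
    (hs : IsTautTrivialization B ν q (ghMap B ν q) i v O s) (hy : y ∈ O)
    {ψ : Moduli B ν → Taut B ν i v} {χ : E3 × ℝ → ℂ} (hχ : DifferentiableAt ℝ χ y)
    (hψ : ∀ᶠ y' in 𝓝 y, ψ (ghMap B ν q y') = Taut.mk (s y') (χ y')) (w : E3 × ℝ) :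
    HasCovDeriv B ν i v ψ (ghMap B ν q y) (mfderiv 𝓘(ℝ, E3 × ℝ) 𝓘(ℝ, E4) (ghMap B ν q) y w)
      (Taut.mk (s y) (fderiv ℝ χ y w + Complex.I * (tautForm B ν q i v y.1 w : ℂ) * χ y)) := by
  intro c χc hc0 hc hhor hproj hψc
  have hyU : y.1 ∈ U := (hOU hy).1
  have hvl := Bow.mem_Icc hv
  set X := deriv (fun r => (c r : Dat B)) 0 with hXdef
  have hX : HasDerivAt (fun r => (c r : Dat B)) X 0 := (hc.differentiableAt (by simp)).hasDerivAt
  obtain ⟨z, hz0, hz, hzd⟩ := exists_coordinate_curve hq hyU hX hc0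
  have hwz : w = (dhopf ((c 0 : Dat B).snd 0) (X.snd 0),
      -holForm Finset.univ B.l q (tval ν (c 0 : Dat B)) (c 0) X) := by
    refine ghMap_mfderiv_injective (B := B) (ν := ν) hq hyU ?_
    have h1 : MDifferentiableAt 𝓘(ℝ, E3 × ℝ) 𝓘(ℝ, E4) (ghMap B ν q) (z 0) := by
      rw [hz0]
      exact (contMDiffAt_proj_comp (contDiffAt_frameN hq imPart_unitHol hyU)).mdifferentiableAt
        (by simp)
    have h2 := mfderiv_of_curve h1 hzd hz
    rw [hz0] at h2
    exact hproj.symm.trans h2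
  have ht0 : tval ν (c 0 : Dat B) = y.1 := by
    rw [← Moduli.toE3_proj, hc0, ghMap, Moduli.toE3_proj, coe_frameN hq imPart_unitHol hyU,
      tval_frameDat hq hyU]
  have hU0 : tval ν (c 0 : Dat B) ∈ U := ht0.symm ▸ hyU
  have hvel : IsVel ν (c 0 : Dat B) X :=
    ⟨fun r => c r, fun r => (c r).2, rfl, hc, hX⟩
  obtain ⟨H, hH⟩ := exists_isHorPart hvel
  have hHX := hH.eq_of_horizontal hhor
  obtain ⟨⟨κ, hκ⟩, -⟩ := hH
  rw [hHX] at hκ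
  have hκw : imVec κ = w.1 := by rw [hwz, hκ.dhopf_snd]
  have hform := holForm_of_qHor (s := leftSet i) (q := q) (c 0).2 hκ hvl
  have hformL := holForm_of_qHor (s := Finset.univ) (q := q) (c 0).2 hκ Bow.l_mem
  rw [ht0, hκw] at hform hformL
  have hw2 : -w.2 = holForm Finset.univ B.l q y.1 (c 0) X := by rw [hwz, ← ht0, neg_neg]
  -- Along the horizontal curve the left `hol` has logarithmic derivative `-i a_v`.
  rw [tautForm_eq w y.1 (hw2.trans hformL)] at hform
  have hql : IsFrame ν (leftSet i) U q :=
    ⟨hq.isOpen, fun ρ _ t ht h => hq.ne_center t ht ⟨ρ, h.symm⟩, fun ρ _ => hq.smooth ρ,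
      fun ρ _ t ht => hq.hopf_eq t ht ρ⟩
  have hhol := hasDerivAt_hol (v := v) hql (c := fun r => (c r : Dat B)) (fun r => (c r).2) hU0 hX
  rw [ht0, hform] at hhol
  set Hc := fun r => hol ν (leftSet i) v q (c r : Dat B) with hHc
  have hHc0 : Hc 0 ≠ 0 := by
    rw [← norm_ne_zero_iff, hHc, norm_hol hql (c 0).2 hU0]; exact one_ne_zero
  have hzt : Tendsto z (𝓝 0) (𝓝 y) := hz0 ▸ hzd.continuousAt
  have hrel : ∀ᶠ r in 𝓝 0, (Taut.mk (c r) (χc r) : Taut B ν i v) = Taut.mk (s (z r)) (χ (z r)) ∧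
      z r ∈ O := by
    filter_upwards [hψc, hz, hzt.eventually hψ, hzt.eventually (hO.mem_nhds hy)]
      with r h1 h2 h3 h4
    rw [← h1, h2, h3]
    exact ⟨rfl, h4⟩
  -- The trivialization `s` has left `hol` equal to `1`, so the gauge transformation from `c r` to
  -- `s (z r)` has the value `(Hc r)⁻¹` at `v`. Differentiating `χ · Hc⁻¹` then produces the term `i
  -- a_v χ`.
  have hχc : ∀ᶠ r in 𝓝 0, χc r = χ (z r) * (Hc r)⁻¹ := by
    filter_upwards [hrel] with r hr
    obtain ⟨θ, hθ, h1⟩ := (Taut.mk_eq_iff hv).1 hr.1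
    have h2 := hol_gauge_left (ν := ν) (i := i) (v := v) q hθ
    rw [hol_eq_one_of_tau_left hq hOU hs hvl hr.2] at h2
    have h3 : (Hc r)⁻¹ = Complex.exp (Complex.I * (gaugeAngle (c r : Dat B) (s (z r)) θ i v : ℂ)) :=
      inv_eq_of_mul_eq_one_right h2.symm
    rw [h3, h1, mul_right_comm, ← Complex.exp_add]
    simp
  have hχz : HasDerivAt (fun r => χ (z r)) (fderiv ℝ χ y w) 0 := by
    rw [hwz]
    have h1 : HasFDerivAt χ (fderiv ℝ χ y) (z 0) := by rw [hz0]; exact hχ.hasFDerivAt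
    exact h1.comp_hasDerivAt (0 : ℝ) hzd
  have hder := (hχz.mul (hhol.fun_inv hHc0)).congr_of_eventuallyEq hχc
  refine ⟨_, hder, ?_⟩
  obtain ⟨θ, hθ, -⟩ := (Taut.mk_eq_iff hv).1 hrel.self_of_nhds.1
  rw [hz0] at hθ
  refine ((Taut.mk_eq_iff hv).2 ⟨θ, hθ, ?_⟩).symm
  have h2 := hol_gauge_left (ν := ν) (i := i) (v := v) q hθ
  rw [hol_eq_one_of_tau_left hq hOU hs hvl hy] at h2
  have h3 : Hc 0 = Complex.exp (-(Complex.I * (gaugeAngle (c 0 : Dat B) (s y) θ i v : ℂ))) := by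
    rw [Complex.exp_neg]
    exact eq_inv_of_mul_eq_one_left h2.symm
  rw [← h3]
  simp only [hz0]
  change _ = Hc 0 * (_ * (Hc 0)⁻¹ + χ y * (-(Hc 0 * _) / Hc 0 ^ 2))
  push_cast
  field_simp

end Connection

end Taut

end

end SmallBow

end

/-! ### Assembly of the theorem -/

theorem mainTheorem5 (k : ℕ) (hk : 0 < k) (B : SmallBow.Bow k) (ν : Fin k → SmallBow.E3)
    (hν : Function.Injective ν) :
    -- `μ` is the hyperkähler moment map of the gauge group action
    (∀ (f : Fin (k + 1) → ℝ → ℝ) (x X : SmallBow.Dat B), SmallBow.IsBowH1 B f →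
      SmallBow.IsGenerated B f x X → ∀ j : Fin 3,
      HasFDerivAt (SmallBow.momentMap B f j)
        (innerSL ℝ (SmallBow.leftMul B (SmallBow.unitQuat j) X)) x) ∧
    -- the hyperkähler quotient is a hyperkähler four-manifold, the multi-Taub-NUT space
    ∃ (_ : ChartedSpace SmallBow.E4 (SmallBow.Moduli B ν))
      (_ : IsManifold 𝓘(ℝ, SmallBow.E4) ∞ (SmallBow.Moduli B ν))
      (g : SmallBow.SmoothMetric (SmallBow.Moduli B ν))
      (Ω : Fin 3 → SmallBow.BilinField (SmallBow.Moduli B ν))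
      (π : SmallBow.Moduli B ν → SmallBow.E3)
      (act : Circle → SmallBow.Moduli B ν → SmallBow.Moduli B ν),
      SmallBow.IsHyperkahlerQuotient B ν g Ω ∧
      SmallBow.IsHyperkahler g Ω ∧
      SmallBow.IsMultiTaubNUT B.l ν g π act ∧
      -- the circle action is triholomorphic
      (∀ z m u v j, Ω j (act z m) (mfderiv 𝓘(ℝ, SmallBow.E4) 𝓘(ℝ, SmallBow.E4) (act z) m u)
        (mfderiv 𝓘(ℝ, SmallBow.E4) 𝓘(ℝ, SmallBow.E4) (act z) m v) = Ω j m u v) ∧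
      -- the map to `ℝ³` and the circle action in terms of the bow data
      (∀ x : SmallBow.levelSet B ν,
        (∀ᵐ s ∂(volume : Measure ℝ).restrict (Icc 0 B.l),
          SmallBow.imVec ((x : SmallBow.Dat B).fst s) = π (SmallBow.proj B ν x)) ∧
        (∀ σ, SmallBow.hopf ((x : SmallBow.Dat B).snd σ) = π (SmallBow.proj B ν x) - ν σ) ∧
        ∀ σ z, ∃ h : SmallBow.rotate B σ z x ∈ SmallBow.levelSet B ν,
          act z (SmallBow.proj B ν x) = SmallBow.proj B ν ⟨SmallBow.rotate B σ z x, h⟩) ∧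
      -- the tautological line bundles
      (∀ i, ∀ v ∈ Icc (B.left i) (B.right i), SmallBow.IsSmoothLineBundle B ν i v) ∧
      -- local coordinates: they exist near every point that is not a center, and
      (∀ t, t ∉ range ν → ∃ U q, t ∈ U ∧ SmallBow.IsPhaseFrame ν U q) ∧
      ∀ U q, SmallBow.IsPhaseFrame ν U q →
        (∀ σ, ∀ t ∈ U,
          SmallBow.CurvatureEq (SmallBow.phaseForm (q σ)) (fun t' => 1 / (2 * ‖t' - ν σ‖)) t) ∧
        ∃ Φ : SmallBow.E3 × ℝ → SmallBow.Moduli B ν,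
          -- the metric is `V dt² + (dτ + η)² / V` with `η = Σ_σ η_σ`,
          SmallBow.IsGibbonsHawkingChart B.l ν g π act U
            (fun t => ∑ σ, SmallBow.phaseForm (q σ) t) Φ ∧
          -- where `τ = Σ_σ φ_σ - ∫ t₀ ds`, and
          (∀ (x : SmallBow.levelSet B ν) (φ : Fin k → ℝ), π (SmallBow.proj B ν x) ∈ U →
            SmallBow.IsPhase B q x (π (SmallBow.proj B ν x)) φ →
            SmallBow.proj B ν x = Φ (π (SmallBow.proj B ν x),
              (∑ σ, φ σ) - ∫ s in (0 : ℝ)..B.l, ((x : SmallBow.Dat B).fst s).re)) ∧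
          -- `L_v` has the connection `d + i a_v` in the trivialization given by `τ_l`
          ∀ i, ∀ v ∈ Icc (B.left i) (B.right i),
            (v < B.l → ∃ s, SmallBow.IsTautTrivialization B ν q Φ i v (U ×ˢ univ) s) ∧
            ∀ O s, IsOpen O → O ⊆ U ×ˢ univ → SmallBow.IsTautTrivialization B ν q Φ i v O s →
              ∀ y ∈ O, ∀ (ψ : SmallBow.Moduli B ν → SmallBow.Taut B ν i v)
                (χ : SmallBow.E3 × ℝ → ℂ), DifferentiableAt ℝ χ y →
                (∀ᶠ y' in 𝓝 y, ψ (Φ y') = SmallBow.Taut.mk (s y') (χ y')) →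
                ∀ w : SmallBow.E3 × ℝ, SmallBow.HasCovDeriv B ν i v ψ (Φ y)
                  (mfderiv 𝓘(ℝ, SmallBow.E3 × ℝ) 𝓘(ℝ, SmallBow.E4) Φ y w)
                  (SmallBow.Taut.mk (s y) (fderiv ℝ χ y w +
                    Complex.I * (SmallBow.tautForm B ν q i v y.1 w : ℂ) * χ y)) := by
  have : NeZero k := ⟨hk.ne'⟩
  have : Fact (Injective ν) := ⟨hν⟩
  refine ⟨fun f x X _ hX j => SmallBow.hasFDerivAt_momentMap hX j, inferInstance, inferInstance,
    SmallBow.moduliMetric B ν, SmallBow.moduliForm B ν, SmallBow.Moduli.toE3, SmallBow.Moduli.act,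
    SmallBow.isHyperkahlerQuotient_moduli, SmallBow.isHyperkahler_moduli,
    SmallBow.isMultiTaubNUT_moduli,
    fun z m u v j => SmallBow.mform_act (SmallBow.unitQuat j) z m u v, fun x => ⟨?_, ?_, ?_⟩,
    fun i v hv => SmallBow.isSmoothLineBundle_taut hv, fun t ht => SmallBow.exists_isPhaseFrame ht,
    fun U q hq => ⟨fun σ t ht => SmallBow.curvatureEq_phaseForm hq.isOpen (hq.smooth σ)
      (fun t ht => hq.hopf_eq t ht σ) (fun t ht => hq.ne_zero ht σ) ht,
      SmallBow.ghMap B ν q, SmallBow.isGibbonsHawkingChart_ghMap hq, fun x φ hU hφ => ?_,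
      fun i v hv => ⟨fun hvl => SmallBow.exists_isTautTrivialization hq (SmallBow.Bow.mem_Icc hv) hvl,
        fun O s hO hOU hs y hy ψ χ hχ hψ w =>
          SmallBow.hasCovDeriv_taut hq hv hO hOU hs hy hχ hψ w⟩⟩⟩
  · exact SmallBow.imVec_ae_of_imPart (SmallBow.mem_levelSet_iff.1 x.2).1
  · exact (SmallBow.mem_levelSet_iff.1 x.2).2
  · exact fun σ z => ⟨SmallBow.rotate_mem σ z x.2, SmallBow.act_proj_rotate σ z x⟩
  · rw [← SmallBow.primL_eq SmallBow.Bow.l_mem]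
    exact SmallBow.proj_eq_ghMap hq hU hφ
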